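/- Let $n,m,p\ge 0$ and consider the plant $\mathbf{x}_{t+1}=\mathbf{A}\mathbf{x}_t+\mathbf{B}\mathbf{u}_t+\mathbf{w}_t$, $\mathbf{x}_t=[(\mathbf{x}^1_t)^{\mathrm T},(\mathbf{x}^2_t)^{\mathrm T}]^{\mathrm T}\in\mathbb{R}^{n}\times\mathbb{R}^{m}$, $\mathbf{u}_t\in\mathbb{R}^p$, where the $\mathbf{w}_t$ are IID $\mathcal N(\mathbf 0,\mathbf W)$ with $\mathbf W=\mathrm{diag}(\mathbf W_{11},\mathbf W_{22})$, $\mathbf W_{11},\mathbf W_{22}\succ 0$. Write $\mathbf A_{ij}$ for the blocks of $\mathbf A$ and $\bar{\mathbf A}=[\mathbf A_{11}^{\mathrm T},\mathbf A_{21}^{\mathrm T}]^{\mathrm T}$. Let $\mathbf Q,\mathbf R\succ0$, let $\mathbf S\succeq 0$ be a stabilizing solution of $\mathbf S=\mathbf A^{\mathrm T}\mathbf S\mathbf A-\mathbf A^{\mathrm T}\mathbf S\mathbf B(\mathbf B^{\mathrm T}\mathbf S\mathbf B+\mathbf R)^{-1}\mathbf B^{\mathrm T}\mathbf S\mathbf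 A+\mathbf Q$, and let $\mathbf K=-(\mathbf B^{\mathrm T}\mathbf S\mathbf B+\mathbf R)^{-1}\mathbf B^{\mathrm T}\mathbf S\mathbf A$. Let $\mathbf C_1\in\mathbb R^{n\times n}$. All logarithms are to base 2 and information is measured in bits. *Gaussian test channel.* $\mathbf x^{\mathrm G}_1$ is Gaussian, $\mathbf y^{\mathrm G}_t=\mathbf C_1\mathbf x^{\mathrm G,1}_t+\mathbf v_t$ with $\mathbf v_t$ IID $\mathcal N(\mathbf 0,\mathbf I)$; $\hat{\mathbf x}^{\mathrm G,1}_t$ is the linear minimum mean squared error (LMMSE) estimate of $\mathbf x^{\mathrm G,1}_t$ given $\mathbf y^{\mathrm G}_{1:t},\mathbf x^{\mathrm G,2}_{1:t}$, and $\mathbf u^{\mathrm G}_t=\mathbf K[(\hat{\mathbf x}^{\mathrm G,1}_t)^{\mathrm T},(\mathbf x^{\mathrm G,2}_t)^{\mathrm T}]^{\mathrm T}$. Put $I(\mathbf x^{\mathrm G}_{1:T}\to\mathbf y^{\mathrm G}_{1:T}\|\mathbf x^{\mathrm G,2}_{1:T})=\sum_{t=1}^{T}I(\mathbf x^{\mathrm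 G}_{1:t};\mathbf y^{\mathrm G}_t\,|\,\mathbf y^{\mathrm G}_{1:t-1},\mathbf x^{\mathrm G,2}_{1:t})$. *Quantized architecture.* Let $\Delta=2\sqrt3$ and let $\mathbf q_\Delta$ round each coordinate to the nearest multiple of $\Delta$ (coordinates in $[j\Delta-\Delta/2,j\Delta+\Delta/2)$ go to $j\Delta$). Let the dithers $\mathbf d_t$ be IID with IID $\mathrm{Uniform}[-\Delta/2,\Delta/2)$ coordinates, independent of the plant noise and of the initial state, and known to encoder and decoder. The initial state $\mathbf x_1$ is square integrable with the same first and second moments as $\mathbf x_1^{\mathrm G}$. At time $t$, $\tilde{\mathbf x}^1_t$ is the LMMSE estimate of $\mathbf x^1_t$ given $\mathbf y_{1:t-1},\mathbf x^2_{1:t}$; the quantizer output is $\tilde{\mathbf z}_t=\mathbf q_\Delta(\mathbf C_1(\mathbf x^1_t-\tilde{\mathbf x}^1_t)+\mathbf d_t)$; $\mathbf y_t=\tilde{\mathbf z}_t-\mathbf d_t$; $\hat{\mathbf x}^1_t$ is the LMMSE estimate of $\mathbf x^1_t$ given $\mathbf y_{1:t},\mathbf x^2_{1:t}$; and $\mathbf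 u_t=\mathbf K[(\hat{\mathbf x}^1_t)^{\mathrm T},(\mathbf x^2_t)^{\mathrm T}]^{\mathrm T}$. The transmitted codeword $\mathbf a_t\in\{0,1\}^*$ is the Shannon–Fano–Elias codeword of $\tilde{\mathbf z}_t$ for the conditional probability mass function of $\tilde{\mathbf z}_t$ given the value of the dither $\mathbf d_t$ (for an arbitrary enumeration of the alphabet); $\ell(\mathbf a_t)$ is its length. Let $k=2+\frac n2\log_2\frac{4\pi e}{12}$. Then the code used at each time is prefix-free and lossless (given the dither), and $$\limsup_{T\to\infty}\frac1T\sum_{t=1}^{T}\mathbb E[\ell(\mathbf a_t)]\le\limsup_{T\to\infty}\frac1T I(\mathbf x^{\mathrm G}_{1:T}\to\mathbf y^{\mathrm G}_{1:T}\|\mathbf x^{\mathrm G,2}_{1:T})+k .$$ Moreover, let $\boldsymbol\Theta$ be the upper left $n\times n$ block of $\mathbf K^{\mathrm T}(\mathbf B^{\mathrm T}\mathbf S\mathbf B+\mathbf R)\mathbf K$, let $\gamma\in\mathbb R$, and let $(\hat{\mathbf P}_{\min},\boldsymbol\Pi_{\min})$ minimize $$\tfrac12\bigl(\log\det\mathbf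 W-\log\det\boldsymbol\Pi-\log\det(\mathbf W_{22}+\mathbf A_{21}\hat{\mathbf P}\mathbf A_{21}^{\mathrm T})\bigr)$$ over $\hat{\mathbf P}\succ0$, $\boldsymbol\Pi\succeq0$ (with $-\log 0=+\infty$; a minimizer has $\boldsymbol\Pi_{\min}\succ 0$) subject to $\mathrm{Tr}(\boldsymbol\Theta\hat{\mathbf P})+\mathrm{Tr}(\mathbf S\mathbf W)\le\gamma$, $$\mathbf W+\bar{\mathbf A}\hat{\mathbf P}\bar{\mathbf A}^{\mathrm T}-\begin{bmatrix}\hat{\mathbf P}&0\\0&0\end{bmatrix}\succeq0,\qquad \begin{bmatrix}\hat{\mathbf P}-\boldsymbol\Pi&\hat{\mathbf P}\bar{\mathbf A}^{\mathrm T}\\ \bar{\mathbf A}\hat{\mathbf P}&\mathbf W+\bar{\mathbf A}\hat{\mathbf P}\bar{\mathbf A}^{\mathrm T}\end{bmatrix}\succeq0 .$$ Put $\tilde{\mathbf P}_{\min}=\mathbf W_{11}+\mathbf A_{11}(\hat{\mathbf P}_{\min}^{-1}+\mathbf A_{21}^{\mathrm T}\mathbf W_{22}^{-1}\mathbf A_{21})^{-1}\mathbf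 A_{11}^{\mathrm T}$. If $\mathbf C_1^{\mathrm T}\mathbf C_1=\hat{\mathbf P}_{\min}^{-1}-\tilde{\mathbf P}_{\min}^{-1}$, then $$\limsup_{T\to\infty}\frac1T I(\mathbf x^{\mathrm G}_{1:T}\to\mathbf y^{\mathrm G}_{1:T}\|\mathbf x^{\mathrm G,2}_{1:T})=\tfrac12\bigl(\log\det\tilde{\mathbf P}_{\min}-\log\det\hat{\mathbf P}_{\min}\bigr),$$ and hence $$\limsup_{T\to\infty}\frac1T\sum_{t=1}^{T}\mathbb E[\ell(\mathbf a_t)]\le k+\tfrac12\bigl(\log\det\tilde{\mathbf P}_{\min}-\log\det\hat{\mathbf P}_{\min}\bigr).$$ -/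

import Mathlib

open MeasureTheory ProbabilityTheory Matrix
open scoped ENNReal

namespace LQGSI

noncomputable section

/-! ### Plant and certainty-equivalence controller -/

/-- Plant data: the state is `x = (x¹, x²) ∈ ℝⁿ × ℝᵐ`, the control lies in `ℝᵖ`. -/
structure Plant (n m p : ℕ) where
  A : Matrix (Fin n ⊕ Fin m) (Fin n ⊕ Fin m) ℝ
  B : Matrix (Fin n ⊕ Fin m) (Fin p) ℝ
  W₁₁ : Matrix (Fin n) (Fin n) ℝ
  W₂₂ : Matrix (Fin m) (Fin m) ℝ
  Q : Matrix (Fin n ⊕ Fin m) (Fin n ⊕ Fin m) ℝ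
  R : Matrix (Fin p) (Fin p) ℝ
  posDef_W₁₁ : W₁₁.PosDef
  posDef_W₂₂ : W₂₂.PosDef
  posDef_Q : Q.PosDef
  posDef_R : R.PosDef

namespace Plant

variable {n m p : ℕ} (M : Plant n m p)

/-- Covariance of the process noise. -/
def W : Matrix (Fin n ⊕ Fin m) (Fin n ⊕ Fin m) ℝ := fromBlocks M.W₁₁ 0 0 M.W₂₂

def A₁₁ : Matrix (Fin n) (Fin n) ℝ := M.A.toBlocks₁₁

def A₂₁ : Matrix (Fin m) (Fin n) ℝ := M.A.toBlocks₂₁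

/-- The first block column `[A₁₁; A₂₁]` of `A`. -/
def Abar : Matrix (Fin n ⊕ Fin m) (Fin n) ℝ := M.A.submatrix id Sum.inl

/-- The feedback gain `K = -(BᵀSB + R)⁻¹ BᵀSA`. -/
def gain (S : Matrix (Fin n ⊕ Fin m) (Fin n ⊕ Fin m) ℝ) : Matrix (Fin p) (Fin n ⊕ Fin m) ℝ :=
  -((M.Bᵀ * S * M.B + M.R)⁻¹ * M.Bᵀ * S * M.A)

/-- `S` is a stabilizing solution of the control algebraic Riccati equation. -/
structure IsStabilizingSolution (S : Matrix (Fin n ⊕ Fin m) (Fin n ⊕ Fin m) ℝ) : Prop where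
  posSemidef : S.PosSemidef
  riccati : S = M.Aᵀ * S * M.A
    - M.Aᵀ * S * M.B * (M.Bᵀ * S * M.B + M.R)⁻¹ * M.Bᵀ * S * M.A + M.Q
  stabilizing : ∀ z ∈ spectrum ℂ ((M.A + M.B * M.gain S).map (algebraMap ℝ ℂ)), ‖z‖ < 1

/-- The upper left `n × n` block of `Kᵀ(BᵀSB + R)K`. -/
def Theta (S : Matrix (Fin n ⊕ Fin m) (Fin n ⊕ Fin m) ℝ) : Matrix (Fin n) (Fin n) ℝ :=
  ((M.gain S)ᵀ * (M.Bᵀ * S * M.B + M.R) * M.gain S).toBlocks₁₁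

/-! ### The log-determinant program -/

/-- Feasible points of the log-determinant program. The program asks for `Π ⪰ 0`; a singular `Π`
has objective value `-log det Π = +∞`, so the domain is restricted to `Π ≻ 0`. -/
structure Feasible (S : Matrix (Fin n ⊕ Fin m) (Fin n ⊕ Fin m) ℝ) (γ : ℝ)
    (Phat Pi : Matrix (Fin n) (Fin n) ℝ) : Prop where
  posDef_Phat : Phat.PosDef
  posDef_Pi : Pi.PosDef
  control : (M.Theta S * Phat).trace + (S * M.W).trace ≤ γ
  lmi₁ : (M.W + M.Abar * Phat * M.Abarᵀ - fromBlocks Phat 0 0 0).PosSemidef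
  lmi₂ : (fromBlocks (Phat - Pi) (Phat * M.Abarᵀ) (M.Abar * Phat)
    (M.W + M.Abar * Phat * M.Abarᵀ)).PosSemidef

/-- Objective of the log-determinant program (in bits). -/
def objective (Phat Pi : Matrix (Fin n) (Fin n) ℝ) : ℝ :=
  (Real.logb 2 M.W.det - Real.logb 2 Pi.det
    - Real.logb 2 (M.W₂₂ + M.A₂₁ * Phat * M.A₂₁ᵀ).det) / 2

/-- `(Phat, Pi)` is a minimizer of the log-determinant program. -/
def IsMinimizer (S : Matrix (Fin n ⊕ Fin m) (Fin n ⊕ Fin m) ℝ) (γ : ℝ)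
    (Phat Pi : Matrix (Fin n) (Fin n) ℝ) : Prop :=
  M.Feasible S γ Phat Pi ∧
    ∀ Phat' Pi', M.Feasible S γ Phat' Pi' → M.objective Phat Pi ≤ M.objective Phat' Pi'

/-- The a priori error covariance `P̃ = W₁₁ + A₁₁ (P̂⁻¹ + A₂₁ᵀ W₂₂⁻¹ A₂₁)⁻¹ A₁₁ᵀ`. -/
def Ptilde (Phat : Matrix (Fin n) (Fin n) ℝ) : Matrix (Fin n) (Fin n) ℝ :=
  M.W₁₁ + M.A₁₁ * (Phat⁻¹ + M.A₂₁ᵀ * M.W₂₂⁻¹ * M.A₂₁)⁻¹ * M.A₁₁ᵀ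

end Plant

/-! ### Estimation and primitive random variables

Time is indexed by `ℕ`, starting at `0`. -/

/-- `Xhat` is the linear (affine) minimum mean squared error estimate of the random vector `X`
from the random vector `Y`. It is used for square integrable `X` and `Y` only. -/
def IsLMMSE {Ω ι κ : Type*} [Fintype ι] [Fintype κ] [MeasurableSpace Ω] (P : Measure Ω)
    (X : Ω → ι → ℝ) (Y : Ω → κ → ℝ) (Xhat : Ω → ι → ℝ) : Prop :=
  ∃ (L : Matrix ι κ ℝ) (b : ι → ℝ), (∀ ω, Xhat ω = L *ᵥ Y ω + b) ∧
    ∀ (L' : Matrix ι κ ℝ) (b' : ι → ℝ),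
      ∫ ω, ∑ i, (X ω i - Xhat ω i) ^ 2 ∂P ≤ ∫ ω, ∑ i, (X ω i - (L' *ᵥ Y ω + b') i) ^ 2 ∂P

/-- The component `x¹` of the state. -/
def fstPart {n m : ℕ} (x : Fin n ⊕ Fin m → ℝ) : Fin n → ℝ := fun i => x (Sum.inl i)

/-- The component `x²` of the state (the side information). -/
def sndPart {n m : ℕ} (x : Fin n ⊕ Fin m → ℝ) : Fin m → ℝ := fun i => x (Sum.inr i)

/-- The vector made of the first `r` samples of `y` and the first `s` samples of `x²`. -/
def observations {Ω : Type*} {n m : ℕ} (y : ℕ → Ω → Fin n → ℝ) (x : ℕ → Ω → Fin n ⊕ Fin m → ℝ)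
    (r s : ℕ) : Ω → (Fin r × Fin n) ⊕ (Fin s × Fin m) → ℝ :=
  fun ω => Sum.elim (fun j => y j.1 ω j.2) (fun j => sndPart (x j.1 ω) j.2)

/-- The centered Gaussian law on `ℝ^ι` with covariance matrix `V`. -/
def gaussianLaw {ι : Type*} [Fintype ι] [DecidableEq ι] (V : Matrix ι ι ℝ) : Measure (ι → ℝ) :=
  (multivariateGaussian 0 V).map (fun z i => z i)

/-- The law of a vector with independent `Uniform[-Δ/2, Δ/2)` coordinates. -/
def ditherLaw (n : ℕ) (Δ : ℝ) : Measure (Fin n → ℝ) :=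
  ProbabilityTheory.cond volume (Set.univ.pi fun _ => Set.Ico (-(Δ / 2)) (Δ / 2))

/-- `x₀` and all the `w t`, `v t` are mutually independent, the `w t` have law `lw` and the `v t`
have law `lv`. -/
structure IsPrimitive {Ω α β : Type*} [MeasurableSpace Ω] [MeasurableSpace α] [MeasurableSpace β]
    (P : Measure Ω) (x₀ : Ω → α) (w : ℕ → Ω → α) (v : ℕ → Ω → β) (lw : Measure α)
    (lv : Measure β) : Prop where
  measurable_init : Measurable x₀
  measurable_w : ∀ t, Measurable (w t)
  measurable_v : ∀ t, Measurable (v t)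
  law_w : ∀ t, P.map (w t) = lw
  law_v : ∀ t, P.map (v t) = lv
  iIndep_w : iIndepFun w P
  iIndep_v : iIndepFun v P
  indep_w_v : IndepFun (fun ω t => w t ω) (fun ω t => v t ω) P
  indep_init : IndepFun x₀ (fun ω => (fun t => w t ω, fun t => v t ω)) P

/-! ### The Gaussian three-stage test channel -/

/-- The closed loop formed by the plant, the sensor `y = C₁ x¹ + v`, `v ∼ N(0, I)`, the Kalman
filter and the controller `u = K [x̂¹; x²]`. -/
structure IsGaussianLoop {Ω : Type*} [MeasurableSpace Ω] {n m p : ℕ} (M : Plant n m p)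
    (K : Matrix (Fin p) (Fin n ⊕ Fin m) ℝ) (C₁ : Matrix (Fin n) (Fin n) ℝ) (P : Measure Ω)
    (x w : ℕ → Ω → Fin n ⊕ Fin m → ℝ) (v y xhat : ℕ → Ω → Fin n → ℝ)
    (u : ℕ → Ω → Fin p → ℝ) : Prop where
  primitive : IsPrimitive P (x 0) w v (gaussianLaw M.W) (gaussianLaw 1)
  init : HasGaussianLaw (x 0) P
  plant : ∀ t ω, x (t + 1) ω = M.A *ᵥ x t ω + M.B *ᵥ u t ω + w t ω
  sensor : ∀ t ω, y t ω = C₁ *ᵥ fstPart (x t ω) + v t ω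
  filter : ∀ t, IsLMMSE P (fun ω => fstPart (x t ω)) (observations y x (t + 1) (t + 1)) (xhat t)
  control : ∀ t ω, u t ω = K *ᵥ Sum.elim (xhat t ω) (sndPart (x t ω))

/-! ### The quantized loop -/

/-- Elementwise uniform quantizer of sensitivity `Δ`, as an integer vector: coordinate `i` is the
integer `k` with `z i ∈ [kΔ - Δ/2, kΔ + Δ/2)`. -/
def quantIndex {n : ℕ} (Δ : ℝ) (z : Fin n → ℝ) : Fin n → ℤ := fun i => ⌊z i / Δ + 1 / 2⌋

/-- Elementwise uniform quantizer of sensitivity `Δ`. -/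
def quantize {n : ℕ} (Δ : ℝ) (z : Fin n → ℝ) : Fin n → ℝ := fun i => quantIndex Δ z i * Δ

/-- The closed loop with predictive quantization of the innovations and subtractive dither `d`:
`xtil` and `xhat` are the a priori and a posteriori LMMSE estimates of `x¹`, `zidx` is the output
of the quantizer in units of `Δ` (the symbol that is entropy coded), and `y` is the measurement
reconstructed by the decoder. -/
structure IsQuantizedLoop {Ω : Type*} [MeasurableSpace Ω] {n m p : ℕ} (M : Plant n m p)
    (K : Matrix (Fin p) (Fin n ⊕ Fin m) ℝ) (C₁ : Matrix (Fin n) (Fin n) ℝ) (Δ : ℝ) (P : Measure Ω)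
    (x w : ℕ → Ω → Fin n ⊕ Fin m → ℝ) (d xtil : ℕ → Ω → Fin n → ℝ) (zidx : ℕ → Ω → Fin n → ℤ)
    (y xhat : ℕ → Ω → Fin n → ℝ) (u : ℕ → Ω → Fin p → ℝ) : Prop where
  primitive : IsPrimitive P (x 0) w d (gaussianLaw M.W) (ditherLaw n Δ)
  init : MemLp (x 0) 2 P
  plant : ∀ t ω, x (t + 1) ω = M.A *ᵥ x t ω + M.B *ᵥ u t ω + w t ω
  predict : ∀ t, IsLMMSE P (fun ω => fstPart (x t ω)) (observations y x t (t + 1)) (xtil t)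
  quant : ∀ t ω, zidx t ω = quantIndex Δ (C₁ *ᵥ (fstPart (x t ω) - xtil t ω) + d t ω)
  reconstruct : ∀ t ω,
    y t ω = quantize Δ (C₁ *ᵥ (fstPart (x t ω) - xtil t ω) + d t ω) - d t ω
  filter : ∀ t, IsLMMSE P (fun ω => fstPart (x t ω)) (observations y x (t + 1) (t + 1)) (xhat t)
  control : ∀ t ω, u t ω = K *ᵥ Sum.elim (xhat t ω) (sndPart (x t ω))

/-! ### Shannon–Fano–Elias coding -/

/-- Modified cumulative distribution function `∑_{b < a} q b + q a / 2` of the probability mass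
function `q`, the alphabet being ordered by the enumeration `e`. -/
def sfeCDF {α : Type*} (e : α ↪ ℕ) (q : α → ℝ) (a : α) : ℝ :=
  (∑' b, if e b < e a then q b else 0) + q a / 2

/-- Codeword length `⌈log₂ (1 / q a)⌉ + 1`. -/
def sfeLength {α : Type*} (q : α → ℝ) (a : α) : ℕ := ⌈Real.logb 2 (1 / q a)⌉₊ + 1

/-- The Shannon–Fano–Elias codeword of `a`: the first `sfeLength q a` binary digits of
`sfeCDF e q a ∈ (0, 1)`. -/
def sfeCode {α : Type*} (e : α ↪ ℕ) (q : α → ℝ) (a : α) : List Bool :=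
  (List.range (sfeLength q a)).map fun i => decide (⌊sfeCDF e q a * 2 ^ (i + 1)⌋ % 2 = 1)

/-- `c` is prefix-free on the alphabet `s`: no codeword is a prefix of that of another symbol. -/
def IsPrefixFreeOn {α : Type*} (c : α → List Bool) (s : Set α) : Prop :=
  ∀ a ∈ s, ∀ b ∈ s, a ≠ b → ¬ c a <+: c b

/-- The conditional probability mass function of the discrete variable `Z` given `D = δ`. -/
def condPMF {Ω β : Type*} [MeasurableSpace Ω] [MeasurableSpace β] {n : ℕ} (P : Measure Ω)
    [IsFiniteMeasure P] (Z : Ω → Fin n → ℤ) (D : Ω → β) (δ : β) (k : Fin n → ℤ) : ℝ :=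
  (condDistrib Z D P δ).real {k}

/-- The transmitted codeword: `Z` encoded by the Shannon–Fano–Elias code matched to the probability
mass function of `Z` given the value of `D`. -/
def sfeCodeword {Ω β : Type*} [MeasurableSpace Ω] [MeasurableSpace β] {n : ℕ} (P : Measure Ω)
    [IsFiniteMeasure P] (e : (Fin n → ℤ) ↪ ℕ) (Z : Ω → Fin n → ℤ) (D : Ω → β) (ω : Ω) :
    List Bool :=
  sfeCode e (condPMF P Z D (D ω)) (Z ω)

/-- The average `(1/T) ∑_{t < T} E[ℓ(a_t)]` of the expected codeword lengths. -/
def avgLength {Ω : Type*} [MeasurableSpace Ω] (P : Measure Ω) (a : ℕ → Ω → List Bool) (T : ℕ) :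
    ℝ≥0∞ :=
  (∑ t ∈ Finset.range T, ∫⁻ ω, ((a t ω).length : ℝ≥0∞) ∂P) / T

/-! ### Directed information -/

/-- The first `r` samples of a process. -/
def history {Ω α : Type*} (q : ℕ → Ω → α) (r : ℕ) : Ω → Fin r → α := fun ω s => q s ω

/-- Conditional mutual information `I(X; Y | Z)` in bits: the Kullback–Leibler divergence of the law
of `(Z, X, Y)` from the law under which `X` and `Y` are conditionally independent given `Z`. -/
def condMutualInfo {Ω α β γ : Type*} [MeasurableSpace Ω] [MeasurableSpace α]
    [StandardBorelSpace α] [Nonempty α] [MeasurableSpace β] [StandardBorelSpace β] [Nonempty β]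
    [MeasurableSpace γ] (P : Measure Ω) [IsFiniteMeasure P] (X : Ω → α) (Y : Ω → β) (Z : Ω → γ) :
    ℝ≥0∞ :=
  InformationTheory.klDiv (P.map fun ω => (Z ω, X ω, Y ω))
    ((P.map Z) ⊗ₘ (condDistrib X Z P ×ₖ condDistrib Y Z P)) / ENNReal.ofReal (Real.log 2)

/-- Causally conditioned directed information
`I(p_{1:T} → q_{1:T} ‖ r_{1:T}) = ∑_t I(p_{1:t}; q_t | q_{1:t-1}, r_{1:t})` in bits. -/
def directedInfo {Ω α β γ : Type*} [MeasurableSpace Ω] [MeasurableSpace α]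
    [StandardBorelSpace α] [Nonempty α] [MeasurableSpace β] [StandardBorelSpace β] [Nonempty β]
    [MeasurableSpace γ] (P : Measure Ω) [IsFiniteMeasure P] (p : ℕ → Ω → α) (q : ℕ → Ω → β)
    (r : ℕ → Ω → γ) (T : ℕ) : ℝ≥0∞ :=
  ∑ t ∈ Finset.range T, condMutualInfo P (history p (t + 1)) (q t)
    (fun ω => (history q t ω, history r (t + 1) ω))

/-- The constant `k = 2 + (n/2) log₂ (4πe/12)`. -/
def overhead (n : ℕ) : ℝ := 2 + n / 2 * Real.logb 2 (4 * Real.pi * Real.exp 1 / 12)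

end

end LQGSI

open Filter LQGSI

/-!
# Rate of entropy-coded dithered quantization in LQG control with side information

The two control loops differ in the law of the measurement noise but not in its second moments.
With subtractive dither, `y t - C (x¹ t - x̃¹ t)` is uniformly distributed on a cube whatever the
signal is; hence it is uncorrelated with the past and has covariance `Δ² / 12 • 1 = 1`, like the
noise of the Gaussian channel. Each loop is therefore, up to known affine functions of past
observations, a system `x⁺ = Ā x¹ + w`, `y = C x¹ + ν` with white `w`, `ν` of covariances `W`, `1`;
`IsSecondOrderLoop` records this. Linear estimation depends on second moments only, so in both loops
the covariance `Σ t` of the a priori estimation error of `x¹ t` follows one and the same Riccati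
recursion `Plant.riccati` (`IsSecondOrderLoop.hasErrorCov_iterate`), from the same initial value
(`hasErrorCov_init`). The next value of `x²` enters it as one more linear measurement of `x¹`.

*The Gaussian loop.* All signals are jointly Gaussian, so the innovation of `y t`, which is
orthogonal to the conditioning variables, is independent of them and has covariance `C (Σ t) Cᵀ + 1`;
given `x t` as well, the remaining randomness is the noise `v t` of covariance `1`. The conditional
mutual information is the expected logarithm of the ratio of the two Gaussian densities, which is
`(1/2) log₂ det (C (Σ t) Cᵀ + 1)` (`condMutualInfo_gaussian`, `IsGaussianLoop.condMutualInfo_eq`).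

*The quantized loop.* A Shannon–Fano–Elias codeword of an index with conditional probability `q` has
length at most `2 - log₂ q`. By Gibbs' inequality the mean of `-log₂ q` is at most the mean of
`-log₂` of the weight `Δⁿ g(kΔ - δ)`, `g` being the Gaussian density of covariance
`C (Σ t) Cᵀ + 1`: the dither cubes translated by the lattice tile the space, so the weights sum to
one after averaging over the dither (`lintegral_cellWeight_div_le`). The logarithm of `g` is a
quadratic form, and its mean depends only on the second moment of `y t`, which is that of the
Gaussian loop. This bounds the mean length by the Gaussian information rate plus a constant
(`IsQuantizedLoop.lintegral_length_le`). Prefix-freeness, `isPrefixFreeOn_sfeCode`, holds because the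
modified distribution functions of two symbols are too far apart to share a dyadic interval.

*The log-determinant formula.* If `CᵀC = P̂⁻¹ - P̃⁻¹`, the measurement update takes `P̃` to `P̂` and
the prediction step takes `P̂` to `P̃`, so `P̃` is a fixed point of the recursion. Bounds
`a P̃ ≤ Σ t ≤ b P̃` tighten geometrically, because the noise `W₁₁ > 0` is not scaled with the
covariance; hence `Σ t → P̃` from any start (`Plant.tendsto_iterate_riccati`). The rates converge to
`(1/2) log₂ (det P̃ / det P̂)`, and so do their averages.
-/


set_option linter.unusedSectionVars false

namespace LQGSI

open Filter Topology

/-! ### Kalman updates of the error covariance -/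

section Riccati

variable {ι κ μ : Type*} [Fintype ι] [Fintype κ] [Fintype μ] [DecidableEq ι] [DecidableEq κ]
  [DecidableEq μ]

lemma posSemidef_mul_mul_transpose {S : Matrix κ κ ℝ} (hS : S.PosSemidef) (B : Matrix ι κ ℝ) :
    (B * S * Bᵀ).PosSemidef := by
  simpa using hS.mul_mul_conjTranspose_same B

lemma transpose_eq_of_posSemidef {S : Matrix κ κ ℝ} (hS : S.PosSemidef) : Sᵀ = S := by
  simpa using hS.isHermitian.eq

/-- Covariance of `A x + q` after its linear regression on the observation `H x + ν`, where `x`,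
`q`, `ν` are uncorrelated with covariances `S`, `Q`, `N`. Measurement updates and prediction steps
of the Kalman filter are both of this form. -/
noncomputable def filterUpdate (A : Matrix ι κ ℝ) (H : Matrix μ κ ℝ) (N : Matrix μ μ ℝ)
    (Q : Matrix ι ι ℝ) (S : Matrix κ κ ℝ) : Matrix ι ι ℝ :=
  A * S * Aᵀ + Q - A * S * Hᵀ * (H * S * Hᵀ + N)⁻¹ * (H * S * Aᵀ)

/-- Error covariance of the estimator with the (possibly suboptimal) gain `L`. -/
def gainUpdate (A : Matrix ι κ ℝ) (H : Matrix μ κ ℝ) (N : Matrix μ μ ℝ)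
    (Q : Matrix ι ι ℝ) (L : Matrix ι μ ℝ) (S : Matrix κ κ ℝ) : Matrix ι ι ℝ :=
  (A - L * H) * S * (A - L * H)ᵀ + Q + L * N * Lᵀ

variable (A : Matrix ι κ ℝ) (H : Matrix μ κ ℝ) {N : Matrix μ μ ℝ} (Q : Matrix ι ι ℝ)

lemma innovation_posDef (hN : N.PosDef) {S : Matrix κ κ ℝ} (hS : S.PosSemidef) :
    (H * S * Hᵀ + N).PosDef :=
  hN.posSemidef_add (posSemidef_mul_mul_transpose hS H)

/-- Completion of the square: the optimal gain is `A S Hᵀ (H S Hᵀ + N)⁻¹`. -/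
lemma gainUpdate_eq (hN : N.PosDef) {S : Matrix κ κ ℝ} (hS : S.PosSemidef) (L : Matrix ι μ ℝ) :
    gainUpdate A H N Q L S = filterUpdate A H N Q S
      + (L - A * S * Hᵀ * (H * S * Hᵀ + N)⁻¹) * (H * S * Hᵀ + N)
        * (L - A * S * Hᵀ * (H * S * Hᵀ + N)⁻¹)ᵀ := by
  have hV := innovation_posDef H hN hS
  set V := H * S * Hᵀ + N with hVdef
  have hVu : IsUnit V.det := hV.det_pos.ne'.isUnit
  have hVt : V⁻¹ᵀ = V⁻¹ := by
    rw [transpose_nonsing_inv, transpose_eq_of_posSemidef hV.posSemidef]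
  have hSt := transpose_eq_of_posSemidef hS
  have hN' : N = V - H * S * Hᵀ := by rw [hVdef]; abel
  unfold gainUpdate filterUpdate
  rw [← hVdef, hN']
  have e1 : A * S * Hᵀ * V⁻¹ * V * Lᵀ = A * S * Hᵀ * Lᵀ := by
    rw [nonsing_inv_mul_cancel_right _ _ hVu]
  have e2 : L * V * (V⁻¹ * (H * S * Aᵀ)) = L * (H * S * Aᵀ) := by
    rw [Matrix.mul_assoc, mul_nonsing_inv_cancel_left _ _ hVu]
  have e3 : A * S * Hᵀ * V⁻¹ * V * (V⁻¹ * (H * S * Aᵀ)) = A * S * Hᵀ * V⁻¹ * (H * S * Aᵀ) := by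
    rw [nonsing_inv_mul_cancel_right _ _ hVu, Matrix.mul_assoc (A * S * Hᵀ)]
  simp only [transpose_sub, transpose_mul, transpose_transpose, hVt, hSt, Matrix.sub_mul,
    Matrix.mul_sub, ← Matrix.mul_assoc] at e1 e2 e3 ⊢
  rw [e1, e2, e3]
  abel

lemma posSemidef_gainUpdate_sub (hN : N.PosDef) {S : Matrix κ κ ℝ} (hS : S.PosSemidef)
    (L : Matrix ι μ ℝ) : (gainUpdate A H N Q L S - filterUpdate A H N Q S).PosSemidef := by
  rw [gainUpdate_eq A H Q hN hS, add_sub_cancel_left]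
  exact posSemidef_mul_mul_transpose (innovation_posDef H hN hS).posSemidef _

lemma exists_gainUpdate_eq (hN : N.PosDef) {S : Matrix κ κ ℝ} (hS : S.PosSemidef) :
    ∃ L, gainUpdate A H N Q L S = filterUpdate A H N Q S :=
  ⟨_, by rw [gainUpdate_eq A H Q hN hS, sub_self]; simp⟩

variable {Q}

lemma filterUpdate_posSemidef (hN : N.PosDef) (hQ : Q.PosSemidef) {S : Matrix κ κ ℝ}
    (hS : S.PosSemidef) : (filterUpdate A H N Q S).PosSemidef := by
  obtain ⟨L, hL⟩ := exists_gainUpdate_eq A H Q hN hS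
  rw [← hL]
  exact ((posSemidef_mul_mul_transpose hS _).add hQ).add
    (posSemidef_mul_mul_transpose hN.posSemidef _)

variable (Q)

/-- The update is monotone, and scaling the covariance up by `b ≥ 1` scales the result by less than
`b` because the noise `Q` is not scaled. -/
lemma filterUpdate_le_smul (hN : N.PosDef) {S P : Matrix κ κ ℝ} (hS : S.PosSemidef)
    (hP : P.PosSemidef) {b : ℝ} (hb : 1 ≤ b) (h : (b • P - S).PosSemidef) :
    (b • filterUpdate A H N Q P - (b - 1) • Q - filterUpdate A H N Q S).PosSemidef := by
  obtain ⟨L, hL⟩ := exists_gainUpdate_eq A H Q hN hP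
  have h1 := posSemidef_gainUpdate_sub A H Q hN hS L
  have h2 := posSemidef_mul_mul_transpose h (A - L * H)
  have h3 := (posSemidef_mul_mul_transpose hN.posSemidef L).smul (sub_nonneg.2 hb)
  convert! (h1.add h2).add h3 using 1
  rw [← hL, gainUpdate, gainUpdate]
  simp only [Matrix.mul_sub (A - L * H), Matrix.sub_mul _ _ (A - L * H)ᵀ, Matrix.mul_smul,
    Matrix.smul_mul]
  module

/-- Lower counterpart of `filterUpdate_le_smul`: scaling the covariance down by `a ≤ 1` scales the
result by more than `a`. -/
lemma smul_le_filterUpdate (hN : N.PosDef) {S P : Matrix κ κ ℝ} (hS : S.PosSemidef)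
    (hP : P.PosSemidef) {a : ℝ} (ha0 : 0 ≤ a) (ha : a ≤ 1) (h : (S - a • P).PosSemidef) :
    (filterUpdate A H N Q S - a • filterUpdate A H N Q P - (1 - a) • Q).PosSemidef := by
  obtain ⟨L, hL⟩ := exists_gainUpdate_eq A H Q hN hS
  have h1 := (posSemidef_gainUpdate_sub A H Q hN hP L).smul ha0
  have h2 := posSemidef_mul_mul_transpose h (A - L * H)
  have h3 := (posSemidef_mul_mul_transpose hN.posSemidef L).smul (sub_nonneg.2 ha)
  convert! (h1.add h2).add h3 using 1
  rw [← hL, gainUpdate, gainUpdate]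
  simp only [Matrix.mul_sub (A - L * H), Matrix.sub_mul _ _ (A - L * H)ᵀ, Matrix.mul_smul,
    Matrix.smul_mul]
  module

/-- Information form of the update, by the matrix inversion lemma. -/
lemma filterUpdate_eq_inv (hN : N.PosDef) {P : Matrix κ κ ℝ} (hP : P.PosDef) :
    filterUpdate A H N Q P = Q + A * (P⁻¹ + Hᵀ * N⁻¹ * H)⁻¹ * Aᵀ := by
  have hV := innovation_posDef H hN hP.posSemidef
  have hPu : IsUnit P.det := hP.det_pos.ne'.isUnit
  have hNu : IsUnit N.det := hN.det_pos.ne'.isUnit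
  rw [Matrix.add_mul_mul_inv_eq_sub P⁻¹ Hᵀ N⁻¹ H hP.inv.isUnit hN.inv.isUnit
    (by rw [nonsing_inv_nonsing_inv _ hPu, nonsing_inv_nonsing_inv _ hNu, add_comm]
        exact hV.isUnit), nonsing_inv_nonsing_inv _ hPu, nonsing_inv_nonsing_inv _ hNu, add_comm N,
    filterUpdate]
  simp only [Matrix.mul_sub, Matrix.sub_mul, ← Matrix.mul_assoc]
  abel

/-- The Cauchy–Schwarz inequality for the inner product defined by `A`, applied to `x` and the `i`-th
column of `A⁻¹`. -/
lemma sq_le_inv_diag_mul {A : Matrix ι ι ℝ} (hA : A.PosDef)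
    (x : ι → ℝ) (i : ι) : x i ^ 2 ≤ A⁻¹ i i * (x ⬝ᵥ A *ᵥ x) := by
  have hAu : IsUnit A.det := hA.det_pos.ne'.isUnit
  have ha : 0 < A⁻¹ i i := hA.inv.diag_pos
  set t := x i / A⁻¹ i i with ht
  have h := hA.posSemidef.dotProduct_mulVec_nonneg (x - t • A⁻¹ *ᵥ Pi.single i 1)
  have e1 : A *ᵥ A⁻¹ *ᵥ Pi.single i 1 = Pi.single i (1 : ℝ) := by
    rw [mulVec_mulVec, mul_nonsing_inv _ hAu, one_mulVec]
  have e2 : (A⁻¹ *ᵥ Pi.single i 1) ⬝ᵥ A *ᵥ x = x i := by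
    rw [dotProduct_mulVec, ← mulVec_transpose, transpose_eq_of_posSemidef hA.posSemidef, e1]
    simp
  have e3 : (A⁻¹ *ᵥ Pi.single i 1) i = A⁻¹ i i := by simp
  simp only [star_trivial, mulVec_sub, mulVec_smul, e1, sub_dotProduct, dotProduct_sub,
    smul_dotProduct, dotProduct_smul, e2, smul_eq_mul, dotProduct_single, mul_one, Pi.sub_apply,
    Pi.smul_apply, e3] at h
  have h4 : t * A⁻¹ i i = x i := by rw [ht]; field_simp
  have h5 : x i * t ≤ x ⬝ᵥ A *ᵥ x := by rw [h4] at h; linarith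
  calc x i ^ 2 = A⁻¹ i i * (x i * t) := by rw [sq]; nth_rw 2 [← h4]; ring
    _ ≤ _ := by gcongr

/-- A positive definite matrix dominates a positive multiple of any symmetric one. -/
lemma exists_pos_posSemidef_sub_smul {A B : Matrix ι ι ℝ} (hA : A.PosDef) (hB : B.IsHermitian) :
    ∃ c : ℝ, 0 < c ∧ c ≤ 1 ∧ (A - c • B).PosSemidef := by
  set K : ℝ := ∑ i, ∑ j, |B i j| * (A⁻¹ i i + A⁻¹ j j) with hK
  have hd : ∀ i, 0 < A⁻¹ i i := fun i => hA.inv.diag_pos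
  have hK0 : 0 ≤ K := Finset.sum_nonneg fun i _ => Finset.sum_nonneg fun j _ =>
    mul_nonneg (abs_nonneg _) (add_pos (hd i) (hd j)).le
  refine ⟨(1 + K)⁻¹, by positivity, inv_le_one_of_one_le₀ (by linarith), ?_⟩
  refine .of_dotProduct_mulVec_nonneg
    (hA.isHermitian.sub (by rw [IsHermitian, conjTranspose_smul, hB.eq, star_trivial])) fun x => ?_
  have hq : 0 ≤ x ⬝ᵥ A *ᵥ x := by simpa using hA.posSemidef.dotProduct_mulVec_nonneg x
  have hB' : x ⬝ᵥ B *ᵥ x ≤ K * (x ⬝ᵥ A *ᵥ x) := by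
    rw [hK, Finset.sum_mul, dotProduct]
    refine Finset.sum_le_sum fun i _ => ?_
    rw [mulVec, dotProduct, Finset.mul_sum, Finset.sum_mul]
    refine Finset.sum_le_sum fun j _ => ?_
    have h1 := sq_le_inv_diag_mul hA x i
    have h2 := sq_le_inv_diag_mul hA x j
    calc x i * (B i j * x j) ≤ |B i j| * (|x i| * |x j|) := by
            refine (le_abs_self _).trans (le_of_eq ?_)
            rw [abs_mul, abs_mul]; ring
      _ ≤ |B i j| * (x i ^ 2 + x j ^ 2) := by
            gcongr
            nlinarith [sq_abs (x i), sq_abs (x j), sq_nonneg (|x i| - |x j|),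
              mul_nonneg (abs_nonneg (x i)) (abs_nonneg (x j))]
      _ ≤ |B i j| * (A⁻¹ i i * (x ⬝ᵥ A *ᵥ x) + A⁻¹ j j * (x ⬝ᵥ A *ᵥ x)) := by gcongr
      _ = _ := by ring
  simp only [star_trivial, sub_mulVec, smul_mulVec, dotProduct_sub, dotProduct_smul, smul_eq_mul]
  have : (1 + K)⁻¹ * (x ⬝ᵥ B *ᵥ x) ≤ (1 + K)⁻¹ * ((1 + K) * (x ⬝ᵥ A *ᵥ x)) := by
    gcongr; linarith
  rw [inv_mul_cancel_left₀ (by positivity)] at this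
  linarith

/-- Entrywise convergence follows from a squeeze in the Loewner order. -/
lemma tendsto_of_sandwich {S : ℕ → Matrix ι ι ℝ} {P : Matrix ι ι ℝ} {a b : ℕ → ℝ}
    (hS : ∀ t, (S t).IsHermitian) (hP : P.IsHermitian)
    (ha : Tendsto a atTop (𝓝 1)) (hb : Tendsto b atTop (𝓝 1))
    (hlow : ∀ t, (S t - a t • P).PosSemidef) (hup : ∀ t, (b t • P - S t).PosSemidef) :
    Tendsto S atTop (𝓝 P) := by
  have hq : ∀ x : ι → ℝ, Tendsto (fun t => x ⬝ᵥ S t *ᵥ x) atTop (𝓝 (x ⬝ᵥ P *ᵥ x)) := by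
    intro x
    have h1 : Tendsto (fun t => a t * (x ⬝ᵥ P *ᵥ x)) atTop (𝓝 (x ⬝ᵥ P *ᵥ x)) := by
      simpa using ha.mul_const (x ⬝ᵥ P *ᵥ x)
    have h2 : Tendsto (fun t => b t * (x ⬝ᵥ P *ᵥ x)) atTop (𝓝 (x ⬝ᵥ P *ᵥ x)) := by
      simpa using hb.mul_const (x ⬝ᵥ P *ᵥ x)
    refine tendsto_of_tendsto_of_tendsto_of_le_of_le h1 h2 (fun t => ?_) (fun t => ?_)
    · have := (hlow t).dotProduct_mulVec_nonneg x
      simpa [sub_mulVec, smul_mulVec, dotProduct_sub] using this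
    · have := (hup t).dotProduct_mulVec_nonneg x
      simpa [sub_mulVec, smul_mulVec, dotProduct_sub] using this
  -- Entries are recovered from the quadratic form by polarization.
  have hpol : ∀ {R : Matrix ι ι ℝ}, R.IsHermitian → ∀ i j, R i j =
      ((Pi.single i 1 + Pi.single j 1) ⬝ᵥ R *ᵥ (Pi.single i 1 + Pi.single j 1)
        - (Pi.single i 1 - Pi.single j 1) ⬝ᵥ R *ᵥ (Pi.single i 1 - Pi.single j 1)) / 4 := by
    intro R hR i j
    have : R j i = R i j := by simpa using hR.apply i j
    simp [mulVec_add, mulVec_sub, sub_dotProduct, add_dotProduct, this]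
    ring
  refine tendsto_pi_nhds.2 fun i => tendsto_pi_nhds.2 fun j => ?_
  rw [hpol hP i j]
  refine (((hq _).sub (hq _)).div_const 4).congr fun t => ?_
  rw [← hpol (hS t) i j]

end Riccati

/-! ### Convergence of the Riccati recursion -/

namespace Plant

variable {n m p : ℕ} (M : Plant n m p)

/-- One period of the Riccati recursion for the a priori error covariance: the update with the
measurement `C x¹ + ν`, `ν` of covariance `I`, followed by the prediction step, in which the new
value of `x²` is a measurement of the old error with noise covariance `W₂₂`. -/
noncomputable def riccati (C S : Matrix (Fin n) (Fin n) ℝ) : Matrix (Fin n) (Fin n) ℝ :=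
  filterUpdate M.A₁₁ M.A₂₁ M.W₂₂ M.W₁₁ (filterUpdate 1 C 1 0 S)

variable {M} {C P S₀ : Matrix (Fin n) (Fin n) ℝ}

lemma riccati_posSemidef {S : Matrix (Fin n) (Fin n) ℝ} (hS : S.PosSemidef) :
    (M.riccati C S).PosSemidef :=
  filterUpdate_posSemidef _ _ M.posDef_W₂₂ M.posDef_W₁₁.posSemidef
    (filterUpdate_posSemidef _ _ .one .zero hS)

lemma iterate_riccati_posSemidef (hS : S₀.PosSemidef) (t : ℕ) :
    ((M.riccati C)^[t] S₀).PosSemidef := by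
  induction t with
  | zero => exact hS
  | succ t ih => rw [Function.iterate_succ_apply']; exact riccati_posSemidef ih

/-- A sandwich `a P ≤ S ≤ b P` around a positive definite fixed point `P` tightens by the factor
`1 - c` in every period, where `c P ≤ W₁₁`. Hence the recursion converges from any start. -/
lemma tendsto_iterate_riccati (hS : S₀.PosSemidef) (hP : P.PosDef) (hfix : M.riccati C P = P) :
    Tendsto (fun t => (M.riccati C)^[t] S₀) atTop (𝓝 P) := by
  obtain ⟨c, hc0, hc1, hc⟩ := exists_pos_posSemidef_sub_smul M.posDef_W₁₁ hP.isHermitian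
  obtain ⟨c', hc'0, hc'1, hc'⟩ := exists_pos_posSemidef_sub_smul hP hS.isHermitian
  have hr0 : 0 ≤ 1 - c := by linarith
  have hpow : Tendsto (fun t : ℕ => (1 - c) ^ t) atTop (𝓝 0) :=
    tendsto_pow_atTop_nhds_zero_of_lt_one hr0 (by linarith)
  have hpow1 : ∀ t : ℕ, (1 - c) ^ t ≤ 1 := fun t => pow_le_one₀ hr0 (by linarith)
  have hk : 0 ≤ c'⁻¹ - 1 := by
    have := (one_le_inv₀ hc'0).2 hc'1
    linarith
  have hPs := hP.posSemidef
  have hmeas := filterUpdate_posSemidef (1 : Matrix (Fin n) (Fin n) ℝ) C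
    (N := (1 : Matrix (Fin n) (Fin n) ℝ)) (Q := 0) .one .zero hPs
  -- The initial sandwich is `0 ≤ S₀ ≤ c'⁻¹ P`.
  have key : ∀ t, ((M.riccati C)^[t] S₀ - (1 - (1 - c) ^ t) • P).PosSemidef ∧
      ((1 + (c'⁻¹ - 1) * (1 - c) ^ t) • P - (M.riccati C)^[t] S₀).PosSemidef := by
    intro t
    induction t with
    | zero =>
      refine ⟨by simpa using hS, ?_⟩
      have := hc'.smul (inv_pos.2 hc'0).le
      rw [smul_sub, smul_smul, inv_mul_cancel₀ hc'0.ne', one_smul] at this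
      simpa using this
    | succ t ih =>
      have hSt := iterate_riccati_posSemidef (M := M) (C := C) hS t
      have hmt := filterUpdate_posSemidef (1 : Matrix (Fin n) (Fin n) ℝ) C
        (N := (1 : Matrix (Fin n) (Fin n) ℝ)) (Q := 0) .one .zero hSt
      rw [Function.iterate_succ_apply']
      constructor
      · have h1 := smul_le_filterUpdate (1 : Matrix (Fin n) (Fin n) ℝ) C 0 .one hSt hPs
          (sub_nonneg.2 (hpow1 t)) (by linarith [pow_nonneg hr0 t]) ih.1
        rw [smul_zero, sub_zero] at h1
        have h2 := smul_le_filterUpdate M.A₁₁ M.A₂₁ M.W₁₁ M.posDef_W₂₂ hmt hmeas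
          (sub_nonneg.2 (hpow1 t)) (by linarith [pow_nonneg hr0 t]) h1
        have h3 := hc.smul (pow_nonneg hr0 t)
        change (M.riccati C _ - _ • M.riccati C P - _).PosSemidef at h2
        rw [hfix] at h2
        convert! h2.add h3 using 1
        rw [pow_succ]
        module
      · have hb : 1 ≤ 1 + (c'⁻¹ - 1) * (1 - c) ^ t := by
          linarith [mul_nonneg hk (pow_nonneg hr0 t)]
        have h1 := filterUpdate_le_smul (1 : Matrix (Fin n) (Fin n) ℝ) C 0 .one hSt hPs hb ih.2
        rw [smul_zero, sub_zero] at h1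
        have h2 := filterUpdate_le_smul M.A₁₁ M.A₂₁ M.W₁₁ M.posDef_W₂₂ hmt hmeas hb h1
        have h3 := hc.smul (mul_nonneg hk (pow_nonneg hr0 t))
        change (_ • M.riccati C P - _ - M.riccati C _).PosSemidef at h2
        rw [hfix] at h2
        convert! h2.add h3 using 1
        rw [pow_succ]
        module
  refine tendsto_of_sandwich (fun t => (iterate_riccati_posSemidef hS t).isHermitian)
    hP.isHermitian ?_ ?_ (fun t => (key t).1) (fun t => (key t).2)
  · simpa using hpow.const_sub 1
  · simpa using (hpow.const_mul (c'⁻¹ - 1)).const_add 1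

variable {Phat : Matrix (Fin n) (Fin n) ℝ}

lemma Ptilde_posDef (hP : Phat.PosDef) : (M.Ptilde Phat).PosDef := by
  have h : (Phat⁻¹ + M.A₂₁ᵀ * M.W₂₂⁻¹ * M.A₂₁).PosDef := by
    refine hP.inv.add_posSemidef ?_
    simpa using posSemidef_mul_mul_transpose M.posDef_W₂₂.inv.posSemidef M.A₂₁ᵀ
  exact M.posDef_W₁₁.add_posSemidef (posSemidef_mul_mul_transpose h.inv.posSemidef _)

/-- If `CᵀC = P̂⁻¹ - P̃⁻¹` then the measurement update turns `P̃` into `P̂`, and the prediction step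
turns `P̂` into `P̃` by definition. -/
lemma riccati_Ptilde (hP : Phat.PosDef) (hC : Cᵀ * C = Phat⁻¹ - (M.Ptilde Phat)⁻¹) :
    M.riccati C (M.Ptilde Phat) = M.Ptilde Phat := by
  have h1 : filterUpdate 1 C 1 0 (M.Ptilde Phat) = Phat := by
    rw [filterUpdate_eq_inv _ _ _ .one (Ptilde_posDef hP)]
    simp [hC, nonsing_inv_nonsing_inv _ hP.det_pos.ne'.isUnit]
  rw [riccati, h1, filterUpdate_eq_inv _ _ _ M.posDef_W₂₂ hP, Ptilde]

/-- `det (C P̃ Cᵀ + 1) = det (1 + CᵀC P̃)`, and `1 + CᵀC P̃ = P̂⁻¹ P̃`. -/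
lemma det_innovation_Ptilde (hP : Phat.PosDef) (hC : Cᵀ * C = Phat⁻¹ - (M.Ptilde Phat)⁻¹) :
    (C * M.Ptilde Phat * Cᵀ + 1).det = (M.Ptilde Phat).det / Phat.det := by
  have hu : IsUnit (M.Ptilde Phat).det := (Ptilde_posDef hP).det_pos.ne'.isUnit
  rw [add_comm, Matrix.mul_assoc, det_one_add_mul_comm, Matrix.mul_assoc, hC, Matrix.mul_sub,
    mul_nonsing_inv _ hu, add_sub_cancel, det_mul, det_nonsing_inv, Ring.inverse_eq_inv',
    div_eq_mul_inv]

/-- The rate of the Riccati iterates converges to the value of the log-determinant program. -/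
lemma tendsto_logb_det_innovation (hS : S₀.PosSemidef) (hP : Phat.PosDef)
    (hC : Cᵀ * C = Phat⁻¹ - (M.Ptilde Phat)⁻¹) :
    Tendsto (fun t => Real.logb 2 (C * (M.riccati C)^[t] S₀ * Cᵀ + 1).det / 2) atTop
      (𝓝 ((Real.logb 2 (M.Ptilde Phat).det - Real.logb 2 Phat.det) / 2)) := by
  have h := tendsto_iterate_riccati hS (Ptilde_posDef hP) (riccati_Ptilde hP hC)
  have hdet : Tendsto (fun t => (C * (M.riccati C)^[t] S₀ * Cᵀ + 1).det) atTop
      (𝓝 (C * M.Ptilde Phat * Cᵀ + 1).det) := by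
    have : Continuous fun S : Matrix (Fin n) (Fin n) ℝ => (C * S * Cᵀ + 1).det := by fun_prop
    exact (this.tendsto _).comp h
  rw [det_innovation_Ptilde hP hC] at hdet
  have hpos := (Ptilde_posDef (M := M) hP).det_pos
  rw [← Real.logb_div hpos.ne' hP.det_pos.ne']
  refine Tendsto.div_const ?_ 2
  exact hdet.logb (div_pos hpos hP.det_pos).ne'

end Plant

/-! ### Second moments -/

section SecondMoments

variable {Ω ι κ μ : Type*} [Fintype ι] [Fintype κ] [Fintype μ] [MeasurableSpace Ω]

/-- All coordinates of the random vector `X` are square integrable. -/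
def IsL2 (P : Measure Ω) (X : Ω → ι → ℝ) : Prop := ∀ i, MemLp (fun ω => X ω i) 2 P

/-- The matrix of second moments `E[X Yᵀ]`. -/
noncomputable def secondMoment (P : Measure Ω) (X : Ω → ι → ℝ) (Y : Ω → κ → ℝ) : Matrix ι κ ℝ :=
  of fun i j => ∫ ω, X ω i * Y ω j ∂P

/-- The coordinates of `X` are orthogonal, in `L²`, to all elements of `U`. -/
def IsOrtho (P : Measure Ω) (X : Ω → ι → ℝ) (U : Submodule ℝ (Ω → ℝ)) : Prop :=
  ∀ f ∈ U, ∀ i, ∫ ω, X ω i * f ω ∂P = 0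

variable {P : Measure Ω} {X X' : Ω → ι → ℝ} {Y : Ω → κ → ℝ}

lemma IsL2.add (hX : IsL2 P X) (hX' : IsL2 P X') : IsL2 P (fun ω => X ω + X' ω) :=
  fun i => (hX i).add (hX' i)

lemma IsL2.sub (hX : IsL2 P X) (hX' : IsL2 P X') : IsL2 P (fun ω => X ω - X' ω) :=
  fun i => (hX i).sub (hX' i)

lemma IsL2.mulVec (hX : IsL2 P X) (A : Matrix κ ι ℝ) : IsL2 P (fun ω => A *ᵥ X ω) := fun i => by
  simp only [Matrix.mulVec, dotProduct]
  exact memLp_finsetSum _ fun j _ => (hX j).const_mul _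

lemma IsL2.integrable_mul (hX : IsL2 P X) (hY : IsL2 P Y) (i : ι) (j : κ) :
    Integrable (fun ω => X ω i * Y ω j) P :=
  MemLp.integrable_mul (hX i) (hY j)

lemma secondMoment_apply (i : ι) (j : κ) :
    secondMoment P X Y i j = ∫ ω, X ω i * Y ω j ∂P := rfl

lemma secondMoment_transpose : (secondMoment P X Y)ᵀ = secondMoment P Y X := by
  ext i j
  simp [secondMoment_apply, mul_comm]

lemma secondMoment_add_left (hX : IsL2 P X) (hX' : IsL2 P X') (hY : IsL2 P Y) :
    secondMoment P (fun ω => X ω + X' ω) Y = secondMoment P X Y + secondMoment P X' Y := by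
  ext i j
  simp only [secondMoment_apply, Pi.add_apply, add_mul, Matrix.add_apply]
  exact integral_add (hX.integrable_mul hY i j) (hX'.integrable_mul hY i j)

lemma secondMoment_sub_left (hX : IsL2 P X) (hX' : IsL2 P X') (hY : IsL2 P Y) :
    secondMoment P (fun ω => X ω - X' ω) Y = secondMoment P X Y - secondMoment P X' Y := by
  ext i j
  simp only [secondMoment_apply, Pi.sub_apply, sub_mul, Matrix.sub_apply]
  exact integral_sub (hX.integrable_mul hY i j) (hX'.integrable_mul hY i j)

lemma secondMoment_mulVec_left (A : Matrix μ ι ℝ) (hX : IsL2 P X) (hY : IsL2 P Y) :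
    secondMoment P (fun ω => A *ᵥ X ω) Y = A * secondMoment P X Y := by
  ext i j
  simp only [secondMoment_apply, Matrix.mulVec, dotProduct, Matrix.mul_apply, Finset.sum_mul,
    mul_assoc]
  rw [integral_finsetSum _ fun k _ => (hX.integrable_mul hY k j).const_mul _]
  simp only [integral_const_mul]

lemma secondMoment_add_right (hX : IsL2 P X) (hX' : IsL2 P X') (hY : IsL2 P Y) :
    secondMoment P Y (fun ω => X ω + X' ω) = secondMoment P Y X + secondMoment P Y X' := by
  rw [← secondMoment_transpose, secondMoment_add_left hX hX' hY, transpose_add,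
    secondMoment_transpose, secondMoment_transpose]

lemma secondMoment_sub_right (hX : IsL2 P X) (hX' : IsL2 P X') (hY : IsL2 P Y) :
    secondMoment P Y (fun ω => X ω - X' ω) = secondMoment P Y X - secondMoment P Y X' := by
  rw [← secondMoment_transpose, secondMoment_sub_left hX hX' hY, transpose_sub,
    secondMoment_transpose, secondMoment_transpose]

lemma secondMoment_mulVec_right (A : Matrix μ ι ℝ) (hX : IsL2 P X) (hY : IsL2 P Y) :
    secondMoment P Y (fun ω => A *ᵥ X ω) = secondMoment P Y X * Aᵀ := by
  rw [← secondMoment_transpose, secondMoment_mulVec_left A hX hY, transpose_mul,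
    secondMoment_transpose]

lemma secondMoment_posSemidef (hX : IsL2 P X) : (secondMoment P X X).PosSemidef := by
  refine .of_dotProduct_mulVec_nonneg ?_ fun v => ?_
  · rw [IsHermitian, conjTranspose_eq_transpose_of_trivial, secondMoment_transpose]
  · have h : v ⬝ᵥ secondMoment P X X *ᵥ v = ∫ ω, (v ⬝ᵥ X ω) * (v ⬝ᵥ X ω) ∂P := by
      have hexp : ∀ ω, (v ⬝ᵥ X ω) * (v ⬝ᵥ X ω)
          = ∑ i, ∑ j, v i * v j * (X ω i * X ω j) := fun ω => by
        simp only [dotProduct, Finset.sum_mul_sum, mul_mul_mul_comm]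
      have hint : ∀ i j, Integrable (fun ω => v i * v j * (X ω i * X ω j)) P := fun i j =>
        (hX.integrable_mul hX i j).const_mul _
      simp only [hexp]
      rw [integral_finsetSum _ fun i _ => integrable_finsetSum _ fun j _ => hint i j]
      refine Finset.sum_congr rfl fun i _ => ?_
      rw [integral_finsetSum _ fun j _ => hint i j, Matrix.mulVec, dotProduct, Finset.mul_sum]
      refine Finset.sum_congr rfl fun j _ => ?_
      rw [integral_const_mul, secondMoment_apply]
      ring
    rw [star_trivial, h]
    exact integral_nonneg fun ω => mul_self_nonneg _

/-! ### Affine functions of an observation -/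

/-- The affine functions of the observation `Y`: the span of `1` and the coordinates of `Y`. -/
def affineFunctions (Y : Ω → κ → ℝ) : Submodule ℝ (Ω → ℝ) :=
  Submodule.span ℝ (insert (fun _ => 1) (Set.range fun j ω => Y ω j))

lemma one_mem_affineFunctions : (fun _ => 1) ∈ affineFunctions Y :=
  Submodule.subset_span (Set.mem_insert _ _)

lemma const_mem_affineFunctions (c : ℝ) : (fun _ => c) ∈ affineFunctions Y := by
  convert! (affineFunctions Y).smul_mem c one_mem_affineFunctions using 1
  ext; simp

lemma coord_mem_affineFunctions (j : κ) : (fun ω => Y ω j) ∈ affineFunctions Y :=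
  Submodule.subset_span (Set.mem_insert_of_mem _ ⟨j, rfl⟩)

lemma affineFunctions_le {U : Submodule ℝ (Ω → ℝ)} (h1 : (fun _ => 1) ∈ U)
    (h : ∀ j, (fun ω => Y ω j) ∈ U) : affineFunctions Y ≤ U := by
  refine Submodule.span_le.2 (Set.insert_subset h1 ?_)
  rintro _ ⟨j, rfl⟩
  exact h j

omit [MeasurableSpace Ω] in
lemma mulVec_mem {U : Submodule ℝ (Ω → ℝ)} (h : ∀ j, (fun ω => Y ω j) ∈ U) (A : Matrix ι κ ℝ)
    (i : ι) : (fun ω => (A *ᵥ Y ω) i) ∈ U := by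
  have : (fun ω => (A *ᵥ Y ω) i) = ∑ j, A i j • fun ω => Y ω j := by
    ext ω; simp [Matrix.mulVec, dotProduct]
  rw [this]
  exact U.sum_mem fun j _ => U.smul_mem _ (h j)

lemma affine_mem_affineFunctions (A : Matrix ι κ ℝ) (b : ι → ℝ) (i : ι) :
    (fun ω => (A *ᵥ Y ω + b) i) ∈ affineFunctions Y :=
  (affineFunctions Y).add_mem (mulVec_mem coord_mem_affineFunctions A i)
    (const_mem_affineFunctions (b i))

lemma exists_affine_of_mem_affineFunctions {f : Ω → ℝ} (hf : f ∈ affineFunctions Y) :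
    ∃ (l : κ → ℝ) (b : ℝ), ∀ ω, f ω = l ⬝ᵥ Y ω + b := by
  classical
  induction hf using Submodule.span_induction with
  | mem f hf =>
    obtain rfl | ⟨j, rfl⟩ := hf
    · exact ⟨0, 1, by simp⟩
    · exact ⟨Pi.single j 1, 0, by simp⟩
  | zero => exact ⟨0, 0, by simp⟩
  | add f g _ _ hf hg =>
    obtain ⟨l, b, h⟩ := hf
    obtain ⟨l', b', h'⟩ := hg
    exact ⟨l + l', b + b', fun ω => by simp [h, h', add_dotProduct]; ring⟩
  | smul c f _ hf =>
    obtain ⟨l, b, h⟩ := hf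
    exact ⟨c • l, c * b, fun ω => by simp [h]; ring⟩

lemma memLp_of_mem_affineFunctions [IsFiniteMeasure P] (hY : IsL2 P Y) {f : Ω → ℝ}
    (hf : f ∈ affineFunctions Y) : MemLp f 2 P := by
  obtain ⟨l, b, h⟩ := exists_affine_of_mem_affineFunctions hf
  rw [show f = fun ω => (∑ j, l j * Y ω j) + b from funext h]
  exact (memLp_finsetSum _ fun j _ => (hY j).const_mul _).add (memLp_const b)

/-- Vanishing integrals against the generators suffice for orthogonality to their span. -/
lemma isOrtho_span {s : Set (Ω → ℝ)} (hX : IsL2 P X) (hs : ∀ f ∈ s, MemLp f 2 P)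
    (h : ∀ f ∈ s, ∀ i, ∫ ω, X ω i * f ω ∂P = 0) : IsOrtho P X (Submodule.span ℝ s) := by
  intro f hf i
  suffices MemLp f 2 P ∧ ∫ ω, X ω i * f ω ∂P = 0 from this.2
  induction hf using Submodule.span_induction with
  | mem f hf => exact ⟨hs f hf, h f hf i⟩
  | zero => simp
  | add f g _ _ hf hg =>
    refine ⟨hf.1.add hg.1, ?_⟩
    simp only [Pi.add_apply, mul_add]
    have := integral_add (MemLp.integrable_mul (hX i) hf.1) (MemLp.integrable_mul (hX i) hg.1)
    simp only [Pi.mul_apply] at this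
    rw [this, hf.2, hg.2, add_zero]
  | smul c f _ hf =>
    refine ⟨hf.1.const_smul c, ?_⟩
    simp only [Pi.smul_apply, smul_eq_mul, mul_left_comm _ c]
    rw [integral_const_mul, hf.2, mul_zero]

lemma IsOrtho.sup {U V : Submodule ℝ (Ω → ℝ)} (hX : IsL2 P X) (hU : IsOrtho P X U)
    (hV : IsOrtho P X V) (hU2 : ∀ f ∈ U, MemLp f 2 P) (hV2 : ∀ f ∈ V, MemLp f 2 P) :
    IsOrtho P X (U ⊔ V) := by
  intro f hf i
  obtain ⟨g, hg, k, hk, rfl⟩ := Submodule.mem_sup.1 hf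
  simp only [Pi.add_apply, mul_add]
  have := integral_add (MemLp.integrable_mul (hX i) (hU2 g hg))
    (MemLp.integrable_mul (hX i) (hV2 k hk))
  simp only [Pi.mul_apply] at this
  rw [this, hU g hg i, hV k hk i, add_zero]

lemma IsOrtho.mono {U V : Submodule ℝ (Ω → ℝ)} (hV : IsOrtho P X V) (h : U ≤ V) :
    IsOrtho P X U := fun f hf => hV f (h hf)

lemma IsOrtho.sub {U : Submodule ℝ (Ω → ℝ)} (hX : IsL2 P X) (hX' : IsL2 P X')
    (hU2 : ∀ f ∈ U, MemLp f 2 P) (h : IsOrtho P X U) (h' : IsOrtho P X' U) :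
    IsOrtho P (fun ω => X ω - X' ω) U := by
  intro f hf i
  simp only [Pi.sub_apply, sub_mul]
  have := integral_sub (MemLp.integrable_mul (hX i) (hU2 f hf))
    (MemLp.integrable_mul (hX' i) (hU2 f hf))
  simp only [Pi.mul_apply] at this
  rw [this, h f hf i, h' f hf i, sub_zero]

lemma IsOrtho.add {U : Submodule ℝ (Ω → ℝ)} (hX : IsL2 P X) (hX' : IsL2 P X')
    (hU2 : ∀ f ∈ U, MemLp f 2 P) (h : IsOrtho P X U) (h' : IsOrtho P X' U) :
    IsOrtho P (fun ω => X ω + X' ω) U := by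
  intro f hf i
  simp only [Pi.add_apply, add_mul]
  have := integral_add (MemLp.integrable_mul (hX i) (hU2 f hf))
    (MemLp.integrable_mul (hX' i) (hU2 f hf))
  simp only [Pi.mul_apply] at this
  rw [this, h f hf i, h' f hf i, add_zero]

lemma IsOrtho.mulVec {U : Submodule ℝ (Ω → ℝ)} (hX : IsL2 P X) (hU2 : ∀ f ∈ U, MemLp f 2 P)
    (h : IsOrtho P X U) (A : Matrix κ ι ℝ) : IsOrtho P (fun ω => A *ᵥ X ω) U := by
  intro f hf i
  simp only [Matrix.mulVec, dotProduct, Finset.sum_mul, mul_assoc]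
  rw [integral_finsetSum _ fun k _ =>
    (show Integrable (fun ω => X ω k * f ω) P from
      MemLp.integrable_mul (hX k) (hU2 f hf)).const_mul _]
  simp [integral_const_mul, h f hf]

lemma IsOrtho.secondMoment_eq_zero {U : Submodule ℝ (Ω → ℝ)} (h : IsOrtho P X U)
    (hY : ∀ j, (fun ω => Y ω j) ∈ U) : secondMoment P X Y = 0 := by
  ext i j
  exact h _ (hY j) i

/-! ### Linear minimum mean squared error estimation -/

/-- `S` is the second moment matrix of the error of the orthogonal projection of the coordinates of
`X` to the space `U` of estimators. -/
def HasErrorCov (P : Measure Ω) (X : Ω → ι → ℝ) (U : Submodule ℝ (Ω → ℝ))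
    (S : Matrix ι ι ℝ) : Prop :=
  ∃ e : Ω → ι → ℝ, IsL2 P e ∧ (∀ i, (fun ω => X ω i - e ω i) ∈ U) ∧ IsOrtho P e U ∧
    secondMoment P e e = S

lemma HasErrorCov.posSemidef {U : Submodule ℝ (Ω → ℝ)} {S : Matrix ι ι ℝ}
    (h : HasErrorCov P X U S) : S.PosSemidef := by
  obtain ⟨e, he, -, -, rfl⟩ := h
  exact secondMoment_posSemidef he

/-- The error covariance does not change when an element of `U` is added to `X`. -/
lemma HasErrorCov.of_sub_mem {U : Submodule ℝ (Ω → ℝ)} {S : Matrix ι ι ℝ}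
    (h : HasErrorCov P X U S) (hX' : ∀ i, (fun ω => X' ω i - X ω i) ∈ U) :
    HasErrorCov P X' U S := by
  obtain ⟨e, he, hm, ho, hS⟩ := h
  refine ⟨e, he, fun i => ?_, ho, hS⟩
  convert! U.add_mem (hX' i) (hm i) using 1
  ext ω; simp

/-- The error covariance is unique: the difference of two errors lies in `U`, to which both are
orthogonal. -/
lemma HasErrorCov.unique {U : Submodule ℝ (Ω → ℝ)} {S S' : Matrix ι ι ℝ}
    (h : HasErrorCov P X U S) (h' : HasErrorCov P X U S') : S = S' := by
  obtain ⟨e, he, hm, ho, rfl⟩ := h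
  obtain ⟨e', he', hm', ho', rfl⟩ := h'
  have hd : ∀ i, (fun ω => (e ω - e' ω) i) ∈ U := fun i => by
    convert! U.sub_mem (hm' i) (hm i) using 1
    ext ω; simp
  have h1 : secondMoment P e e - secondMoment P e e' = 0 := by
    rw [← secondMoment_sub_right he he' he]
    exact ho.secondMoment_eq_zero hd
  have h2 : secondMoment P e' e - secondMoment P e' e' = 0 := by
    rw [← secondMoment_sub_right he he' he']
    exact ho'.secondMoment_eq_zero hd
  rw [sub_eq_zero] at h1 h2
  rw [h1, ← secondMoment_transpose, h2, secondMoment_transpose]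

/-- The normal equations of an LMMSE estimate, from optimality under perturbations by multiples of
an affine function of the observation. -/
lemma IsLMMSE.isOrtho [IsFiniteMeasure P] {Xhat : Ω → ι → ℝ} (hX : IsL2 P X) (hY : IsL2 P Y)
    (h : IsLMMSE P X Y Xhat) : IsOrtho P (fun ω => X ω - Xhat ω) (affineFunctions Y) := by
  classical
  obtain ⟨L, b, hL, hopt⟩ := h
  intro f hf i
  obtain ⟨l, c, hlc⟩ := exists_affine_of_mem_affineFunctions hf
  have hf2 := memLp_of_mem_affineFunctions hY hf
  have hhat : IsL2 P Xhat := fun i => by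
    simpa only [hL] using memLp_of_mem_affineFunctions hY (affine_mem_affineFunctions L b i)
  have he := hX.sub hhat
  have hef : Integrable (fun ω => (X ω - Xhat ω) i * f ω) P := MemLp.integrable_mul (he i) hf2
  have hff : Integrable (fun ω => f ω * f ω) P := MemLp.integrable_mul hf2 hf2
  have hee : Integrable (fun ω => ∑ k, (X ω k - Xhat ω k) ^ 2) P :=
    integrable_finsetSum _ fun k _ => by
      simpa [sq] using he.integrable_mul he k k
  set a := ∫ ω, (X ω - Xhat ω) i * f ω ∂P with ha
  set q := ∫ ω, f ω * f ω ∂P with hq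
  have key : ∀ r : ℝ, 0 ≤ r ^ 2 * q - 2 * r * a := by
    intro r
    set δ : ι → ℝ := Pi.single i 1 with hδ
    have h1 := hopt (L + r • vecMulVec δ l) (b + (r * c) • δ)
    have h2 : ∀ ω, ∑ k, (X ω k - ((L + r • vecMulVec δ l) *ᵥ Y ω + (b + (r * c) • δ)) k) ^ 2
        = ∑ k, (X ω k - Xhat ω k) ^ 2 + (r ^ 2 * (f ω * f ω)
          - 2 * r * ((X ω - Xhat ω) i * f ω)) := by
      intro ω
      have h3 : ∀ k, X ω k - ((L + r • vecMulVec δ l) *ᵥ Y ω + (b + (r * c) • δ)) k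
          = (X ω k - Xhat ω k) - r * f ω * δ k := by
        intro k
        simp only [hL, hlc, add_mulVec, smul_mulVec, vecMulVec_mulVec, Pi.add_apply, op_smul_eq_smul,
          Pi.smul_apply, smul_eq_mul]
        ring
      have h4 : ∀ k, (X ω k - Xhat ω k - r * f ω * δ k) ^ 2
          = (X ω k - Xhat ω k) ^ 2 + δ k * (r ^ 2 * (f ω * f ω)
            - 2 * r * ((X ω - Xhat ω) k * f ω)) := by
        intro k
        by_cases hk : k = i
        · subst hk; simp [hδ]; ring
        · simp [hδ, Pi.single_eq_of_ne hk]
      simp only [h3, h4, Finset.sum_add_distrib]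
      congr 1
      rw [Finset.sum_eq_single i (fun k _ hk => by simp [hδ, Pi.single_eq_of_ne hk]) (by simp)]
      simp [hδ]
    simp only [h2] at h1
    have hsub : Integrable (fun ω => r ^ 2 * (f ω * f ω) - 2 * r * ((X ω - Xhat ω) i * f ω)) P :=
      (hff.const_mul _).sub (hef.const_mul _)
    rw [integral_add hee hsub,
      integral_sub (hff.const_mul _) (hef.const_mul _), integral_const_mul, integral_const_mul,
      ← ha, ← hq] at h1
    linarith
  have hq0 : 0 ≤ q := integral_nonneg fun ω => mul_self_nonneg _
  by_contra hne
  have h5 := key (a / (q + 1))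
  have h6 : (a / (q + 1)) ^ 2 * q - 2 * (a / (q + 1)) * a = -(a ^ 2 * (q + 2)) / (q + 1) ^ 2 := by
    field_simp
    ring
  rw [h6] at h5
  have h7 : 0 < a ^ 2 * (q + 2) / (q + 1) ^ 2 := by positivity
  rw [neg_div] at h5
  linarith

lemma IsLMMSE.hasErrorCov [IsFiniteMeasure P] {Xhat : Ω → ι → ℝ} (hX : IsL2 P X) (hY : IsL2 P Y)
    (h : IsLMMSE P X Y Xhat) : HasErrorCov P X (affineFunctions Y)
      (secondMoment P (fun ω => X ω - Xhat ω) (fun ω => X ω - Xhat ω)) := by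
  have ho := h.isOrtho hX hY
  obtain ⟨L, b, hL, -⟩ := h
  have hmem : ∀ i, (fun ω => Xhat ω i) ∈ affineFunctions Y := fun i => by
    simpa only [hL] using affine_mem_affineFunctions L b i
  refine ⟨_, hX.sub fun i => memLp_of_mem_affineFunctions hY (hmem i), fun i => ?_, ho, rfl⟩
  simpa using hmem i

/-- Update of an estimation error `X` by the innovation `ε`. -/
lemma hasErrorCov_innovation [DecidableEq κ] {U U' : Submodule ℝ (Ω → ℝ)} {ε : Ω → κ → ℝ}
    (hX2 : IsL2 P X) (hε2 : IsL2 P ε) (hU2 : ∀ f ∈ U, MemLp f 2 P) (hX : IsOrtho P X U)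
    (hε : IsOrtho P ε U) (hε' : ∀ j, (fun ω => ε ω j) ∈ U')
    (hU' : U' ≤ U ⊔ Submodule.span ℝ (Set.range fun j ω => ε ω j))
    (hdet : IsUnit (secondMoment P ε ε).det) :
    HasErrorCov P X U' (secondMoment P X X
      - secondMoment P X ε * (secondMoment P ε ε)⁻¹ * secondMoment P ε X) := by
  set L := secondMoment P X ε * (secondMoment P ε ε)⁻¹ with hL
  have hLε := hε2.mulVec L
  have he2 := hX2.sub hLε
  have hspan2 : ∀ f ∈ Set.range fun j ω => ε ω j, MemLp f 2 P := by
    rintro _ ⟨j, rfl⟩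
    exact hε2 j
  have hspan2' : ∀ f ∈ Submodule.span ℝ (Set.range fun j ω => ε ω j), MemLp f 2 P := by
    intro f hf
    induction hf using Submodule.span_induction with
    | mem f hf => exact hspan2 f hf
    | zero => simp
    | add f g _ _ hf hg => exact hf.add hg
    | smul c f _ hf => exact hf.const_smul c
  have hmom : secondMoment P (fun ω => X ω - L *ᵥ ε ω) ε = 0 := by
    rw [secondMoment_sub_left hX2 hLε hε2, secondMoment_mulVec_left L hε2 hε2, hL,
      nonsing_inv_mul_cancel_right _ _ hdet, sub_self]
  refine ⟨fun ω => X ω - L *ᵥ ε ω, he2, fun i => ?_, ?_, ?_⟩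
  · simpa using mulVec_mem hε' L i
  · refine IsOrtho.mono (IsOrtho.sup he2 (IsOrtho.sub hX2 hLε hU2 hX (hε.mulVec hε2 hU2 L))
      (isOrtho_span he2 hspan2 ?_) hU2 hspan2') hU'
    rintro _ ⟨j, rfl⟩ i
    exact congrFun (congrFun hmom i) j
  · rw [secondMoment_sub_right hX2 hLε he2, secondMoment_mulVec_right L hε2 he2, hmom,
      Matrix.zero_mul, sub_zero, secondMoment_sub_left hX2 hLε hX2,
      secondMoment_mulVec_left L hε2 hX2]

end SecondMoments

section Loop

variable {Ω : Type*} [MeasurableSpace Ω] {n m p : ℕ}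

/-! ### Second-order description of the closed loops -/

/-- The estimators that are affine in the first `r` samples of `y` and the first `s` samples
of `x²`. -/
def obsSpan (y : ℕ → Ω → Fin n → ℝ) (x : ℕ → Ω → Fin n ⊕ Fin m → ℝ) (r s : ℕ) :
    Submodule ℝ (Ω → ℝ) :=
  affineFunctions (observations y x r s)

variable {y : ℕ → Ω → Fin n → ℝ} {x : ℕ → Ω → Fin n ⊕ Fin m → ℝ}

lemma measurement_mem_obsSpan {r s t : ℕ} (h : t < r) (i : Fin n) :
    (fun ω => y t ω i) ∈ obsSpan y x r s :=
  coord_mem_affineFunctions (Y := observations y x r s) (Sum.inl (⟨t, h⟩, i))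

lemma sndPart_mem_obsSpan {r s t : ℕ} (h : t < s) (i : Fin m) :
    (fun ω => sndPart (x t ω) i) ∈ obsSpan y x r s :=
  coord_mem_affineFunctions (Y := observations y x r s) (Sum.inr (⟨t, h⟩, i))

lemma obsSpan_le {r s : ℕ} {U : Submodule ℝ (Ω → ℝ)} (h1 : (fun _ => 1) ∈ U)
    (hy : ∀ t < r, ∀ i, (fun ω => y t ω i) ∈ U)
    (hx : ∀ t < s, ∀ i, (fun ω => sndPart (x t ω) i) ∈ U) : obsSpan y x r s ≤ U := by
  refine affineFunctions_le h1 ?_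
  rintro (⟨t, i⟩ | ⟨t, i⟩)
  · exact hy t t.2 i
  · exact hx t t.2 i

lemma obsSpan_mono {r s r' s' : ℕ} (hr : r ≤ r') (hs : s ≤ s') :
    obsSpan y x r s ≤ obsSpan y x r' s' :=
  obsSpan_le one_mem_affineFunctions (fun _ ht i => measurement_mem_obsSpan (ht.trans_le hr) i)
    (fun _ ht i => sndPart_mem_obsSpan (ht.trans_le hs) i)

lemma isL2_observations {P : Measure Ω} {r s : ℕ} (hy : ∀ t < r, IsL2 P (y t))
    (hx : ∀ t < s, IsL2 P (x t)) : IsL2 P (observations y x r s) := by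
  rintro (⟨t, i⟩ | ⟨t, i⟩)
  · exact hy t t.2 i
  · exact hx t t.2 (Sum.inr i)

/-- The second-order properties shared by the Gaussian and the quantized loop: up to known affine
functions of past observations, `y = C x¹ + ν` and `x⁺ = Ā x¹ + w`, where `ν` and `w` are white and
uncorrelated with the past. -/
structure IsSecondOrderLoop (M : Plant n m p) (C : Matrix (Fin n) (Fin n) ℝ) (P : Measure Ω)
    (x w : ℕ → Ω → Fin n ⊕ Fin m → ℝ) (ν y : ℕ → Ω → Fin n → ℝ) : Prop where
  l2_x : ∀ t, IsL2 P (x t)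
  l2_y : ∀ t, IsL2 P (y t)
  l2_w : ∀ t, IsL2 P (w t)
  l2_ν : ∀ t, IsL2 P (ν t)
  sensor : ∀ t i, (fun ω => (y t ω - (C *ᵥ fstPart (x t ω) + ν t ω)) i) ∈ obsSpan y x t (t + 1)
  plant : ∀ t i, (fun ω => (x (t + 1) ω - (M.Abar *ᵥ fstPart (x t ω) + w t ω)) i) ∈
    obsSpan y x (t + 1) (t + 1)
  ortho_ν : ∀ t, IsOrtho P (ν t) (obsSpan y x t (t + 1))
  ortho_w : ∀ t, IsOrtho P (w t) (obsSpan y x (t + 1) (t + 1))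
  ν_x : ∀ t, secondMoment P (ν t) (x t) = 0
  w_x : ∀ t, secondMoment P (w t) (x t) = 0
  cov_ν : ∀ t, secondMoment P (ν t) (ν t) = 1
  cov_w : ∀ t, secondMoment P (w t) (w t) = M.W

lemma IsL2.fstPart {P : Measure Ω} {X : Ω → Fin n ⊕ Fin m → ℝ} (h : IsL2 P X) :
    IsL2 P (fun ω => fstPart (X ω)) := fun i => h (Sum.inl i)

lemma IsL2.sndPart {P : Measure Ω} {X : Ω → Fin n ⊕ Fin m → ℝ} (h : IsL2 P X) :
    IsL2 P (fun ω => sndPart (X ω)) := fun i => h (Sum.inr i)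

namespace IsSecondOrderLoop

variable {M : Plant n m p} {C : Matrix (Fin n) (Fin n) ℝ} {P : Measure Ω} [IsFiniteMeasure P]
  {w : ℕ → Ω → Fin n ⊕ Fin m → ℝ} {ν : ℕ → Ω → Fin n → ℝ}

lemma memLp_of_mem (h : IsSecondOrderLoop M C P x w ν y) {r s : ℕ} :
    ∀ f ∈ obsSpan y x r s, MemLp f 2 P := fun _ hf =>
  memLp_of_mem_affineFunctions (isL2_observations (fun t _ => h.l2_y t) (fun t _ => h.l2_x t)) hf

/-- A vector uncorrelated with `x t` and with the estimators is uncorrelated with every estimation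
error of `x¹ t`. -/
lemma secondMoment_error_eq_zero (h : IsSecondOrderLoop M C P x w ν y) {ι : Type*} [Fintype ι]
    {t r s : ℕ} {q : Ω → ι → ℝ} (hq2 : IsL2 P q) (hq : IsOrtho P q (obsSpan y x r s))
    (hqx : secondMoment P q (x t) = 0) {e : Ω → Fin n → ℝ} (he2 : IsL2 P e)
    (he : ∀ i, (fun ω => fstPart (x t ω) i - e ω i) ∈ obsSpan y x r s) :
    secondMoment P q e = 0 := by
  have h1 : secondMoment P q (fun ω => fstPart (x t ω) - e ω) = 0 := hq.secondMoment_eq_zero he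
  have h2 : secondMoment P q (fun ω => fstPart (x t ω)) = 0 := by
    ext i j
    exact congrFun (congrFun hqx i) (Sum.inl j)
  rw [secondMoment_sub_right (h.l2_x t).fstPart he2 hq2, h2, zero_sub, neg_eq_zero] at h1
  exact h1

/-- The innovation of the measurement `y t`, its orthogonality to the past, and its covariance. -/
lemma measurement_innovation (h : IsSecondOrderLoop M C P x w ν y) {t : ℕ} {e : Ω → Fin n → ℝ}
    (he2 : IsL2 P e) (hem : ∀ i, (fun ω => fstPart (x t ω) i - e ω i) ∈ obsSpan y x t (t + 1))
    (heo : IsOrtho P e (obsSpan y x t (t + 1))) :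
    IsOrtho P (fun ω => C *ᵥ e ω + ν t ω) (obsSpan y x t (t + 1)) ∧
    (∀ i, (fun ω => (y t ω - (C *ᵥ e ω + ν t ω)) i) ∈ obsSpan y x t (t + 1)) ∧
    secondMoment P e (fun ω => C *ᵥ e ω + ν t ω) = secondMoment P e e * Cᵀ ∧
    secondMoment P (fun ω => C *ᵥ e ω + ν t ω) (fun ω => C *ᵥ e ω + ν t ω)
      = C * secondMoment P e e * Cᵀ + 1 := by
  have hCe := he2.mulVec C
  have hν := h.l2_ν t
  have hνe := h.secondMoment_error_eq_zero hν (h.ortho_ν t) (h.ν_x t) he2 hem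
  have heν : secondMoment P e (ν t) = 0 := by rw [← secondMoment_transpose, hνe, transpose_zero]
  have h1 : secondMoment P e (fun ω => C *ᵥ e ω + ν t ω) = secondMoment P e e * Cᵀ := by
    rw [secondMoment_add_right hCe hν he2, secondMoment_mulVec_right C he2 he2, heν, add_zero]
  refine ⟨IsOrtho.add hCe hν h.memLp_of_mem (heo.mulVec he2 h.memLp_of_mem C) (h.ortho_ν t),
    fun i => ?_, h1, ?_⟩
  · convert! (obsSpan y x t (t + 1)).add_mem (h.sensor t i) (mulVec_mem hem C i) using 1
    ext ω
    have : C *ᵥ (fun j => fstPart (x t ω) j - e ω j) = C *ᵥ fstPart (x t ω) - C *ᵥ e ω :=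
      mulVec_sub C _ _
    simp [this]
    ring
  · rw [secondMoment_add_left hCe hν (hCe.add hν), secondMoment_mulVec_left C he2 (hCe.add hν), h1,
      secondMoment_add_right hCe hν hν, secondMoment_mulVec_right C he2 hν, hνe, h.cov_ν,
      Matrix.zero_mul, zero_add, Matrix.mul_assoc]

/-- The measurement update of the Kalman filter, by the new measurement `y t`. -/
lemma measurement_update (h : IsSecondOrderLoop M C P x w ν y) {t : ℕ}
    {S : Matrix (Fin n) (Fin n) ℝ}
    (hS : HasErrorCov P (fun ω => fstPart (x t ω)) (obsSpan y x t (t + 1)) S) :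
    HasErrorCov P (fun ω => fstPart (x t ω)) (obsSpan y x (t + 1) (t + 1))
      (filterUpdate 1 C 1 0 S) := by
  have hSpos := hS.posSemidef
  obtain ⟨e, he2, hem, heo, rfl⟩ := hS
  obtain ⟨ho, hym, h1, h2⟩ := h.measurement_innovation he2 hem heo
  have hle : obsSpan y x t (t + 1) ≤ obsSpan y x (t + 1) (t + 1) :=
    obsSpan_mono t.le_succ le_rfl
  have hε2 := (he2.mulVec C).add (h.l2_ν t)
  have hdet : IsUnit (secondMoment P (fun ω => C *ᵥ e ω + ν t ω)
      (fun ω => C *ᵥ e ω + ν t ω)).det := by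
    rw [h2]
    exact (innovation_posDef C .one hSpos).det_pos.ne'.isUnit
  have key := hasErrorCov_innovation (U' := obsSpan y x (t + 1) (t + 1)) he2 hε2 h.memLp_of_mem heo
    ho (fun j => ?_) ?_ hdet
  · have h3 : filterUpdate 1 C 1 0 (secondMoment P e e) = secondMoment P e e
        - secondMoment P e e * Cᵀ * (C * secondMoment P e e * Cᵀ + 1)⁻¹
          * (C * secondMoment P e e) := by
      simp [filterUpdate]
    rw [← secondMoment_transpose (X := e) (Y := fun ω => C *ᵥ e ω + ν t ω), h1, h2,
      transpose_mul, transpose_transpose, secondMoment_transpose, ← h3] at key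
    exact key.of_sub_mem fun i => hle (hem i)
  · convert! (obsSpan y x (t + 1) (t + 1)).sub_mem
      (measurement_mem_obsSpan (y := y) (x := x) t.lt_succ_self j) (hle (hym j)) using 1
    ext ω; simp
  · refine obsSpan_le (Submodule.mem_sup_left one_mem_affineFunctions) (fun k hk i => ?_)
      (fun k hk i => Submodule.mem_sup_left (sndPart_mem_obsSpan hk i))
    obtain hk | rfl := Nat.lt_succ_iff_lt_or_eq.1 hk
    · exact Submodule.mem_sup_left (measurement_mem_obsSpan hk i)
    · convert! Submodule.add_mem _ (Submodule.mem_sup_left (hym i))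
        (Submodule.mem_sup_right (Submodule.subset_span (Set.mem_range_self i))) using 1
      ext ω; simp

/-- The prediction step of the Kalman filter. The observation gained is `x² (t + 1)`, whose innovation
is `A₂₁` times the error of `x¹ t` plus the noise `w² t`. -/
lemma prediction_update (h : IsSecondOrderLoop M C P x w ν y) {t : ℕ}
    {S : Matrix (Fin n) (Fin n) ℝ}
    (hS : HasErrorCov P (fun ω => fstPart (x t ω)) (obsSpan y x (t + 1) (t + 1)) S) :
    HasErrorCov P (fun ω => fstPart (x (t + 1) ω)) (obsSpan y x (t + 1) (t + 2))
      (filterUpdate M.A₁₁ M.A₂₁ M.W₂₂ M.W₁₁ S) := by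
  have hSpos := hS.posSemidef
  obtain ⟨e, he2, hem, heo, rfl⟩ := hS
  set z : Ω → Fin n ⊕ Fin m → ℝ := fun ω => M.Abar *ᵥ e ω + w t ω with hz
  have hAe := he2.mulVec M.Abar
  have hw := h.l2_w t
  have hz2 : IsL2 P z := hAe.add hw
  have hwe := h.secondMoment_error_eq_zero hw (h.ortho_w t) (h.w_x t) he2 hem
  have hew : secondMoment P e (w t) = 0 := by rw [← secondMoment_transpose, hwe, transpose_zero]
  have hzz : secondMoment P z z = M.Abar * secondMoment P e e * M.Abarᵀ + M.W := by
    rw [hz, secondMoment_add_left hAe hw hz2, secondMoment_mulVec_left _ he2 hz2,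
      secondMoment_add_right hAe hw he2, secondMoment_add_right hAe hw hw,
      secondMoment_mulVec_right _ he2 he2, secondMoment_mulVec_right _ he2 hw, hwe, hew, h.cov_w,
      Matrix.zero_mul, zero_add, add_zero, Matrix.mul_assoc]
  have hzo : IsOrtho P z (obsSpan y x (t + 1) (t + 1)) :=
    IsOrtho.add hAe hw h.memLp_of_mem (heo.mulVec he2 h.memLp_of_mem _) (h.ortho_w t)
  have hxm : ∀ i, (fun ω => (x (t + 1) ω - z ω) i) ∈ obsSpan y x (t + 1) (t + 1) := fun i => by
    convert! (obsSpan y x (t + 1) (t + 1)).add_mem (h.plant t i) (mulVec_mem hem M.Abar i) using 1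
    ext ω
    have : M.Abar *ᵥ (fun j => fstPart (x t ω) j - e ω j)
        = M.Abar *ᵥ fstPart (x t ω) - M.Abar *ᵥ e ω := mulVec_sub _ _ _
    simp [this, hz]
    ring
  have hle : obsSpan y x (t + 1) (t + 1) ≤ obsSpan y x (t + 1) (t + 2) :=
    obsSpan_mono le_rfl (t + 1).le_succ
  have h11 : secondMoment P (fun ω => fstPart (z ω)) (fun ω => fstPart (z ω))
      = M.A₁₁ * secondMoment P e e * M.A₁₁ᵀ + M.W₁₁ := by
    ext i j
    exact (congrFun (congrFun hzz (Sum.inl i)) (Sum.inl j)).trans rfl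
  have h12 : secondMoment P (fun ω => fstPart (z ω)) (fun ω => sndPart (z ω))
      = M.A₁₁ * secondMoment P e e * M.A₂₁ᵀ := by
    ext i j
    exact (congrFun (congrFun hzz (Sum.inl i)) (Sum.inr j)).trans (add_zero _)
  have h22 : secondMoment P (fun ω => sndPart (z ω)) (fun ω => sndPart (z ω))
      = M.A₂₁ * secondMoment P e e * M.A₂₁ᵀ + M.W₂₂ := by
    ext i j
    exact (congrFun (congrFun hzz (Sum.inr i)) (Sum.inr j)).trans rfl
  have hdet : IsUnit (secondMoment P (fun ω => sndPart (z ω)) (fun ω => sndPart (z ω))).det := by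
    rw [h22]
    exact (innovation_posDef _ M.posDef_W₂₂ hSpos).det_pos.ne'.isUnit
  have key := hasErrorCov_innovation (U := obsSpan y x (t + 1) (t + 1))
    (U' := obsSpan y x (t + 1) (t + 2)) hz2.fstPart hz2.sndPart
    h.memLp_of_mem (fun f hf i => hzo f hf (Sum.inl i)) (fun f hf i => hzo f hf (Sum.inr i))
    (fun j => ?_) ?_ hdet
  · rw [← secondMoment_transpose (X := fun ω => fstPart (z ω)) (Y := fun ω => sndPart (z ω)),
      h11, h12, h22, transpose_mul, transpose_mul, transpose_transpose] at key
    have h3 := key.of_sub_mem (X' := fun ω => fstPart (x (t + 1) ω))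
      fun i => hle (hxm (Sum.inl i))
    rwa [secondMoment_transpose, ← Matrix.mul_assoc M.A₂₁] at h3
  · convert! (obsSpan y x (t + 1) (t + 2)).sub_mem
      (sndPart_mem_obsSpan (y := y) (x := x) (t + 1).lt_succ_self j) (hle (hxm (Sum.inr j))) using 1
    ext ω; simp [sndPart]
  · refine obsSpan_le (Submodule.mem_sup_left one_mem_affineFunctions)
      (fun k hk i => Submodule.mem_sup_left (measurement_mem_obsSpan hk i)) (fun k hk i => ?_)
    obtain hk | rfl := Nat.lt_succ_iff_lt_or_eq.1 hk
    · exact Submodule.mem_sup_left (sndPart_mem_obsSpan hk i)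
    · convert! Submodule.add_mem _ (Submodule.mem_sup_left (hxm (Sum.inr i)))
        (Submodule.mem_sup_right (Submodule.subset_span (Set.mem_range_self i))) using 1
      ext ω; simp [sndPart]

/-- The a priori error covariances follow the Riccati recursion. -/
lemma hasErrorCov_iterate (h : IsSecondOrderLoop M C P x w ν y) {S : Matrix (Fin n) (Fin n) ℝ}
    (hS : HasErrorCov P (fun ω => fstPart (x 0 ω)) (obsSpan y x 0 1) S) (t : ℕ) :
    HasErrorCov P (fun ω => fstPart (x t ω)) (obsSpan y x t (t + 1)) ((M.riccati C)^[t] S) := by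
  induction t with
  | zero => exact hS
  | succ t ih =>
    rw [Function.iterate_succ_apply']
    exact h.prediction_update (h.measurement_update ih)

end IsSecondOrderLoop

end Loop

/-! ### Independence of the noise from the past -/

section Independence

variable {Ω α β γ : Type*} [MeasurableSpace Ω] [MeasurableSpace α] [MeasurableSpace β]
  [MeasurableSpace γ] {P : Measure Ω} [IsProbabilityMeasure P]

lemma indepFun_prodMk_left {X : Ω → α} {Y : Ω → β} {Z : Ω → γ} (hX : Measurable X)
    (hY : Measurable Y) (hZ : Measurable Z) (h1 : IndepFun X (fun ω => (Y ω, Z ω)) P)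
    (h2 : IndepFun Y Z P) : IndepFun (fun ω => (X ω, Y ω)) Z P := by
  have := Measure.isProbabilityMeasure_map (μ := P) hX.aemeasurable
  have := Measure.isProbabilityMeasure_map (μ := P) hY.aemeasurable
  have := Measure.isProbabilityMeasure_map (μ := P) hZ.aemeasurable
  have h3 : IndepFun X Y P := h1.comp measurable_id measurable_fst
  rw [indepFun_iff_map_prod_eq_prod_map_map (by fun_prop) (by fun_prop)] at h1 h2 h3 ⊢
  rw [h3]
  rw [h2] at h1
  have h4 : (fun ω => ((X ω, Y ω), Z ω))
      = MeasurableEquiv.prodAssoc.symm ∘ fun ω => (X ω, (Y ω, Z ω)) := rfl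
  rw [h4, ← Measure.map_map (MeasurableEquiv.measurable _) (by fun_prop), h1,
    MeasurableEquiv.map_apply_eq_iff_map_symm_apply_eq, MeasurableEquiv.symm_symm,
    Measure.prodAssoc_prod]

/-- The initial state, the first `r` samples of `w` and the first `s` samples of `v`. -/
def primitives (x₀ : Ω → α) (w : ℕ → Ω → α) (v : ℕ → Ω → β) (r s : ℕ) :
    Ω → α × (Fin r → α) × (Fin s → β) :=
  fun ω => (x₀ ω, history w r ω, history v s ω)

/-- The `σ`-algebra of the initial state and of the first `r` samples of `w` and `s` samples
of `v`. -/
@[reducible] def past (x₀ : Ω → α) (w : ℕ → Ω → α) (v : ℕ → Ω → β) (r s : ℕ) : MeasurableSpace Ω :=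
  MeasurableSpace.comap (primitives x₀ w v r s) inferInstance

variable {x₀ : Ω → α} {w : ℕ → Ω → α} {v : ℕ → Ω → β} {lw : Measure α} {lv : Measure β}

lemma past_mono {r s r' s' : ℕ} (hr : r ≤ r') (hs : s ≤ s') :
    past x₀ w v r s ≤ past x₀ w v r' s' := by
  have h : primitives x₀ w v r s = (fun z : α × (Fin r' → α) × (Fin s' → β) =>
      (z.1, (fun i => z.2.1 (Fin.castLE hr i)), fun i => z.2.2 (Fin.castLE hs i)))
      ∘ primitives x₀ w v r' s' := rfl
  rw [past, h, ← MeasurableSpace.comap_comp]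
  exact MeasurableSpace.comap_mono (Measurable.comap_le (by fun_prop))

lemma measurable_past_init {r s : ℕ} : Measurable[past x₀ w v r s] x₀ :=
  measurable_fst.comp (comap_measurable (primitives x₀ w v r s))

lemma measurable_past_w {r s t : ℕ} (h : t < r) : Measurable[past x₀ w v r s] (w t) :=
  ((measurable_pi_apply (⟨t, h⟩ : Fin r)).comp (measurable_fst.comp measurable_snd)).comp
    (comap_measurable (primitives x₀ w v r s))

lemma measurable_past_v {r s t : ℕ} (h : t < s) : Measurable[past x₀ w v r s] (v t) :=
  ((measurable_pi_apply (⟨t, h⟩ : Fin s)).comp (measurable_snd.comp measurable_snd)).comp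
    (comap_measurable (primitives x₀ w v r s))

omit [IsProbabilityMeasure P] in
lemma measurable_history {q : ℕ → Ω → α} (hq : ∀ t, Measurable (q t)) (r : ℕ) :
    Measurable (history q r) :=
  measurable_pi_lambda _ fun i => hq i

lemma IsPrimitive.past_le (h : IsPrimitive P x₀ w v lw lv) (r s : ℕ) :
    past x₀ w v r s ≤ ‹MeasurableSpace Ω› :=
  Measurable.comap_le (h.measurable_init.prodMk
    ((measurable_history h.measurable_w r).prodMk (measurable_history h.measurable_v s)))

omit [IsProbabilityMeasure P] in
lemma indepFun_history_self {q : ℕ → Ω → α} (hq : ∀ t, Measurable (q t)) (hind : iIndepFun q P)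
    (r : ℕ) : IndepFun (history q r) (q r) P := by
  have h := hind.indepFun_finset (Finset.range r) {r} (by simp) hq
  exact h.comp
    (φ := fun (z : Finset.range r → α) (i : Fin r) => z ⟨i, Finset.mem_range.2 i.2⟩)
    (ψ := fun z : ({r} : Finset ℕ) → α => z ⟨r, Finset.mem_singleton_self r⟩)
    (measurable_pi_lambda _ fun i => measurable_pi_apply _) (measurable_pi_apply _)

lemma IsPrimitive.indepFun_w (h : IsPrimitive P x₀ w v lw lv) {r s : ℕ} {f : Ω → γ}
    (hf : Measurable[past x₀ w v r s] f) : IndepFun f (w r) P := by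
  have hw : Measurable (history w r) := measurable_history h.measurable_w r
  have hv : Measurable (history v s) := measurable_history h.measurable_v s
  have h1 : IndepFun (history v s) (fun ω => (history w r ω, w r ω)) P :=
    h.indep_w_v.symm.comp (φ := fun (z : ℕ → β) (i : Fin s) => z i)
      (ψ := fun z : ℕ → α => (fun i : Fin r => z i, z r)) (by fun_prop) (by fun_prop)
  have h2 := indepFun_prodMk_left hv hw (h.measurable_w r) h1
    (indepFun_history_self h.measurable_w h.iIndep_w r)
  have h3 := indepFun_prodMk_left h.measurable_init (hw.prodMk hv) (h.measurable_w r)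
    (h.indep_init.comp (φ := id)
      (ψ := fun z : (ℕ → α) × (ℕ → β) => ((fun i : Fin r => z.1 i, fun i : Fin s => z.2 i), z.1 r))
      measurable_id (by fun_prop)) (h2.comp measurable_swap measurable_id)
  exact indep_of_indep_of_le_left h3 hf.comap_le

lemma IsPrimitive.indepFun_v (h : IsPrimitive P x₀ w v lw lv) {r s : ℕ} {f : Ω → γ}
    (hf : Measurable[past x₀ w v r s] f) : IndepFun f (v s) P := by
  have hw : Measurable (history w r) := measurable_history h.measurable_w r
  have hv : Measurable (history v s) := measurable_history h.measurable_v s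
  have h1 : IndepFun (history w r) (fun ω => (history v s ω, v s ω)) P :=
    h.indep_w_v.comp (φ := fun (z : ℕ → α) (i : Fin r) => z i)
      (ψ := fun z : ℕ → β => (fun i : Fin s => z i, z s)) (by fun_prop) (by fun_prop)
  have h2 := indepFun_prodMk_left hw hv (h.measurable_v s) h1
    (indepFun_history_self h.measurable_v h.iIndep_v s)
  have h3 := indepFun_prodMk_left h.measurable_init (hw.prodMk hv) (h.measurable_v s)
    (h.indep_init.comp (φ := id)
      (ψ := fun z : (ℕ → α) × (ℕ → β) => ((fun i : Fin r => z.1 i, fun i : Fin s => z.2 i), z.2 s))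
      measurable_id (by fun_prop)) h2
  exact indep_of_indep_of_le_left h3 hf.comap_le

end Independence

/-! ### Adaptedness and square integrability of the closed loops -/

section Adapted

variable {Ω : Type*} [MeasurableSpace Ω] {n m p : ℕ} {P : Measure Ω} [IsProbabilityMeasure P]
  {M : Plant n m p} {C : Matrix (Fin n) (Fin n) ℝ}
  {x w : ℕ → Ω → Fin n ⊕ Fin m → ℝ} {ν y : ℕ → Ω → Fin n → ℝ}

/-- Induction along the loop `x 0, y 0, x 1, y 1, …`. -/
lemma loop_induction {A B : ℕ → Prop} (h0 : A 0)
    (hB : ∀ t, (∀ s ≤ t, A s) → (∀ s < t, B s) → B t)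
    (hA : ∀ t, (∀ s ≤ t, A s) → (∀ s ≤ t, B s) → A (t + 1)) (t : ℕ) : A t ∧ B t := by
  induction t using Nat.strong_induction_on with
  | _ t ih =>
    have hAt : A t := by
      cases t with
      | zero => exact h0
      | succ t =>
        exact hA t (fun s hs => (ih s (Nat.lt_succ_of_le hs)).1)
          (fun s hs => (ih s (Nat.lt_succ_of_le hs)).2)
    refine ⟨hAt, hB t (fun s hs => ?_) fun s hs => (ih s hs).2⟩
    obtain hs | rfl := hs.lt_or_eq
    · exact (ih s hs).1
    · exact hAt

lemma l2_of_sensor_plant (h0 : IsL2 P (x 0)) (hw : ∀ t, IsL2 P (w t)) (hν : ∀ t, IsL2 P (ν t))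
    (sensor : ∀ t i,
      (fun ω => (y t ω - (C *ᵥ fstPart (x t ω) + ν t ω)) i) ∈ obsSpan y x t (t + 1))
    (plant : ∀ t i, (fun ω => (x (t + 1) ω - (M.Abar *ᵥ fstPart (x t ω) + w t ω)) i) ∈
      obsSpan y x (t + 1) (t + 1)) (t : ℕ) : IsL2 P (x t) ∧ IsL2 P (y t) := by
  refine loop_induction (A := fun t => IsL2 P (x t)) (B := fun t => IsL2 P (y t)) h0
    (fun t hx hy => ?_) (fun t hx hy => ?_) t
  · intro i
    have h1 := memLp_of_mem_affineFunctions (isL2_observations hy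
      fun s hs => hx s (Nat.lt_succ_iff.1 hs)) (sensor t i)
    convert! h1.add ((((hx t le_rfl).fstPart.mulVec C).add (hν t)) i) using 1
    ext ω; simp
  · intro i
    have h1 := memLp_of_mem_affineFunctions (isL2_observations
      (fun s hs => hy s (Nat.lt_succ_iff.1 hs))
      fun s hs => hx s (Nat.lt_succ_iff.1 hs)) (plant t i)
    convert! h1.add ((((hx t le_rfl).fstPart.mulVec M.Abar).add (hw t)) i) using 1
    ext ω; simp

lemma measurable_of_mem_affineFunctions {m₀ : MeasurableSpace Ω} {κ : Type*} [Fintype κ]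
    {Y : Ω → κ → ℝ} (hY : Measurable[m₀] Y) {f : Ω → ℝ} (hf : f ∈ affineFunctions Y) :
    Measurable[m₀] f := by
  obtain ⟨l, b, h⟩ := exists_affine_of_mem_affineFunctions hf
  have h1 : f = (fun z : κ → ℝ => l ⬝ᵥ z + b) ∘ Y := funext h
  rw [h1]
  refine Measurable.comp ?_ hY
  simp only [dotProduct]
  fun_prop

lemma measurable_fstPart : Measurable (fstPart (n := n) (m := m)) :=
  measurable_pi_lambda _ fun _ => measurable_pi_apply _

lemma measurable_sndPart : Measurable (sndPart (n := n) (m := m)) :=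
  measurable_pi_lambda _ fun _ => measurable_pi_apply _

lemma measurable_mulVec {ι κ : Type*} [Fintype κ] (A : Matrix ι κ ℝ) :
    Measurable fun z : κ → ℝ => A *ᵥ z := by
  refine measurable_pi_lambda _ fun i => ?_
  simp only [mulVec, dotProduct]
  fun_prop

lemma measurable_observations {m₀ : MeasurableSpace Ω} {r s : ℕ}
    (hy : ∀ t < r, Measurable[m₀] (y t)) (hx : ∀ t < s, Measurable[m₀] (x t)) :
    Measurable[m₀] (observations y x r s) := by
  refine @measurable_pi_lambda _ _ _ m₀ _ _ ?_
  rintro (⟨t, i⟩ | ⟨t, i⟩)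
  · exact (measurable_pi_apply i).comp (hy t t.2)
  · exact (measurable_pi_apply (Sum.inr i)).comp (hx t t.2)

/-- In both loops `x t` is a function of the primitive variables up to `w (t - 1)`, `v (t - 1)`,
and `y t` of those up to `w (t - 1)`, `v t`. -/
lemma measurable_past_of_sensor_plant {v : ℕ → Ω → Fin n → ℝ}
    (hν : ∀ t, (∀ s ≤ t, Measurable[past (x 0) w v t t] (x s)) →
      (∀ s < t, Measurable[past (x 0) w v t t] (y s)) →
      Measurable[past (x 0) w v t (t + 1)] (ν t))
    (sensor : ∀ t i,
      (fun ω => (y t ω - (C *ᵥ fstPart (x t ω) + ν t ω)) i) ∈ obsSpan y x t (t + 1))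
    (plant : ∀ t i, (fun ω => (x (t + 1) ω - (M.Abar *ᵥ fstPart (x t ω) + w t ω)) i) ∈
      obsSpan y x (t + 1) (t + 1)) (t : ℕ) :
    Measurable[past (x 0) w v t t] (x t) ∧ Measurable[past (x 0) w v t (t + 1)] (y t) := by
  refine loop_induction (A := fun t => Measurable[past (x 0) w v t t] (x t))
    (B := fun t => Measurable[past (x 0) w v t (t + 1)] (y t)) measurable_past_init
    (fun t hx hy => ?_) (fun t hx hy => ?_) t
  · have hx' : ∀ s ≤ t, Measurable[past (x 0) w v t t] (x s) := fun s hs =>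
      (hx s hs).mono (past_mono hs hs) le_rfl
    have hy' : ∀ s < t, Measurable[past (x 0) w v t t] (y s) := fun s hs =>
      (hy s hs).mono (past_mono hs.le hs) le_rfl
    have hle : past (x 0) w v t t ≤ past (x 0) w v t (t + 1) := past_mono le_rfl t.le_succ
    have hobs := measurable_observations hy' (fun s hs => hx' s (Nat.lt_succ_iff.1 hs))
    refine @measurable_pi_lambda _ _ _ (past (x 0) w v t (t + 1)) _ _ fun i => ?_
    have h1 := (measurable_of_mem_affineFunctions hobs (sensor t i)).mono hle le_rfl
    have h2 := ((measurable_pi_apply i).comp ((measurable_mulVec C).comp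
      (measurable_fstPart.comp (hx' t le_rfl)))).mono hle le_rfl
    have h3 := (measurable_pi_apply i).comp (hν t hx' hy')
    convert! h1.add (h2.add h3) using 1
    ext ω; simp
  · have hx' : ∀ s < t + 1, Measurable[past (x 0) w v (t + 1) (t + 1)] (x s) := fun s hs =>
      (hx s (Nat.lt_succ_iff.1 hs)).mono (past_mono hs.le hs.le) le_rfl
    have hy' : ∀ s < t + 1, Measurable[past (x 0) w v (t + 1) (t + 1)] (y s) := fun s hs =>
      (hy s (Nat.lt_succ_iff.1 hs)).mono (past_mono hs.le hs) le_rfl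
    have hobs := measurable_observations hy' hx'
    refine @measurable_pi_lambda _ _ _ (past (x 0) w v (t + 1) (t + 1)) _ _ fun i => ?_
    have h1 := measurable_of_mem_affineFunctions hobs (plant t i)
    have h2 := (measurable_pi_apply i).comp ((measurable_mulVec M.Abar).comp
      (measurable_fstPart.comp (hx' t t.lt_succ_self)))
    have h3 := (measurable_pi_apply i).comp
      (measurable_past_w (x₀ := x 0) (w := w) (v := v) (s := t + 1) t.lt_succ_self)
    convert! h1.add (h2.add h3) using 1
    ext ω; simp

/-- The control is affine in the observations, so `x (t + 1) - Ā x¹ t - w t` is, too. -/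
lemma plant_mem_obsSpan {K : Matrix (Fin p) (Fin n ⊕ Fin m) ℝ} {u : ℕ → Ω → Fin p → ℝ}
    {xhat : ℕ → Ω → Fin n → ℝ}
    (plant : ∀ t ω, x (t + 1) ω = M.A *ᵥ x t ω + M.B *ᵥ u t ω + w t ω)
    (filter : ∀ t, IsLMMSE P (fun ω => fstPart (x t ω)) (observations y x (t + 1) (t + 1)) (xhat t))
    (control : ∀ t ω, u t ω = K *ᵥ Sum.elim (xhat t ω) (sndPart (x t ω)))
    (t : ℕ) (i : Fin n ⊕ Fin m) :
    (fun ω => (x (t + 1) ω - (M.Abar *ᵥ fstPart (x t ω) + w t ω)) i) ∈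
      obsSpan y x (t + 1) (t + 1) := by
  obtain ⟨L, b, hL, -⟩ := filter t
  have hhat : ∀ j, (fun ω => xhat t ω j) ∈ obsSpan y x (t + 1) (t + 1) := fun j => by
    simp only [hL]
    exact affine_mem_affineFunctions L b j
  have hx2 : ∀ j, (fun ω => sndPart (x t ω) j) ∈ obsSpan y x (t + 1) (t + 1) := fun j =>
    sndPart_mem_obsSpan t.lt_succ_self j
  have helim : ∀ j, (fun ω => Sum.elim (xhat t ω) (sndPart (x t ω)) j) ∈
      obsSpan y x (t + 1) (t + 1) := by
    rintro (j | j)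
    · exact hhat j
    · exact hx2 j
  have hu : ∀ j, (fun ω => u t ω j) ∈ obsSpan y x (t + 1) (t + 1) := fun j => by
    simpa only [control] using mulVec_mem helim K j
  convert! Submodule.add_mem _
    (mulVec_mem hx2 (M.A.submatrix id Sum.inr) i) (mulVec_mem hu M.B i) using 1
  ext ω
  have hA : M.A *ᵥ x t ω
      = M.Abar *ᵥ fstPart (x t ω) + (M.A.submatrix id Sum.inr) *ᵥ sndPart (x t ω) := by
    ext k
    simp [mulVec, dotProduct, Plant.Abar, fstPart, sndPart]
  simp only [plant, hA, Pi.sub_apply, Pi.add_apply]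
  ring

end Adapted

/-! ### Moments of the Gaussian noise -/

section GaussianMoments

variable {ι : Type*} [Fintype ι] [DecidableEq ι] {V : Matrix ι ι ℝ}

instance isProbabilityMeasure_gaussianLaw : IsProbabilityMeasure (gaussianLaw V) :=
  Measure.isProbabilityMeasure_map (by fun_prop)

variable {Ω : Type*} [MeasurableSpace Ω] {P : Measure Ω}

lemma memLp_eval_multivariateGaussian (i : ι) :
    MemLp (fun z : EuclideanSpace ℝ ι => z i) 2 (multivariateGaussian 0 V) :=
  (EuclideanSpace.proj (𝕜 := ℝ) i).comp_memLp' (IsGaussian.memLp_two_id)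

lemma gaussianLaw_moments {q : Ω → ι → ℝ} (hq : Measurable q) (hlaw : P.map q = gaussianLaw V)
    (hV : V.PosSemidef) :
    IsL2 P q ∧ (∀ i, ∫ ω, q ω i ∂P = 0) ∧ secondMoment P q q = V := by
  have hmeas : Measurable (fun (z : EuclideanSpace ℝ ι) (i : ι) => z i) := by fun_prop
  have htrans : ∀ f : (ι → ℝ) → ℝ, Measurable f →
      ∫ ω, f (q ω) ∂P = ∫ z, f (fun i => z i) ∂(multivariateGaussian 0 V) := by
    intro f hf
    rw [← integral_map hq.aemeasurable hf.aestronglyMeasurable, hlaw, gaussianLaw,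
      integral_map hmeas.aemeasurable hf.aestronglyMeasurable]
  have hmean : ∀ i, ∫ z : EuclideanSpace ℝ ι, z i ∂(multivariateGaussian 0 V) = 0 := fun i => by
    have := (EuclideanSpace.proj (𝕜 := ℝ) i).integral_comp_comm
      (IsGaussian.integrable_id (μ := multivariateGaussian 0 V))
    simpa using this
  refine ⟨fun i => ?_, fun i => ?_, ?_⟩
  · have h1 : MemLp (fun z : ι → ℝ => z i) 2 (P.map q) := by
      rw [hlaw, gaussianLaw, memLp_map_measure_iff (measurable_pi_apply i).aestronglyMeasurable
        hmeas.aemeasurable]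
      exact memLp_eval_multivariateGaussian i
    exact (memLp_map_measure_iff (measurable_pi_apply i).aestronglyMeasurable
      hq.aemeasurable).1 h1
  · rw [htrans (fun z => z i) (by fun_prop)]
    exact hmean i
  · ext i j
    rw [secondMoment_apply, htrans (fun z => z i * z j) (by fun_prop)]
    have h1 := covariance_eval_multivariateGaussian (μ := (0 : EuclideanSpace ℝ ι)) hV i j
    rw [covariance_eq_sub (memLp_eval_multivariateGaussian i)
      (memLp_eval_multivariateGaussian j), hmean i, zero_mul, sub_zero] at h1
    exact h1

end GaussianMoments

/-! ### Subtractive dither -/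

section Dither

/-- The error `q_Δ(s + δ) - δ - s` of the scalar quantizer with subtractive dither `δ`. -/
noncomputable def ditherError (Δ s δ : ℝ) : ℝ := ⌊(s + δ) / Δ + 1 / 2⌋ * Δ - δ - s

variable {Δ : ℝ}

lemma ditherError_eq_zero_sub {u : ℝ} (hΔ : 0 < Δ) (hu : u ∈ Set.Ico (-(Δ / 2)) (Δ / 2)) :
    ditherError Δ 0 u = -u := by
  have h : ⌊(0 + u) / Δ + 1 / 2⌋ = 0 := by
    rw [Int.floor_eq_zero_iff, Set.mem_Ico]
    constructor
    · have : -(1 / 2) ≤ (0 + u) / Δ := by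
        rw [le_div_iff₀ hΔ]; linarith [hu.1]
      linarith
    · have : (0 + u) / Δ < 1 / 2 := by
        rw [div_lt_iff₀ hΔ]; linarith [hu.2]
      linarith
  rw [ditherError, h]
  simp

lemma abs_ditherError_le (hΔ : 0 < Δ) (s δ : ℝ) : |ditherError Δ s δ| ≤ Δ / 2 := by
  have h1 := Int.floor_le ((s + δ) / Δ + 1 / 2)
  have h2 := Int.lt_floor_add_one ((s + δ) / Δ + 1 / 2)
  have h3 : (s + δ) / Δ * Δ = s + δ := by field_simp
  have h4 := mul_le_mul_of_nonneg_right h1 hΔ.le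
  have h5 := mul_le_mul_of_nonneg_right h2.le hΔ.le
  rw [abs_le, ditherError]
  constructor <;> nlinarith

lemma measurable_ditherError_right (s : ℝ) : Measurable (ditherError Δ s) := by
  unfold ditherError
  fun_prop

/-- The uniform distribution on `[-Δ/2, Δ/2)`. -/
noncomputable def uniformLaw (Δ : ℝ) : Measure ℝ :=
  ProbabilityTheory.cond volume (Set.Ico (-(Δ / 2)) (Δ / 2))

lemma volume_Ico_half (Δ : ℝ) : volume (Set.Ico (-(Δ / 2)) (Δ / 2)) = ENNReal.ofReal Δ := by
  rw [Real.volume_Ico]; congr 1; ring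

lemma isProbabilityMeasure_uniformLaw (hΔ : 0 < Δ) : IsProbabilityMeasure (uniformLaw Δ) :=
  cond_isProbabilityMeasure_of_finite (by rw [volume_Ico_half]; simpa using hΔ)
    (by rw [volume_Ico_half]; simp)

/-- Whatever the signal `s`, the quantization error is distributed like the dither. -/
lemma integral_comp_ditherError (hΔ : 0 < Δ) (h : ℝ → ℝ) (s : ℝ) :
    ∫ δ, h (ditherError Δ s δ) ∂uniformLaw Δ
      = Δ⁻¹ * ∫ u in (-(Δ / 2))..(Δ / 2), h (-u) := by
  have hle : -(Δ / 2) ≤ Δ / 2 := by linarith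
  have hper : Function.Periodic (fun u => h (ditherError Δ 0 u)) Δ := fun u => by
    have : (0 + (u + Δ)) / Δ + 1 / 2 = (0 + u) / Δ + 1 / 2 + 1 := by field_simp; ring
    simp only [ditherError, this, Int.floor_add_one]
    congr 1
    push_cast
    ring
  have h1 : ∫ δ in (-(Δ / 2))..(Δ / 2), h (ditherError Δ s δ)
      = ∫ u in (-(Δ / 2))..(Δ / 2), h (-u) := by
    have e1 : (fun δ => h (ditherError Δ s δ)) = fun δ => h (ditherError Δ 0 (s + δ)) := by
      ext δ
      simp only [ditherError, zero_add]
      congr 1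
      ring
    rw [e1, intervalIntegral.integral_comp_add_left (fun u => h (ditherError Δ 0 u)) s]
    have e2 := hper.intervalIntegral_add_eq (s + -(Δ / 2)) (-(Δ / 2))
    rw [show s + -(Δ / 2) + Δ = s + Δ / 2 by ring, show -(Δ / 2) + Δ = Δ / 2 by ring] at e2
    rw [e2, intervalIntegral.integral_of_le hle, intervalIntegral.integral_of_le hle,
      ← integral_Ico_eq_integral_Ioc, ← integral_Ico_eq_integral_Ioc]
    exact setIntegral_congr_fun measurableSet_Ico fun u hu => by
      simp only [ditherError_eq_zero_sub hΔ hu]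
  rw [uniformLaw, ProbabilityTheory.cond, integral_smul_measure, volume_Ico_half,
    integral_Ico_eq_integral_Ioc, ← intervalIntegral.integral_of_le hle, h1]
  simp [hΔ.le]

lemma integral_ditherError (hΔ : 0 < Δ) (s : ℝ) : ∫ δ, ditherError Δ s δ ∂uniformLaw Δ = 0 := by
  rw [integral_comp_ditherError hΔ (fun u => u) s, intervalIntegral.integral_neg, integral_id]
  ring

lemma integral_ditherError_sq (hΔ : 0 < Δ) (s : ℝ) :
    ∫ δ, ditherError Δ s δ ^ 2 ∂uniformLaw Δ = Δ ^ 2 / 12 := by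
  rw [integral_comp_ditherError hΔ (fun u => u ^ 2) s]
  simp only [neg_sq]
  rw [integral_pow]
  field_simp
  ring

variable {n : ℕ}

lemma ditherLaw_eq_pi (hΔ : 0 < Δ) : ditherLaw n Δ = Measure.pi fun _ => uniformLaw Δ := by
  have := isProbabilityMeasure_uniformLaw hΔ
  refine (Measure.pi_eq fun s hs => ?_).symm
  rw [ditherLaw, cond_apply (MeasurableSet.univ_pi fun _ => measurableSet_Ico),
    ← Set.pi_inter_distrib, volume_pi_pi, volume_pi_pi]
  simp only [uniformLaw, cond_apply measurableSet_Ico, volume_Ico_half]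
  rw [Finset.prod_mul_distrib]
  congr 1
  simp [ENNReal.inv_pow]

lemma isProbabilityMeasure_ditherLaw (hΔ : 0 < Δ) : IsProbabilityMeasure (ditherLaw n Δ) := by
  have := isProbabilityMeasure_uniformLaw hΔ
  rw [ditherLaw_eq_pi hΔ]
  infer_instance

lemma integral_pi_eval (μ : Measure ℝ) [IsProbabilityMeasure μ] {g : ℝ → ℝ} (hg : Measurable g)
    (i : Fin n) : ∫ δ, g (δ i) ∂Measure.pi (fun _ : Fin n => μ) = ∫ a, g a ∂μ := by
  have h := measurePreserving_eval (fun _ : Fin n => μ) i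
  nth_rw 2 [← h.map_eq]
  rw [integral_map h.measurable.aemeasurable hg.aestronglyMeasurable]

lemma integral_ditherLaw_ditherError (hΔ : 0 < Δ) (s : Fin n → ℝ) (i : Fin n) :
    ∫ δ, ditherError Δ (s i) (δ i) ∂ditherLaw n Δ = 0 := by
  have := isProbabilityMeasure_uniformLaw hΔ
  rw [ditherLaw_eq_pi hΔ, integral_pi_eval _ (g := ditherError Δ (s i))
    (measurable_ditherError_right _), integral_ditherError hΔ]

lemma integral_ditherLaw_ditherError_mul (hΔ : 0 < Δ) (s : Fin n → ℝ) (i j : Fin n) :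
    ∫ δ, ditherError Δ (s i) (δ i) * ditherError Δ (s j) (δ j) ∂ditherLaw n Δ
      = (Δ ^ 2 / 12) * (1 : Matrix (Fin n) (Fin n) ℝ) i j := by
  have := isProbabilityMeasure_uniformLaw hΔ
  have hm : ∀ a, Measurable (ditherError Δ a) := measurable_ditherError_right
  rw [ditherLaw_eq_pi hΔ]
  by_cases hij : i = j
  · subst hij
    rw [integral_pi_eval _ (g := fun δ => ditherError Δ (s i) δ * ditherError Δ (s i) δ)
      ((hm _).mul (hm _))]
    simp only [← sq, integral_ditherError_sq hΔ]
    simp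
  · have hind : iIndepFun (fun (k : Fin n) (δ : Fin n → ℝ) => ditherError Δ (s k) (δ k))
        (Measure.pi fun _ => uniformLaw Δ) :=
      iIndepFun_pi (X := fun k => ditherError Δ (s k)) fun k => (hm _).aemeasurable
    rw [(hind.indepFun hij).integral_fun_mul_eq_mul_integral
      ((hm _).comp (measurable_pi_apply i)).aestronglyMeasurable
      ((hm _).comp (measurable_pi_apply j)).aestronglyMeasurable,
      integral_pi_eval _ (g := ditherError Δ (s i)) (hm _),
      integral_ditherError hΔ]
    simp [hij]

end Dither

/-- Averaging over an independent variable `D` whose conditional contribution is the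
constant `c`. -/
lemma integral_mul_of_indepFun {Ω α β : Type*} [MeasurableSpace Ω] [MeasurableSpace α]
    [MeasurableSpace β] {P : Measure Ω} [IsProbabilityMeasure P] {s : Ω → α} {f : Ω → ℝ}
    {d : Ω → β} {law : Measure β} [IsProbabilityMeasure law] (hs : Measurable s)
    (hf : Measurable f) (hd : Measurable d) (hlaw : P.map d = law)
    (hind : IndepFun (fun ω => (s ω, f ω)) d P) (hfi : Integrable f P) {H : α → β → ℝ}
    (hH : Measurable fun z : α × β => H z.1 z.2) {B c : ℝ} (hB : ∀ a b, |H a b| ≤ B)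
    (hc : ∀ a, ∫ b, H a b ∂law = c) :
    ∫ ω, H (s ω) (d ω) * f ω ∂P = c * ∫ ω, f ω ∂P := by
  have hsf : Measurable fun ω => (s ω, f ω) := hs.prodMk hf
  have := Measure.isProbabilityMeasure_map (μ := P) hsf.aemeasurable
  rw [indepFun_iff_map_prod_eq_prod_map_map hsf.aemeasurable hd.aemeasurable, hlaw] at hind
  have hG : Measurable fun z : (α × ℝ) × β => H z.1.1 z.2 * z.1.2 :=
    (hH.comp ((measurable_fst.comp measurable_fst).prodMk measurable_snd)).mul
      (measurable_snd.comp measurable_fst)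
  have hint : Integrable (fun ω => H (s ω) (d ω) * f ω) P :=
    hfi.bdd_mul (hH.comp (hs.prodMk hd)).aestronglyMeasurable (.of_forall fun ω => hB _ _)
  have h1 : ∫ ω, H (s ω) (d ω) * f ω ∂P
      = ∫ z, H z.1.1 z.2 * z.1.2 ∂((P.map fun ω => (s ω, f ω)).prod law) := by
    rw [← hind, integral_map (hsf.prodMk hd).aemeasurable hG.aestronglyMeasurable]
  have h2 : Integrable (fun z : (α × ℝ) × β => H z.1.1 z.2 * z.1.2)
      ((P.map fun ω => (s ω, f ω)).prod law) := by
    rw [← hind, integrable_map_measure hG.aestronglyMeasurable (hsf.prodMk hd).aemeasurable]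
    exact hint
  rw [h1, integral_prod _ h2]
  simp only [integral_mul_const, hc]
  rw [integral_map hsf.aemeasurable (by fun_prop), integral_const_mul]

/-! ### The closed loops as second-order loops -/

/-- The quantization noise `y t - C (x¹ t - x̃¹ t)`. -/
noncomputable def quantizationNoise {Ω : Type*} {n m : ℕ} (Δ : ℝ) (C : Matrix (Fin n) (Fin n) ℝ)
    (x : ℕ → Ω → Fin n ⊕ Fin m → ℝ) (xtil d : ℕ → Ω → Fin n → ℝ) (t : ℕ) (ω : Ω) : Fin n → ℝ :=
  fun i => ditherError Δ ((C *ᵥ (fstPart (x t ω) - xtil t ω)) i) (d t ω i)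

lemma measurable_signal {Ω : Type*} {m₀ : MeasurableSpace Ω} {n m : ℕ}
    {x : Ω → Fin n ⊕ Fin m → ℝ} {xtil : Ω → Fin n → ℝ} (C : Matrix (Fin n) (Fin n) ℝ)
    (hx : Measurable x) (hxtil : Measurable xtil) :
    Measurable fun ω => C *ᵥ (fstPart (x ω) - xtil ω) :=
  (measurable_mulVec C).comp ((measurable_fstPart.comp hx).sub hxtil)

lemma measurable_ditherError_apply {Ω : Type*} {m₀ : MeasurableSpace Ω} {n : ℕ} (Δ : ℝ)
    {s δ : Ω → Fin n → ℝ} (hs : Measurable s) (hδ : Measurable δ) (i : Fin n) :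
    Measurable fun ω => ditherError Δ (s ω i) (δ ω i) := by
  have h1 : Measurable fun ω => (s ω i + δ ω i) / Δ + 1 / 2 :=
    ((((measurable_pi_apply i).comp hs).add ((measurable_pi_apply i).comp hδ)).div_const
      Δ).add_const _
  have h2 : Measurable fun ω => (⌊(s ω i + δ ω i) / Δ + 1 / 2⌋ : ℝ) :=
    measurable_from_top.comp (Int.measurable_floor.comp h1)
  exact ((h2.mul_const Δ).sub ((measurable_pi_apply i).comp hδ)).sub
    ((measurable_pi_apply i).comp hs)

/-- `Measurable.prodMk` for a σ-algebra `m₀` that is not the ambient one. -/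
lemma measurable_pair {Ω β γ : Type*} {m₀ : MeasurableSpace Ω} [MeasurableSpace β]
    [MeasurableSpace γ] {f : Ω → β} {g : Ω → γ} (hf : Measurable f) (hg : Measurable g) :
    Measurable fun ω => (f ω, g ω) :=
  hf.prodMk hg

section Loops

variable {Ω : Type*} [MeasurableSpace Ω] {n m p : ℕ} {P : Measure Ω} [IsProbabilityMeasure P]
  {M : Plant n m p} {C : Matrix (Fin n) (Fin n) ℝ} {K : Matrix (Fin p) (Fin n ⊕ Fin m) ℝ}
  {x w : ℕ → Ω → Fin n ⊕ Fin m → ℝ} {v y xhat : ℕ → Ω → Fin n → ℝ} {u : ℕ → Ω → Fin p → ℝ}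

lemma Plant.posSemidef_W (M : Plant n m p) : M.W.PosSemidef := by
  have hu : IsUnit M.W₁₁.det := M.posDef_W₁₁.det_pos.ne'.isUnit
  let _ : Invertible M.W₁₁ := M.W₁₁.invertibleOfIsUnitDet hu
  have h := (Matrix.PosDef.fromBlocks₁₁ (A := M.W₁₁) 0 M.W₂₂ M.posDef_W₁₁).2
    (by simpa using M.posDef_W₂₂.posSemidef)
  simpa [Plant.W] using h

lemma integral_mul_eq_zero_of_indepFun {f g : Ω → ℝ} (hf : Measurable f) (hg : Measurable g)
    (h : IndepFun f g P) (h0 : ∫ ω, g ω ∂P = 0) : ∫ ω, g ω * f ω ∂P = 0 := by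
  rw [h.symm.integral_fun_mul_eq_mul_integral hg.aestronglyMeasurable hf.aestronglyMeasurable, h0,
    zero_mul]

section Common

variable {ν : ℕ → Ω → Fin n → ℝ} {lv : Measure (Fin n → ℝ)}

/-- Criterion for `IsSecondOrderLoop`; the process noise is handled here because it is the same in
both loops. -/
lemma isSecondOrderLoop_of_isPrimitive
    (hprim : IsPrimitive P (x 0) w v (gaussianLaw M.W) lv) (hx0 : IsL2 P (x 0))
    (hν2 : ∀ t, IsL2 P (ν t))
    (hadapt : ∀ t, Measurable[past (x 0) w v t t] (x t) ∧
      Measurable[past (x 0) w v t (t + 1)] (y t))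
    (sensor : ∀ t i,
      (fun ω => (y t ω - (C *ᵥ fstPart (x t ω) + ν t ω)) i) ∈ obsSpan y x t (t + 1))
    (plant : ∀ t i, (fun ω => (x (t + 1) ω - (M.Abar *ᵥ fstPart (x t ω) + w t ω)) i) ∈
      obsSpan y x (t + 1) (t + 1))
    (hν : ∀ t (f : Ω → ℝ), Measurable[past (x 0) w v t t] f → MemLp f 2 P →
      ∀ i, ∫ ω, ν t ω i * f ω ∂P = 0)
    (hcov : ∀ t, secondMoment P (ν t) (ν t) = 1) : IsSecondOrderLoop M C P x w ν y := by
  have hwm := fun t => gaussianLaw_moments (hprim.measurable_w t) (hprim.law_w t) M.posSemidef_W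
  have hl2 := l2_of_sensor_plant hx0 (fun t => (hwm t).1) hν2 sensor plant
  have hw : ∀ t (f : Ω → ℝ), Measurable[past (x 0) w v t (t + 1)] f →
      ∀ i, ∫ ω, w t ω i * f ω ∂P = 0 := fun t f hf i => by
    refine integral_mul_eq_zero_of_indepFun (hf.mono (hprim.past_le _ _) le_rfl)
      ((measurable_pi_apply i).comp (hprim.measurable_w t)) ?_ ((hwm t).2.1 i)
    exact (hprim.indepFun_w hf).comp measurable_id (measurable_pi_apply i)
  refine ⟨fun t => (hl2 t).1, fun t => (hl2 t).2, fun t => (hwm t).1, hν2, sensor, plant,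
    fun t f hf i => ?_, fun t f hf i => ?_, fun t => ?_, fun t => ?_, hcov, fun t => (hwm t).2.2⟩
  · refine hν t f (measurable_of_mem_affineFunctions (measurable_observations (fun s hs => ?_)
      fun s hs => ?_) hf) (memLp_of_mem_affineFunctions (isL2_observations
        (fun s _ => (hl2 s).2) fun s _ => (hl2 s).1) hf) i
    · exact (hadapt s).2.mono (past_mono hs.le hs) le_rfl
    · exact (hadapt s).1.mono (past_mono (Nat.lt_succ_iff.1 hs) (Nat.lt_succ_iff.1 hs)) le_rfl
  · refine hw t f (measurable_of_mem_affineFunctions (measurable_observations (fun s hs => ?_)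
      fun s hs => ?_) hf) i
    · exact (hadapt s).2.mono (past_mono (Nat.lt_succ_iff.1 hs) hs) le_rfl
    · exact (hadapt s).1.mono (past_mono (Nat.lt_succ_iff.1 hs) hs.le) le_rfl
  · ext i j
    exact hν t _ ((measurable_pi_apply j).comp (hadapt t).1) ((hl2 t).1 j) i
  · ext i j
    exact hw t _ ((measurable_pi_apply j).comp
      ((hadapt t).1.mono (past_mono le_rfl t.le_succ) le_rfl)) i

end Common

/-! ### The Gaussian loop -/

namespace IsGaussianLoop

lemma sensor_mem (h : IsGaussianLoop M K C P x w v y xhat u) (t : ℕ) (i : Fin n) :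
    (fun ω => (y t ω - (C *ᵥ fstPart (x t ω) + v t ω)) i) ∈ obsSpan y x t (t + 1) := by
  simp only [h.sensor, sub_self]
  exact (obsSpan y x t (t + 1)).zero_mem

lemma adapted (h : IsGaussianLoop M K C P x w v y xhat u) (t : ℕ) :
    Measurable[past (x 0) w v t t] (x t) ∧ Measurable[past (x 0) w v t (t + 1)] (y t) :=
  measurable_past_of_sensor_plant (fun t _ _ => measurable_past_v t.lt_succ_self) h.sensor_mem
    (plant_mem_obsSpan h.plant h.filter h.control) t

lemma isSecondOrderLoop (h : IsGaussianLoop M K C P x w v y xhat u) :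
    IsSecondOrderLoop M C P x w v y := by
  have hv := fun t => gaussianLaw_moments (h.primitive.measurable_v t) (h.primitive.law_v t) .one
  refine isSecondOrderLoop_of_isPrimitive h.primitive (fun i => (h.init.eval i).memLp_two)
    (fun t => (hv t).1) h.adapted h.sensor_mem (plant_mem_obsSpan h.plant h.filter h.control)
    (fun t f hf _ i => ?_) fun t => (hv t).2.2
  refine integral_mul_eq_zero_of_indepFun (hf.mono (h.primitive.past_le _ _) le_rfl)
    ((measurable_pi_apply i).comp (h.primitive.measurable_v t)) ?_ ((hv t).2.1 i)
  exact (h.primitive.indepFun_v hf).comp measurable_id (measurable_pi_apply i)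

end IsGaussianLoop

/-! ### The quantized loop -/

namespace IsQuantizedLoop

variable {d xtil : ℕ → Ω → Fin n → ℝ} {zidx : ℕ → Ω → Fin n → ℤ} {Δ : ℝ}

lemma reconstruct_eq (h : IsQuantizedLoop M K C Δ P x w d xtil zidx y xhat u) (t : ℕ) (ω : Ω) :
    y t ω = C *ᵥ (fstPart (x t ω) - xtil t ω) + quantizationNoise Δ C x xtil d t ω := by
  ext i
  simp only [h.reconstruct, Pi.sub_apply, Pi.add_apply, quantize, quantIndex,
    quantizationNoise, ditherError]
  ring

lemma reconstruct_eq_index (h : IsQuantizedLoop M K C Δ P x w d xtil zidx y xhat u) (t : ℕ)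
    (ω : Ω) (i : Fin n) : y t ω i = zidx t ω i * Δ - d t ω i := by
  simp only [h.reconstruct, h.quant, Pi.sub_apply, quantize]

lemma xtil_mem (h : IsQuantizedLoop M K C Δ P x w d xtil zidx y xhat u) (t : ℕ) (i : Fin n) :
    (fun ω => xtil t ω i) ∈ obsSpan y x t (t + 1) := by
  obtain ⟨L, b, hL, -⟩ := h.predict t
  simp only [hL]
  exact affine_mem_affineFunctions L b i

lemma sensor_mem (h : IsQuantizedLoop M K C Δ P x w d xtil zidx y xhat u) (t : ℕ) (i : Fin n) :
    (fun ω => (y t ω - (C *ᵥ fstPart (x t ω) + quantizationNoise Δ C x xtil d t ω)) i) ∈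
      obsSpan y x t (t + 1) := by
  convert! Submodule.neg_mem _ (mulVec_mem (h.xtil_mem t) C i) using 1
  ext ω
  simp [h.reconstruct_eq, mulVec_sub]

lemma adapted (h : IsQuantizedLoop M K C Δ P x w d xtil zidx y xhat u) (t : ℕ) :
    Measurable[past (x 0) w d t t] (x t) ∧ Measurable[past (x 0) w d t (t + 1)] (y t) := by
  refine measurable_past_of_sensor_plant (fun t hx hy => ?_) h.sensor_mem
    (plant_mem_obsSpan h.plant h.filter h.control) t
  have hxtil : Measurable[past (x 0) w d t t] (xtil t) :=
    @measurable_pi_lambda _ _ _ (past (x 0) w d t t) _ _ fun i => measurable_of_mem_affineFunctions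
      (measurable_observations hy fun s hs => hx s (Nat.lt_succ_iff.1 hs)) (h.xtil_mem t i)
  refine @measurable_pi_lambda _ _ _ (past (x 0) w d t (t + 1)) _ _ fun i => ?_
  exact measurable_ditherError_apply Δ
    ((measurable_signal C (hx t le_rfl) hxtil).mono (past_mono le_rfl t.le_succ) le_rfl)
    (measurable_past_v t.lt_succ_self) i

lemma measurable_signal_past (h : IsQuantizedLoop M K C Δ P x w d xtil zidx y xhat u) (t : ℕ) :
    Measurable[past (x 0) w d t t] (fun ω => C *ᵥ (fstPart (x t ω) - xtil t ω)) := by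
  have hx : ∀ s ≤ t, Measurable[past (x 0) w d t t] (x s) := fun s hs =>
    (h.adapted s).1.mono (past_mono hs hs) le_rfl
  have hxtil : Measurable[past (x 0) w d t t] (xtil t) :=
    @measurable_pi_lambda _ _ _ (past (x 0) w d t t) _ _ fun i => measurable_of_mem_affineFunctions
      (measurable_observations (fun s hs => (h.adapted s).2.mono (past_mono hs.le hs) le_rfl)
        fun s hs => hx s (Nat.lt_succ_iff.1 hs)) (h.xtil_mem t i)
  exact measurable_signal C (hx t le_rfl) hxtil

lemma isSecondOrderLoop (h : IsQuantizedLoop M K C Δ P x w d xtil zidx y xhat u) (hΔ : 0 < Δ)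
    (hΔ2 : Δ ^ 2 / 12 = 1) : IsSecondOrderLoop M C P x w (quantizationNoise Δ C x xtil d) y := by
  have hprob := isProbabilityMeasure_ditherLaw (n := n) hΔ
  have hsig := fun t => (h.measurable_signal_past t).mono (h.primitive.past_le _ _) le_rfl
  have hd := h.primitive.measurable_v
  have hmeas : ∀ t i, Measurable fun ω => quantizationNoise Δ C x xtil d t ω i := fun t i =>
    measurable_ditherError_apply Δ (hsig t) (hd t) i
  refine isSecondOrderLoop_of_isPrimitive h.primitive
    (fun i => (memLp_pi_iff.1 h.init) i) (fun t i => ?_) h.adapted h.sensor_mem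
    (plant_mem_obsSpan h.plant h.filter h.control) (fun t f hf hf2 i => ?_) fun t => ?_
  · exact MemLp.of_bound (hmeas t i).aestronglyMeasurable (Δ / 2)
      (.of_forall fun ω => abs_ditherError_le hΔ _ _)
  · have key := integral_mul_of_indepFun (hsig t) (hf.mono (h.primitive.past_le _ _) le_rfl)
      (hd t) (h.primitive.law_v t)
      (h.primitive.indepFun_v (measurable_pair (h.measurable_signal_past t) hf))
        (hf2.integrable one_le_two)
      (H := fun s δ => ditherError Δ (s i) (δ i)) (B := Δ / 2) (c := 0)
      (measurable_ditherError_apply Δ measurable_fst measurable_snd i)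
        (fun _ _ => abs_ditherError_le hΔ _ _)
      (fun s => integral_ditherLaw_ditherError hΔ s i)
    rw [zero_mul] at key
    exact key
  · ext i j
    have key := integral_mul_of_indepFun (f := fun _ => (1 : ℝ)) (hsig t) measurable_const
      (hd t) (h.primitive.law_v t)
      (h.primitive.indepFun_v (measurable_pair (h.measurable_signal_past t)
        measurable_const)) (integrable_const 1)
      (H := fun s δ => ditherError Δ (s i) (δ i) * ditherError Δ (s j) (δ j))
      (B := Δ / 2 * (Δ / 2))
      ((measurable_ditherError_apply Δ measurable_fst measurable_snd i).mul
        (measurable_ditherError_apply Δ measurable_fst measurable_snd j))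
      (fun _ _ => by
        rw [abs_mul]
        exact mul_le_mul (abs_ditherError_le hΔ _ _) (abs_ditherError_le hΔ _ _) (abs_nonneg _)
          (by positivity))
      (fun s => integral_ditherLaw_ditherError_mul hΔ s i j)
    simp only [mul_one, integral_const, probReal_univ, smul_eq_mul, hΔ2, one_mul] at key
    exact key

lemma hasErrorCov (h : IsQuantizedLoop M K C Δ P x w d xtil zidx y xhat u) (hΔ : 0 < Δ)
    (hΔ2 : Δ ^ 2 / 12 = 1) (t : ℕ) :
    HasErrorCov P (fun ω => fstPart (x t ω)) (obsSpan y x t (t + 1))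
      (secondMoment P (fun ω => fstPart (x t ω) - xtil t ω)
        (fun ω => fstPart (x t ω) - xtil t ω)) := by
  have h2 := h.isSecondOrderLoop hΔ hΔ2
  exact (h.predict t).hasErrorCov (h2.l2_x t).fstPart
    (isL2_observations (fun s _ => h2.l2_y s) fun s _ => h2.l2_x s)

/-- The second moment of the reconstructed measurement is governed by the Riccati recursion. -/
lemma secondMoment_reconstruct (h : IsQuantizedLoop M K C Δ P x w d xtil zidx y xhat u)
    (hΔ : 0 < Δ) (hΔ2 : Δ ^ 2 / 12 = 1) {S : Matrix (Fin n) (Fin n) ℝ}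
    (hS : HasErrorCov P (fun ω => fstPart (x 0 ω)) (obsSpan y x 0 1) S) (t : ℕ) :
    secondMoment P (y t) (y t) = C * (M.riccati C)^[t] S * Cᵀ + 1 := by
  have h2 := h.isSecondOrderLoop hΔ hΔ2
  have hobs : IsL2 P (observations y x t (t + 1)) :=
    isL2_observations (fun s _ => h2.l2_y s) fun s _ => h2.l2_x s
  have he2 : IsL2 P fun ω => fstPart (x t ω) - xtil t ω :=
    (h2.l2_x t).fstPart.sub fun i => h2.memLp_of_mem _ (h.xtil_mem t i)
  have hinn := h2.measurement_innovation he2 (fun i => by simpa using h.xtil_mem t i)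
    ((h.predict t).isOrtho (h2.l2_x t).fstPart hobs)
  have hy : y t = fun ω => C *ᵥ (fstPart (x t ω) - xtil t ω) + quantizationNoise Δ C x xtil d t ω :=
    funext (h.reconstruct_eq t)
  rw [hy, hinn.2.2.2, (h.hasErrorCov hΔ hΔ2 t).unique (h2.hasErrorCov_iterate hS t)]

end IsQuantizedLoop

end Loops

lemma dotProduct_observations_zero_one {Ω : Type*} {n m : ℕ} (y : ℕ → Ω → Fin n → ℝ)
    (x : ℕ → Ω → Fin n ⊕ Fin m → ℝ) (l : (Fin 0 × Fin n) ⊕ (Fin 1 × Fin m) → ℝ) (ω : Ω) :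
    l ⬝ᵥ observations y x 0 1 ω = ∑ j, l (Sum.inr (0, j)) * sndPart (x 0 ω) j := by
  simp [dotProduct, observations, Fintype.sum_prod_type]

/-- The initial error covariance depends only on the first and second moments of the initial
state. -/
lemma hasErrorCov_init {Ω Ω' : Type*} [MeasurableSpace Ω] [MeasurableSpace Ω'] {n m : ℕ}
    {P : Measure Ω} [IsProbabilityMeasure P] {P' : Measure Ω'} [IsProbabilityMeasure P']
    {x : ℕ → Ω → Fin n ⊕ Fin m → ℝ} {x' : ℕ → Ω' → Fin n ⊕ Fin m → ℝ}
    {y : ℕ → Ω → Fin n → ℝ} {y' : ℕ → Ω' → Fin n → ℝ} (hx : IsL2 P (x 0)) (hx' : IsL2 P' (x' 0))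
    (hmean : ∀ i, ∫ ω, x' 0 ω i ∂P' = ∫ ω, x 0 ω i ∂P)
    (hsecond : ∀ i j, ∫ ω, x' 0 ω i * x' 0 ω j ∂P' = ∫ ω, x 0 ω i * x 0 ω j ∂P)
    {S : Matrix (Fin n) (Fin n) ℝ}
    (hS : HasErrorCov P' (fun ω => fstPart (x' 0 ω)) (obsSpan y' x' 0 1) S) :
    HasErrorCov P (fun ω => fstPart (x 0 ω)) (obsSpan y x 0 1) S := by
  obtain ⟨e', he2', hem', heo', rfl⟩ := hS
  choose l b hlb using fun i => exists_affine_of_mem_affineFunctions (hem' i)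
  set X : Ω → (Fin n ⊕ Fin m) ⊕ Unit → ℝ := fun ω => Sum.elim (x 0 ω) fun _ => 1 with hX
  set X' : Ω' → (Fin n ⊕ Fin m) ⊕ Unit → ℝ := fun ω => Sum.elim (x' 0 ω) fun _ => 1 with hX'
  have hX2 : IsL2 P X := by
    rintro (i | i)
    · exact hx i
    · exact memLp_const 1
  have hX2' : IsL2 P' X' := by
    rintro (i | i)
    · exact hx' i
    · exact memLp_const 1
  have hmom : secondMoment P' X' X' = secondMoment P X X := by
    ext (i | i) (j | j)
    · exact hsecond i j
    · simpa [secondMoment_apply, hX, hX'] using hmean i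
    · simpa [secondMoment_apply, hX, hX'] using hmean j
    · simp [secondMoment_apply, hX, hX']
  -- The error is the same affine function of the initial state on both spaces.
  let F : Matrix (Fin n) ((Fin n ⊕ Fin m) ⊕ Unit) ℝ := of fun i =>
    Sum.elim (Sum.elim (Pi.single i 1) fun j => -l i (Sum.inr (0, j))) fun _ => -b i
  have hF : ∀ (z : Fin n ⊕ Fin m → ℝ) (i : Fin n), (F *ᵥ Sum.elim z fun _ => 1) i
      = fstPart z i - (∑ j, l i (Sum.inr (0, j)) * sndPart z j + b i) := by
    intro z i
    simp [F, mulVec, dotProduct, Pi.single_apply, fstPart, sndPart]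
    ring
  have he' : e' = fun ω => F *ᵥ X' ω := by
    ext ω i
    have h1 := hlb i ω
    rw [dotProduct_observations_zero_one] at h1
    rw [hX', hF]
    linarith
  refine ⟨fun ω => F *ᵥ X ω, hX2.mulVec F, fun i => ?_, ?_, ?_⟩
  · have h1 : (fun ω => fstPart (x 0 ω) i - (F *ᵥ X ω) i)
        = fun ω => ((of fun i => l i) *ᵥ observations y x 0 1 ω + b) i := by
      ext ω
      change fstPart (x 0 ω) i - (F *ᵥ Sum.elim (x 0 ω) fun _ => 1) i
        = l i ⬝ᵥ observations y x 0 1 ω + b i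
      rw [hF, dotProduct_observations_zero_one]
      ring
    rw [h1]
    exact affine_mem_affineFunctions _ b i
  · have h0 : secondMoment P' e' X' = secondMoment P (fun ω => F *ᵥ X ω) X := by
      rw [he', secondMoment_mulVec_left F hX2' hX2', hmom, secondMoment_mulVec_left F hX2 hX2]
    refine isOrtho_span (hX2.mulVec F) (fun f hf => ?_) fun f hf i => ?_
    · obtain rfl | ⟨⟨⟨k, hk⟩, j⟩ | ⟨k, j⟩, rfl⟩ := hf
      · exact memLp_const 1
      · exact absurd hk (Nat.not_lt_zero _)
      · rw [Subsingleton.elim k 0]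
        exact hx (Sum.inr j)
    · obtain rfl | ⟨⟨⟨k, hk⟩, j⟩ | ⟨k, j⟩, rfl⟩ := hf
      · have h1 := congrFun (congrFun h0 i) (Sum.inr ())
        have h2 := heo' _ one_mem_affineFunctions i
        exact h1.symm.trans h2
      · exact absurd hk (Nat.not_lt_zero _)
      · rw [Subsingleton.elim k 0]
        have h1 := congrFun (congrFun h0 i) (Sum.inl (Sum.inr j))
        have h2 := heo' _ (sndPart_mem_obsSpan (y := y') (x := x') zero_lt_one j) i
        exact h1.symm.trans h2
  · rw [he', secondMoment_mulVec_left F hX2 (hX2.mulVec F),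
      secondMoment_mulVec_left F hX2' (hX2'.mulVec F), secondMoment_mulVec_right F hX2 hX2,
      secondMoment_mulVec_right F hX2' hX2', hmom]

/-! ### The Gaussian density -/

section GaussianDensity

variable {ι : Type*} [Fintype ι] [DecidableEq ι] {V : Matrix ι ι ℝ}

/-- The density of the centered Gaussian law with invertible covariance matrix `V`. -/
noncomputable def gaussianDensity (V : Matrix ι ι ℝ) (x : ι → ℝ) : ℝ :=
  (√(2 * Real.pi))⁻¹ ^ Fintype.card ι * (√V.det)⁻¹ * Real.exp (-(x ⬝ᵥ V⁻¹ *ᵥ x) / 2)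

lemma gaussianDensity_pos (hV : V.PosDef) (x : ι → ℝ) : 0 < gaussianDensity V x := by
  have := hV.det_pos
  have := Real.pi_pos
  unfold gaussianDensity
  positivity

lemma continuous_gaussianDensity : Continuous (gaussianDensity V) := by
  unfold gaussianDensity dotProduct mulVec dotProduct
  fun_prop

lemma measurable_gaussianDensity : Measurable (gaussianDensity V) :=
  continuous_gaussianDensity.measurable

lemma log_gaussianDensity (hV : V.PosDef) (x : ι → ℝ) :
    Real.log (gaussianDensity V x)
      = -(Fintype.card ι * Real.log (2 * Real.pi) + Real.log V.det + x ⬝ᵥ V⁻¹ *ᵥ x) / 2 := by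
  have h1 := hV.det_pos
  have h2 : 0 < 2 * Real.pi := by positivity
  have h3 : 0 < (√(2 * Real.pi))⁻¹ ^ Fintype.card ι := by positivity
  have h4 : 0 < (√V.det)⁻¹ := by positivity
  rw [gaussianDensity, Real.log_mul (by positivity) (Real.exp_pos _).ne',
    Real.log_mul h3.ne' h4.ne', Real.log_pow, Real.log_inv, Real.log_inv, Real.log_sqrt h2.le,
    Real.log_sqrt h1.le, Real.log_exp]
  ring

lemma gaussianDensity_one (x : ι → ℝ) :
    gaussianDensity 1 x = ∏ i, gaussianPDFReal 0 1 (x i) := by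
  simp only [gaussianDensity, gaussianPDFReal, Finset.prod_mul_distrib, Finset.prod_const,
    ← Real.exp_sum, det_one, Real.sqrt_one, inv_one, one_mulVec, mul_one, NNReal.coe_one, sub_zero,
    Finset.card_univ]
  congr 2
  rw [dotProduct, ← Finset.sum_neg_distrib, Finset.sum_div]
  exact Finset.sum_congr rfl fun i _ => by ring

lemma pi_gaussianReal_eq_withDensity :
    Measure.pi (fun _ : ι => gaussianReal 0 1)
      = volume.withDensity fun x : ι → ℝ => ENNReal.ofReal (gaussianDensity 1 x) := by
  refine Measure.pi_eq fun s hs => ?_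
  rw [withDensity_apply _ (MeasurableSet.univ_pi hs), volume_pi, Measure.restrict_pi_pi]
  simp only [gaussianDensity_one]
  rw [← ofReal_integral_eq_lintegral_ofReal
      (Integrable.fintype_prod fun i => (integrable_gaussianPDFReal 0 1).restrict)
      (.of_forall fun x => Finset.prod_nonneg fun i _ => gaussianPDFReal_nonneg 0 1 _),
    integral_fintype_prod_eq_prod fun _ => gaussianPDFReal 0 1,
    ENNReal.ofReal_prod_of_nonneg fun i _ => integral_nonneg fun x => gaussianPDFReal_nonneg 0 1 x]
  exact Finset.prod_congr rfl fun i _ => (gaussianReal_apply_eq_integral 0 one_ne_zero _).symm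

open scoped MatrixOrder in
/-- A centered Gaussian vector is a symmetric square root of its covariance matrix applied to a
standard Gaussian vector. -/
lemma exists_gaussianLaw_eq_map (hV : V.PosSemidef) : ∃ L : Matrix ι ι ℝ, L * L = V ∧ Lᵀ = L ∧
    gaussianLaw V = (Measure.pi fun _ : ι => gaussianReal 0 1).map fun z => L *ᵥ z := by
  have hL : (CFC.sqrt V).PosSemidef := by
    rw [← Matrix.nonneg_iff_posSemidef]; exact CFC.sqrt_nonneg V
  refine ⟨CFC.sqrt V, CFC.sqrt_mul_sqrt_self V hV.nonneg, transpose_eq_of_posSemidef hL, ?_⟩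
  rw [gaussianLaw, multivariateGaussian, ← map_pi_eq_stdGaussian,
    Measure.map_map (by fun_prop) (by fun_prop), Measure.map_map (by fun_prop) (by fun_prop)]
  congr 1
  ext z i
  simp

lemma gaussianLaw_eq_withDensity (hV : V.PosDef) :
    gaussianLaw V = volume.withDensity fun x => ENNReal.ofReal (gaussianDensity V x) := by
  obtain ⟨L, hLL, hLt, hmap⟩ := exists_gaussianLaw_eq_map hV.posSemidef
  have hdet : L.det * L.det = V.det := by rw [← det_mul, hLL]
  have hdet0 : L.det ≠ 0 := fun h => by
    have := hV.det_pos
    rw [← hdet, h] at this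
    simp at this
  have hsqrt : √V.det = |L.det| := by rw [← hdet, Real.sqrt_mul_self_eq_abs]
  have hV' : V⁻¹ = L⁻¹ * L⁻¹ := by rw [← hLL, Matrix.mul_inv_rev]
  have hdens : ∀ y, ENNReal.ofReal |(L.det)⁻¹| * ENNReal.ofReal (gaussianDensity 1 (L⁻¹ *ᵥ y))
      = ENNReal.ofReal (gaussianDensity V y) := by
    intro y
    rw [← ENNReal.ofReal_mul (abs_nonneg _)]
    congr 1
    have hq : (L⁻¹ *ᵥ y) ⬝ᵥ (L⁻¹ *ᵥ y) = y ⬝ᵥ V⁻¹ *ᵥ y := by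
      rw [hV', ← mulVec_mulVec, dotProduct_mulVec y, ← mulVec_transpose, transpose_nonsing_inv, hLt]
    simp only [gaussianDensity, inv_one, one_mulVec, det_one, Real.sqrt_one, hq, hsqrt, abs_inv]
    ring
  have hlin : Measurable fun z : ι → ℝ => L *ᵥ z := by
    unfold mulVec dotProduct; fun_prop
  have hlin' : Measurable fun z : ι → ℝ => L⁻¹ *ᵥ z := by
    unfold mulVec dotProduct; fun_prop
  have hvol : (volume : Measure (ι → ℝ)).map (fun z => L *ᵥ z)
      = ENNReal.ofReal |(L.det)⁻¹| • volume := Real.map_matrix_volume_pi_eq_smul_volume_pi hdet0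
  refine Measure.ext_of_lintegral _ fun f hf => ?_
  have hg : Measurable fun x : ι → ℝ => ENNReal.ofReal (gaussianDensity 1 x) :=
    measurable_gaussianDensity.ennreal_ofReal
  have hgV : Measurable fun x : ι → ℝ => ENNReal.ofReal (gaussianDensity V x) :=
    measurable_gaussianDensity.ennreal_ofReal
  calc ∫⁻ y, f y ∂gaussianLaw V
      = ∫⁻ z, ENNReal.ofReal (gaussianDensity 1 z) * f (L *ᵥ z) := by
        rw [hmap, lintegral_map hf hlin, pi_gaussianReal_eq_withDensity,
          lintegral_withDensity_eq_lintegral_mul (g := fun z => f (L *ᵥ z)) _ hg (hf.comp hlin)]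
        rfl
    _ = ∫⁻ z, ENNReal.ofReal (gaussianDensity 1 (L⁻¹ *ᵥ (L *ᵥ z))) * f (L *ᵥ z) := by
        simp only [mulVec_mulVec, nonsing_inv_mul L hdet0.isUnit, one_mulVec]
    _ = ENNReal.ofReal |(L.det)⁻¹| *
          ∫⁻ y, ENNReal.ofReal (gaussianDensity 1 (L⁻¹ *ᵥ y)) * f y := by
        rw [← lintegral_map (f := fun y => ENNReal.ofReal (gaussianDensity 1 (L⁻¹ *ᵥ y)) * f y)
          ((hg.comp hlin').mul hf) hlin, hvol, lintegral_smul_measure, smul_eq_mul]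
    _ = ∫⁻ y, ENNReal.ofReal (gaussianDensity V y) * f y := by
        rw [← lintegral_const_mul (f := fun y => ENNReal.ofReal (gaussianDensity 1 (L⁻¹ *ᵥ y)) * f y)
          _ ((hg.comp hlin').mul hf)]
        simp only [← mul_assoc, hdens]
    _ = ∫⁻ y, f y ∂volume.withDensity fun x => ENNReal.ofReal (gaussianDensity V x) := by
        rw [lintegral_withDensity_eq_lintegral_mul _ hgV hf]
        rfl

lemma lintegral_gaussianDensity (hV : V.PosDef) :
    ∫⁻ x, ENNReal.ofReal (gaussianDensity V x) = 1 := by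
  have h := measure_univ (μ := gaussianLaw V)
  rwa [gaussianLaw_eq_withDensity hV, withDensity_apply _ .univ, setLIntegral_univ] at h

end GaussianDensity

/-! ### Conditional mutual information across an additive noise channel -/

section Channel

variable {Ω γ α β : Type*} [MeasurableSpace Ω] [MeasurableSpace γ] [MeasurableSpace α]
  [MeasurableSpace β] {P : Measure Ω} [IsProbabilityMeasure P]

/-- Integration of a function of `(U, φ(U) + e)`, where the noise `e` is independent of `U` and has
density `g`. -/
lemma lintegral_of_indepFun_add {ι : Type*} [Fintype ι] {U : Ω → γ} {e : Ω → ι → ℝ}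
    {g : (ι → ℝ) → ℝ≥0∞} {φ : γ → ι → ℝ} (hU : Measurable U) (he : Measurable e) (hg : Measurable g)
    (hφ : Measurable φ) (hind : IndepFun U e P) (hlaw : P.map e = volume.withDensity g)
    {h : γ × (ι → ℝ) → ℝ≥0∞} (hh : Measurable h) :
    ∫⁻ ω, h (U ω, φ (U ω) + e ω) ∂P = ∫⁻ ω, ∫⁻ y, g (y - φ (U ω)) * h (U ω, y) ∂volume ∂P := by
  have hprob : IsProbabilityMeasure (P.map e) := Measure.isProbabilityMeasure_map he.aemeasurable
  have hprobU : IsProbabilityMeasure (P.map U) := Measure.isProbabilityMeasure_map hU.aemeasurable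
  have hF : Measurable fun z : γ × (ι → ℝ) => h (z.1, φ z.1 + z.2) := by fun_prop
  have hG : Measurable fun z : γ × (ι → ℝ) => g (z.2 - φ z.1) * h z := by fun_prop
  calc ∫⁻ ω, h (U ω, φ (U ω) + e ω) ∂P
      = ∫⁻ z, h (z.1, φ z.1 + z.2) ∂((P.map U).prod (P.map e)) := by
        rw [← (indepFun_iff_map_prod_eq_prod_map_map hU.aemeasurable he.aemeasurable).1 hind,
          lintegral_map hF (hU.prodMk he)]
    _ = ∫⁻ u, ∫⁻ s, h (u, φ u + s) ∂(P.map e) ∂(P.map U) := lintegral_prod _ hF.aemeasurable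
    _ = ∫⁻ u, ∫⁻ y, g (y - φ u) * h (u, y) ∂volume ∂(P.map U) := by
        refine lintegral_congr fun u => ?_
        rw [hlaw, lintegral_withDensity_eq_lintegral_mul _ hg (by fun_prop),
          ← lintegral_add_right_eq_self (μ := volume) (fun y => g (y - φ u) * h (u, y)) (φ u)]
        simp [add_comm]
    _ = ∫⁻ ω, ∫⁻ y, g (y - φ (U ω)) * h (U ω, y) ∂volume ∂P :=
        lintegral_map hG.lintegral_prod_right' hU

variable {ι : Type*} [Fintype ι] [StandardBorelSpace α] [Nonempty α] {Z : Ω → γ} {X : Ω → α}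
  {Y v ε : Ω → ι → ℝ} {f g : (ι → ℝ) → ℝ} {c : γ × α → ι → ℝ} {φ : γ → ι → ℝ}

/-- Integration against the law under which `X` and `Y` are conditionally independent given `Z`,
when `Y - φ(Z)` is independent of `Z` with density `g`. -/
lemma lintegral_condIndep (hZ : Measurable Z) (hX : Measurable X) (hY : Measurable Y)
    (hε : Measurable ε) {g : (ι → ℝ) → ℝ≥0∞} (hg : Measurable g) (hφ : Measurable φ)
    (hind : IndepFun Z ε P) (hlaw : P.map ε = volume.withDensity g)
    (hYε : ∀ ω, Y ω = φ (Z ω) + ε ω) {h : γ × α × (ι → ℝ) → ℝ≥0∞} (hh : Measurable h) :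
    ∫⁻ q, h q ∂((P.map Z) ⊗ₘ (condDistrib X Z P ×ₖ condDistrib Y Z P))
      = ∫⁻ ω, ∫⁻ y, g (y - φ (Z ω)) * h (Z ω, X ω, y) ∂volume ∂P := by
  have hprob : IsProbabilityMeasure (P.map Z) := Measure.isProbabilityMeasure_map hZ.aemeasurable
  have hF3 : Measurable fun q : (γ × (ι → ℝ)) × α => h (q.1.1, q.2, q.1.2) := by fun_prop
  have hF : Measurable fun q : γ × (ι → ℝ) => ∫⁻ x, h (q.1, x, q.2) ∂condDistrib X Z P q.1 :=
    Measurable.lintegral_kernel_prod_right' (κ := (condDistrib X Z P).comap Prod.fst measurable_fst)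
      hF3
  have hG : Measurable fun q : γ × α => ∫⁻ y, g (y - φ q.1) * h (q.1, q.2, y) := by
    have : Measurable fun q : (γ × α) × (ι → ℝ) => g (q.2 - φ q.1.1) * h (q.1.1, q.1.2, q.2) := by
      fun_prop
    exact this.lintegral_prod_right'
  calc ∫⁻ q, h q ∂((P.map Z) ⊗ₘ (condDistrib X Z P ×ₖ condDistrib Y Z P))
      = ∫⁻ z, ∫⁻ y, ∫⁻ x, h (z, x, y) ∂condDistrib X Z P z ∂condDistrib Y Z P z ∂(P.map Z) := by
        rw [Measure.lintegral_compProd hh]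
        refine lintegral_congr fun z => ?_
        rw [Kernel.prod_apply, lintegral_prod_symm' _ (by fun_prop)]
    _ = ∫⁻ ω, ∫⁻ x, h (Z ω, x, Y ω) ∂condDistrib X Z P (Z ω) ∂P := by
        rw [← lintegral_map (f := fun q : γ × (ι → ℝ) =>
            ∫⁻ x, h (q.1, x, q.2) ∂condDistrib X Z P q.1) hF (hZ.prodMk hY),
          ← compProd_map_condDistrib hY.aemeasurable, Measure.lintegral_compProd hF]
    _ = ∫⁻ ω, ∫⁻ y, g (y - φ (Z ω)) * ∫⁻ x, h (Z ω, x, y) ∂condDistrib X Z P (Z ω)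
          ∂volume ∂P := by
        simp only [hYε]
        exact lintegral_of_indepFun_add hZ hε hg hφ hind hlaw hF
    _ = ∫⁻ z, ∫⁻ x, ∫⁻ y, g (y - φ z) * h (z, x, y) ∂volume ∂condDistrib X Z P z ∂(P.map Z) := by
        have hH : Measurable fun q : γ × (ι → ℝ) =>
            g (q.2 - φ q.1) * ∫⁻ x, h (q.1, x, q.2) ∂condDistrib X Z P q.1 := by fun_prop
        rw [← lintegral_map (f := fun z => ∫⁻ y, g (y - φ z) *
          ∫⁻ x, h (z, x, y) ∂condDistrib X Z P z ∂volume) hH.lintegral_prod_right' hZ]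
        refine lintegral_congr fun z => ?_
        have hsw : ∀ y, g (y - φ z) * ∫⁻ x, h (z, x, y) ∂condDistrib X Z P z
            = ∫⁻ x, g (y - φ z) * h (z, x, y) ∂condDistrib X Z P z := fun y =>
          (lintegral_const_mul _ (by fun_prop)).symm
        simp only [hsw]
        exact lintegral_lintegral_swap (Measurable.aemeasurable (by fun_prop))
    _ = ∫⁻ ω, ∫⁻ y, g (y - φ (Z ω)) * h (Z ω, X ω, y) ∂volume ∂P := by
        rw [← lintegral_map (f := fun q : γ × α => ∫⁻ y, g (y - φ q.1) * h (q.1, q.2, y)) hG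
          (hZ.prodMk hX), ← compProd_map_condDistrib hX.aemeasurable, Measure.lintegral_compProd hG]

/-- Law of `(Z, X, Y)` relative to the law under which `X` and `Y` are conditionally independent
given `Z`. -/
lemma map_eq_withDensity_condIndep (hZ : Measurable Z) (hX : Measurable X) (hY : Measurable Y)
    (hv : Measurable v) (hε : Measurable ε) (hf : Measurable f) (hg : Measurable g)
    (hgpos : ∀ y, 0 < g y) (hc : Measurable c) (hφ : Measurable φ)
    (hindv : IndepFun (fun ω => (Z ω, X ω)) v P) (hind : IndepFun Z ε P)
    (hlawv : P.map v = volume.withDensity fun y => ENNReal.ofReal (f y))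
    (hlaw : P.map ε = volume.withDensity fun y => ENNReal.ofReal (g y))
    (hYv : ∀ ω, Y ω = c (Z ω, X ω) + v ω) (hYε : ∀ ω, Y ω = φ (Z ω) + ε ω) :
    P.map (fun ω => (Z ω, X ω, Y ω))
      = ((P.map Z) ⊗ₘ (condDistrib X Z P ×ₖ condDistrib Y Z P)).withDensity fun q =>
          ENNReal.ofReal (f (q.2.2 - c (q.1, q.2.1)) / g (q.2.2 - φ q.1)) := by
  refine Measure.ext_of_lintegral _ fun h hh => ?_
  have hρ : Measurable fun q : γ × α × (ι → ℝ) =>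
      ENNReal.ofReal (f (q.2.2 - c (q.1, q.2.1)) / g (q.2.2 - φ q.1)) := by fun_prop
  rw [lintegral_map hh (by fun_prop), lintegral_withDensity_eq_lintegral_mul _ hρ hh,
    lintegral_condIndep hZ hX hY hε hg.ennreal_ofReal hφ hind hlaw hYε (hρ.mul hh)]
  have h1 := lintegral_of_indepFun_add (hZ.prodMk hX) hv hf.ennreal_ofReal hc hindv hlawv
    (h := fun q : (γ × α) × (ι → ℝ) => h (q.1.1, q.1.2, q.2)) (by fun_prop)
  simp only [← hYv] at h1
  rw [h1]
  refine lintegral_congr fun ω => lintegral_congr fun y => ?_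
  simp only [Pi.mul_apply]
  rw [← mul_assoc, ← ENNReal.ofReal_mul (hgpos _).le, mul_div_cancel₀ _ (hgpos _).ne']

/-- The Kullback–Leibler divergence in the definition of conditional mutual information, for an
additive noise channel. -/
lemma klDiv_condIndep (hZ : Measurable Z) (hX : Measurable X) (hY : Measurable Y)
    (hv : Measurable v) (hε : Measurable ε) (hf : Measurable f) (hg : Measurable g)
    (hfpos : ∀ y, 0 < f y) (hgpos : ∀ y, 0 < g y) (hc : Measurable c) (hφ : Measurable φ)
    (hindv : IndepFun (fun ω => (Z ω, X ω)) v P) (hind : IndepFun Z ε P)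
    (hlawv : P.map v = volume.withDensity fun y => ENNReal.ofReal (f y))
    (hlaw : P.map ε = volume.withDensity fun y => ENNReal.ofReal (g y))
    (hYv : ∀ ω, Y ω = c (Z ω, X ω) + v ω) (hYε : ∀ ω, Y ω = φ (Z ω) + ε ω)
    (hint : Integrable (fun ω => Real.log (f (v ω)) - Real.log (g (ε ω))) P) :
    InformationTheory.klDiv (P.map fun ω => (Z ω, X ω, Y ω))
        ((P.map Z) ⊗ₘ (condDistrib X Z P ×ₖ condDistrib Y Z P))
      = ENNReal.ofReal (∫ ω, (Real.log (f (v ω)) - Real.log (g (ε ω))) ∂P) := by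
  have hmapeq := map_eq_withDensity_condIndep hZ hX hY hv hε hf hg hgpos hc hφ hindv hind hlawv
    hlaw hYv hYε
  have hprob : IsProbabilityMeasure (P.map Z) := Measure.isProbabilityMeasure_map hZ.aemeasurable
  set μ := P.map (fun ω => (Z ω, X ω, Y ω)) with hμ
  set ν := (P.map Z) ⊗ₘ (condDistrib X Z P ×ₖ condDistrib Y Z P) with hν
  set ρ : γ × α × (ι → ℝ) → ℝ := fun q => f (q.2.2 - c (q.1, q.2.1)) / g (q.2.2 - φ q.1) with hρ
  have hρm : Measurable ρ := by fun_prop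
  have hT : Measurable fun ω => (Z ω, X ω, Y ω) := by fun_prop
  have hprobμ : IsProbabilityMeasure μ := Measure.isProbabilityMeasure_map hT.aemeasurable
  have hac : μ ≪ ν := by rw [hmapeq]; exact withDensity_absolutelyContinuous _ _
  have hllr : llr μ ν =ᵐ[μ] fun q => Real.log (ρ q) := by
    refine hac.ae_le ?_
    have h1 := Measure.rnDeriv_withDensity ν hρm.ennreal_ofReal
    rw [hmapeq]
    filter_upwards [h1] with q hq
    rw [llr, hq, ENNReal.toReal_ofReal (div_pos (hfpos _) (hgpos _)).le]
  have hlogρ : ∀ ω, Real.log (ρ (Z ω, X ω, Y ω)) = Real.log (f (v ω)) - Real.log (g (ε ω)) := by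
    intro ω
    have h1 : Y ω - c (Z ω, X ω) = v ω := by rw [hYv]; abel
    have h2 : Y ω - φ (Z ω) = ε ω := by rw [hYε]; abel
    rw [hρ]
    simp only [h1, h2]
    exact Real.log_div (hfpos _).ne' (hgpos _).ne'
  have hlogm : Measurable fun q => Real.log (ρ q) := hρm.log
  have hint' : Integrable (llr μ ν) μ := by
    rw [integrable_congr hllr, hμ, integrable_map_measure hlogm.aestronglyMeasurable hT.aemeasurable]
    exact hint.congr (.of_forall fun ω => (hlogρ ω).symm)
  rw [InformationTheory.klDiv_of_ac_of_integrable hac hint', integral_congr_ae hllr, hμ,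
    integral_map hT.aemeasurable hlogm.aestronglyMeasurable]
  simp only [hlogρ, probReal_univ, add_sub_cancel_right]

lemma integrable_quadraticForm {κ : Type*} [Fintype κ] {q : Ω → κ → ℝ} (hq : IsL2 P q)
    (A : Matrix κ κ ℝ) : Integrable (fun ω => q ω ⬝ᵥ A *ᵥ q ω) P := by
  simp only [dotProduct, mulVec]
  exact integrable_finsetSum _ fun i _ =>
    (hq i).integrable_mul (memLp_finsetSum _ fun j _ => (hq j).const_mul (A i j))

lemma integral_quadraticForm {κ : Type*} [Fintype κ] {q : Ω → κ → ℝ} (hq : IsL2 P q)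
    (A : Matrix κ κ ℝ) : ∫ ω, q ω ⬝ᵥ A *ᵥ q ω ∂P = (A * secondMoment P q q).trace := by
  have hij : ∀ i j, Integrable (fun ω => q ω i * (A i j * q ω j)) P := fun i j =>
    (hq i).integrable_mul ((hq j).const_mul (A i j))
  simp only [dotProduct, mulVec, trace, diag_apply, mul_apply, secondMoment_apply, Finset.mul_sum]
  rw [integral_finsetSum _ fun i _ => integrable_finsetSum _ fun j _ => hij i j]
  refine Finset.sum_congr rfl fun i _ => ?_
  rw [integral_finsetSum _ fun j _ => hij i j]
  refine Finset.sum_congr rfl fun j _ => ?_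
  rw [← integral_const_mul]
  exact integral_congr_ae (.of_forall fun ω => by ring)

lemma integrable_log_gaussianDensity [DecidableEq ι] {V : Matrix ι ι ℝ} (hV : V.PosDef)
    (hε : IsL2 P ε) : Integrable (fun ω => Real.log (gaussianDensity V (ε ω))) P := by
  simp only [log_gaussianDensity hV]
  exact (((integrable_const _).add (integrable_quadraticForm hε _)).neg).div_const 2

lemma integral_log_gaussianDensity [DecidableEq ι] {V : Matrix ι ι ℝ} (hV : V.PosDef)
    (hε : IsL2 P ε) (hcov : secondMoment P ε ε = V) :
    ∫ ω, Real.log (gaussianDensity V (ε ω)) ∂P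
      = -(Fintype.card ι * Real.log (2 * Real.pi) + Real.log V.det + Fintype.card ι) / 2 := by
  simp only [log_gaussianDensity hV]
  rw [integral_div, integral_neg, integral_add (integrable_const _) (integrable_quadraticForm hε _),
    integral_quadraticForm hε, hcov, nonsing_inv_mul V hV.det_pos.ne'.isUnit, trace_one]
  simp

/-- Conditional mutual information across an additive Gaussian channel with unit noise covariance,
when the output is `φ(Z)` plus an innovation independent of `Z` with covariance `V`. -/
lemma condMutualInfo_gaussian [DecidableEq ι] {V : Matrix ι ι ℝ} (hV : V.PosDef)
    (hZ : Measurable Z) (hX : Measurable X) (hY : Measurable Y)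
    (hv : Measurable v) (hε : Measurable ε) (hc : Measurable c) (hφ : Measurable φ)
    (hindv : IndepFun (fun ω => (Z ω, X ω)) v P) (hind : IndepFun Z ε P)
    (hlawv : P.map v = gaussianLaw 1) (hlaw : P.map ε = gaussianLaw V)
    (hYv : ∀ ω, Y ω = c (Z ω, X ω) + v ω) (hYε : ∀ ω, Y ω = φ (Z ω) + ε ω) :
    condMutualInfo P X Y Z = ENNReal.ofReal (Real.logb 2 V.det / 2) := by
  have hv2 := gaussianLaw_moments hv hlawv .one
  have hε2 := gaussianLaw_moments hε hlaw hV.posSemidef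
  have hiv := integrable_log_gaussianDensity .one hv2.1
  have hiε := integrable_log_gaussianDensity hV hε2.1
  rw [condMutualInfo, klDiv_condIndep hZ hX hY hv hε measurable_gaussianDensity
    measurable_gaussianDensity (gaussianDensity_pos .one) (gaussianDensity_pos hV) hc hφ hindv hind
    (hlawv.trans (gaussianLaw_eq_withDensity .one)) (hlaw.trans (gaussianLaw_eq_withDensity hV))
    hYv hYε (hiv.sub hiε), integral_sub hiv hiε, integral_log_gaussianDensity .one hv2.1 hv2.2.2,
    integral_log_gaussianDensity hV hε2.1 hε2.2.2, ← ENNReal.ofReal_div_of_pos (Real.log_pos one_lt_two),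
    det_one, Real.log_one, Real.logb]
  congr 1
  ring

end Channel

/-! ### Joint Gaussianity of the test channel -/

section GaussianVectors

variable {Ω ι κ : Type*} [MeasurableSpace Ω] [Fintype ι] [Fintype κ] {P : Measure Ω}
  [IsProbabilityMeasure P]

lemma isGaussian_gaussianLaw [DecidableEq ι] (V : Matrix ι ι ℝ) : IsGaussian (gaussianLaw V) := by
  have h : gaussianLaw V = (multivariateGaussian 0 V).map (EuclideanSpace.equiv ι ℝ) := rfl
  rw [h]
  infer_instance

lemma measurable_dotProduct (a : ι → ℝ) : Measurable fun z : ι → ℝ => a ⬝ᵥ z := by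
  simp only [dotProduct]
  fun_prop

lemma apply_eq_dotProduct [DecidableEq ι] (L : StrongDual ℝ (ι → ℝ)) (z : ι → ℝ) :
    L z = (fun i => L (Pi.single i 1)) ⬝ᵥ z := by
  conv_lhs => rw [← Finset.univ_sum_single z]
  rw [map_sum, dotProduct]
  refine Finset.sum_congr rfl fun i _ => ?_
  rw [show Pi.single i (z i) = z i • (Pi.single i (1 : ℝ) : ι → ℝ) by
    rw [← Pi.single_smul, smul_eq_mul, mul_one], map_smul, smul_eq_mul, mul_comm]

/-- Two centered Gaussian laws with the same second moments coincide. -/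
lemma eq_of_secondMoment_eq {μ ν : Measure (ι → ℝ)} [IsGaussian μ] [IsGaussian ν]
    (hμ : ∀ i, ∫ z, z i ∂μ = 0) (hν : ∀ i, ∫ z, z i ∂ν = 0)
    (h : secondMoment μ id id = secondMoment ν id id) : μ = ν := by
  classical
  have hl2 : ∀ (μ : Measure (ι → ℝ)) [IsGaussian μ], IsL2 μ id := fun μ _ i =>
    IsGaussian.memLp_dual μ (ContinuousLinearMap.proj i) 2 (by simp)
  have hmean : ∀ (μ : Measure (ι → ℝ)) [IsGaussian μ], (∀ i, ∫ z, z i ∂μ = 0) →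
      ∀ L : StrongDual ℝ (ι → ℝ), ∫ z, L z ∂μ = 0 := by
    intro μ _ h0 L
    rw [show ∫ z, L z ∂μ = ∫ z, ∑ i, L (Pi.single i 1) * z i ∂μ from
      integral_congr_ae (.of_forall (apply_eq_dotProduct L)),
      integral_finsetSum _ fun i _ => Integrable.const_mul (f := fun z : ι → ℝ => z i)
        ((hl2 μ i).integrable one_le_two) _]
    simp [integral_const_mul, h0]
  have hvar : ∀ (μ : Measure (ι → ℝ)) [IsGaussian μ], (∀ i, ∫ z, z i ∂μ = 0) →
      ∀ L : StrongDual ℝ (ι → ℝ), Var[L; μ] =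
        (vecMulVec (fun i => L (Pi.single i 1)) (fun i => L (Pi.single i 1))
          * secondMoment μ id id).trace := by
    intro μ _ h0 L
    rw [variance_of_integral_eq_zero L.continuous.aemeasurable (hmean μ h0 L),
      ← integral_quadraticForm (hl2 μ)]
    refine integral_congr_ae (.of_forall fun z => ?_)
    change L z ^ 2 = z ⬝ᵥ vecMulVec _ _ *ᵥ z
    rw [apply_eq_dotProduct L z, vecMulVec_mulVec, dotProduct_smul,
      dotProduct_comm z]
    simp [sq]
  refine Measure.ext_of_charFunDual (funext fun L => ?_)
  rw [IsGaussian.charFunDual_eq, IsGaussian.charFunDual_eq, integral_complex_ofReal,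
    integral_complex_ofReal, hmean μ hμ, hmean ν hν, hvar μ hμ, hvar ν hν, h]

lemma map_eq_gaussianLaw [DecidableEq ι] {q : Ω → ι → ℝ} {V : Matrix ι ι ℝ} (hq : Measurable q)
    (hG : HasGaussianLaw q P) (hmean : ∀ i, ∫ ω, q ω i ∂P = 0) (hV : V.PosSemidef)
    (hcov : secondMoment P q q = V) : P.map q = gaussianLaw V := by
  have h1 := hG.isGaussian_map
  have h2 := isGaussian_gaussianLaw V
  have h3 := gaussianLaw_moments (P := gaussianLaw V) (q := id) measurable_id Measure.map_id hV
  refine eq_of_secondMoment_eq (fun i => ?_) h3.2.1 ?_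
  · rw [integral_map hq.aemeasurable (measurable_pi_apply i).aestronglyMeasurable]
    exact hmean i
  · rw [h3.2.2, ← hcov]
    ext i j
    rw [secondMoment_apply, secondMoment_apply, integral_map hq.aemeasurable
      (by simp only [id]; fun_prop)]
    rfl

lemma HasGaussianLaw.dotProduct {q : Ω → ι → ℝ} (hq : HasGaussianLaw q P) (a : ι → ℝ) :
    HasGaussianLaw (fun ω => a ⬝ᵥ q ω) P := by
  have h := hq.map_fun (∑ i, a i • ContinuousLinearMap.proj (R := ℝ) (φ := fun _ : ι => ℝ) i)
  simpa [_root_.dotProduct] using h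

/-- A submodule of random variables with Gaussian laws. -/
def IsGaussianSpace (P : Measure Ω) (U : Submodule ℝ (Ω → ℝ)) : Prop :=
  ∀ f ∈ U, HasGaussianLaw f P

/-- Vectors with coordinates in a Gaussian space are jointly Gaussian. -/
lemma IsGaussianSpace.hasGaussianLaw_prod {U : Submodule ℝ (Ω → ℝ)} (hU : IsGaussianSpace P U)
    {X : Ω → ι → ℝ} {Y : Ω → κ → ℝ} (hXm : Measurable X) (hYm : Measurable Y)
    (hX : ∀ i, (fun ω => X ω i) ∈ U) (hY : ∀ i, (fun ω => Y ω i) ∈ U) :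
    HasGaussianLaw (fun ω => (X ω, Y ω)) P := by
  classical
  refine ⟨isGaussian_of_isGaussian_map fun L => ?_⟩
  rw [Measure.map_map L.continuous.measurable (hXm.prodMk hYm)]
  have hsum : (L ∘ fun ω => (X ω, Y ω))
      = (∑ i, L (Pi.single i 1, 0) • fun ω => X ω i)
        + ∑ i, L (0, Pi.single i 1) • fun ω => Y ω i := by
    ext ω
    have h1 := apply_eq_dotProduct (L.comp (.inl ℝ (ι → ℝ) (κ → ℝ))) (X ω)
    have h2 := apply_eq_dotProduct (L.comp (.inr ℝ (ι → ℝ) (κ → ℝ))) (Y ω)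
    have h3 : L (X ω, Y ω) = L (X ω, 0) + L (0, Y ω) := by rw [← map_add]; simp
    simp only [ContinuousLinearMap.comp_apply, ContinuousLinearMap.inl_apply,
      ContinuousLinearMap.inr_apply, dotProduct] at h1 h2
    simp [h3, h1, h2]
  rw [hsum]
  exact (hU _ (U.add_mem (U.sum_mem fun i _ => U.smul_mem _ (hX i))
    (U.sum_mem fun i _ => U.smul_mem _ (hY i)))).isGaussian_map

end GaussianVectors

section GaussianSpan

variable {Ω ι κ : Type*} [MeasurableSpace Ω] [Fintype ι] [Fintype κ] {P : Measure Ω}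
  [IsProbabilityMeasure P] {x₀ : Ω → ι → ℝ} {w : ℕ → Ω → ι → ℝ} {v : ℕ → Ω → κ → ℝ}
  {lw : Measure (ι → ℝ)} {lv : Measure (κ → ℝ)}

/-- The affine functions of finitely many of the primitive random variables. -/
def primitiveSpan (x₀ : Ω → ι → ℝ) (w : ℕ → Ω → ι → ℝ) (v : ℕ → Ω → κ → ℝ) :
    Submodule ℝ (Ω → ℝ) :=
  Submodule.span ℝ ({fun _ => 1} ∪ (Set.range fun i ω => x₀ ω i)
    ∪ (Set.range fun (j : ℕ × ι) ω => w j.1 ω j.2) ∪ Set.range fun (j : ℕ × κ) ω => v j.1 ω j.2)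

lemma one_mem_primitiveSpan : (fun _ => 1) ∈ primitiveSpan x₀ w v :=
  Submodule.subset_span (.inl (.inl (.inl rfl)))

lemma init_mem_primitiveSpan (i : ι) : (fun ω => x₀ ω i) ∈ primitiveSpan x₀ w v :=
  Submodule.subset_span (.inl (.inl (.inr ⟨i, rfl⟩)))

lemma w_mem_primitiveSpan (t : ℕ) (i : ι) : (fun ω => w t ω i) ∈ primitiveSpan x₀ w v :=
  Submodule.subset_span (.inl (.inr ⟨(t, i), rfl⟩))

lemma v_mem_primitiveSpan (t : ℕ) (i : κ) : (fun ω => v t ω i) ∈ primitiveSpan x₀ w v :=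
  Submodule.subset_span (.inr ⟨(t, i), rfl⟩)

lemma exists_sum_of_mem_primitiveSpan {f : Ω → ℝ} (hf : f ∈ primitiveSpan x₀ w v) :
    ∃ (l : ι → ℝ) (b : ℝ) (a : ℕ → ι → ℝ) (c : ℕ → κ → ℝ) (N : ℕ), ∀ K ≥ N, ∀ ω,
      f ω = l ⬝ᵥ x₀ ω + b + ∑ t ∈ Finset.range K, (a t ⬝ᵥ w t ω + c t ⬝ᵥ v t ω) := by
  classical
  induction hf using Submodule.span_induction with
  | mem f hf =>
    obtain ((rfl | ⟨i, rfl⟩) | ⟨⟨t, i⟩, rfl⟩) | ⟨⟨t, i⟩, rfl⟩ := hf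
    · exact ⟨0, 1, 0, 0, 0, by simp⟩
    · exact ⟨Pi.single i 1, 0, 0, 0, 0, by simp⟩
    · refine ⟨0, 0, Pi.single t (Pi.single i 1), 0, t + 1, fun K hK ω => ?_⟩
      rw [Finset.sum_eq_single_of_mem t (Finset.mem_range.2 hK) fun s _ hs => by
        simp [Pi.single_eq_of_ne hs]]
      simp
    · refine ⟨0, 0, 0, Pi.single t (Pi.single i 1), t + 1, fun K hK ω => ?_⟩
      rw [Finset.sum_eq_single_of_mem t (Finset.mem_range.2 hK) fun s _ hs => by
        simp [Pi.single_eq_of_ne hs]]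
      simp
  | zero => exact ⟨0, 0, 0, 0, 0, by simp⟩
  | add f g _ _ hf hg =>
    obtain ⟨l, b, a, c, N, h⟩ := hf
    obtain ⟨l', b', a', c', N', h'⟩ := hg
    refine ⟨l + l', b + b', a + a', c + c', max N N', fun K hK ω => ?_⟩
    rw [Pi.add_apply, h K (le_trans (le_max_left _ _) hK), h' K (le_trans (le_max_right _ _) hK)]
    simp only [Pi.add_apply, add_dotProduct, Finset.sum_add_distrib]
    ring
  | smul r f _ hf =>
    obtain ⟨l, b, a, c, N, h⟩ := hf
    refine ⟨r • l, r * b, fun t => r • a t, fun t => r • c t, N, fun K hK ω => ?_⟩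
    rw [Pi.smul_apply, h K hK]
    simp only [smul_dotProduct, smul_eq_mul, ← mul_add, ← Finset.mul_sum]

lemma isGaussianSpace_primitiveSpan (hp : IsPrimitive P x₀ w v lw lv) [IsGaussian lw]
    [IsGaussian lv] (h0 : HasGaussianLaw x₀ P) : IsGaussianSpace P (primitiveSpan x₀ w v) := by
  have hw : ∀ t, HasGaussianLaw (w t) P := fun t => ⟨by rw [hp.law_w]; infer_instance⟩
  have hv : ∀ t, HasGaussianLaw (v t) P := fun t => ⟨by rw [hp.law_v]; infer_instance⟩
  intro f hf
  obtain ⟨l, b, a, c, N, h⟩ := exists_sum_of_mem_primitiveSpan hf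
  suffices H : ∀ K, Measurable[past x₀ w v K K]
      (fun ω => l ⬝ᵥ x₀ ω + b + ∑ t ∈ Finset.range K, (a t ⬝ᵥ w t ω + c t ⬝ᵥ v t ω)) ∧
      HasGaussianLaw
        (fun ω => l ⬝ᵥ x₀ ω + b + ∑ t ∈ Finset.range K, (a t ⬝ᵥ w t ω + c t ⬝ᵥ v t ω)) P by
    rw [show f = _ from funext (h N le_rfl)]
    exact (H N).2
  intro K
  induction K with
  | zero =>
    simp only [Finset.range_zero, Finset.sum_empty, add_zero]
    refine ⟨((measurable_dotProduct l).comp measurable_past_init).add_const b, ?_⟩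
    have hb : HasGaussianLaw (fun _ : Ω => b) P := ⟨by
      rw [Measure.map_const, measure_univ, one_smul]; infer_instance⟩
    exact (IndepFun.hasGaussianLaw (HasGaussianLaw.dotProduct h0 l) hb
      (indepFun_const_right _ _)).fun_add
  | succ K ih =>
    obtain ⟨hm, hG⟩ := ih
    have h1 := IndepFun.hasGaussianLaw hG (HasGaussianLaw.dotProduct (hv K) (c K))
      ((hp.indepFun_v hm).comp measurable_id (measurable_dotProduct (c K)))
    have hm2 : Measurable[past x₀ w v K (K + 1)] (fun ω => l ⬝ᵥ x₀ ω + b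
        + ∑ t ∈ Finset.range K, (a t ⬝ᵥ w t ω + c t ⬝ᵥ v t ω) + c K ⬝ᵥ v K ω) :=
      (hm.mono (past_mono le_rfl K.le_succ) le_rfl).add
        ((measurable_dotProduct (c K)).comp (measurable_past_v K.lt_succ_self))
    have h2 := IndepFun.hasGaussianLaw h1.fun_add (HasGaussianLaw.dotProduct (hw K) (a K))
      ((hp.indepFun_w hm2).comp measurable_id (measurable_dotProduct (a K)))
    have hm3 := (hm2.mono (past_mono K.le_succ le_rfl) le_rfl).add
      ((measurable_dotProduct (a K)).comp (measurable_past_w (x₀ := x₀) (w := w) (v := v) (s := K + 1)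
        K.lt_succ_self))
    have heq : (fun ω => l ⬝ᵥ x₀ ω + b
          + ∑ t ∈ Finset.range (K + 1), (a t ⬝ᵥ w t ω + c t ⬝ᵥ v t ω))
        = fun ω => l ⬝ᵥ x₀ ω + b
          + ∑ t ∈ Finset.range K, (a t ⬝ᵥ w t ω + c t ⬝ᵥ v t ω) + c K ⬝ᵥ v K ω
          + a K ⬝ᵥ w K ω := by
      ext ω
      rw [Finset.sum_range_succ]
      ring
    rw [heq]
    exact ⟨hm3, h2.fun_add⟩

end GaussianSpan

namespace IsGaussianLoop

variable {Ω : Type*} [MeasurableSpace Ω] {n m p : ℕ} {P : Measure Ω} [IsProbabilityMeasure P]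
  {M : Plant n m p} {C : Matrix (Fin n) (Fin n) ℝ} {K : Matrix (Fin p) (Fin n ⊕ Fin m) ℝ}
  {x w : ℕ → Ω → Fin n ⊕ Fin m → ℝ} {v y xhat : ℕ → Ω → Fin n → ℝ} {u : ℕ → Ω → Fin p → ℝ}

/-- Linear estimation and control keep all signals affine in the primitive random variables. -/
lemma mem_primitiveSpan (h : IsGaussianLoop M K C P x w v y xhat u) (t : ℕ) :
    (∀ i, (fun ω => x t ω i) ∈ primitiveSpan (x 0) w v) ∧
      ∀ i, (fun ω => y t ω i) ∈ primitiveSpan (x 0) w v := by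
  refine loop_induction (A := fun t => ∀ i, (fun ω => x t ω i) ∈ primitiveSpan (x 0) w v)
    (B := fun t => ∀ i, (fun ω => y t ω i) ∈ primitiveSpan (x 0) w v) init_mem_primitiveSpan
    (fun t hx _ i => ?_) (fun t hx hy i => ?_) t
  · convert! Submodule.add_mem _ (mulVec_mem (Y := fun ω => fstPart (x t ω))
      (fun j => hx t le_rfl (Sum.inl j)) C i) (v_mem_primitiveSpan t i) using 1
    ext ω
    simp [h.sensor]
  · have hle : obsSpan y x (t + 1) (t + 1) ≤ primitiveSpan (x 0) w v :=
      obsSpan_le one_mem_primitiveSpan (fun s hs => hy s (Nat.lt_succ_iff.1 hs))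
        fun s hs j => hx s (Nat.lt_succ_iff.1 hs) (Sum.inr j)
    convert! Submodule.add_mem _ (hle (plant_mem_obsSpan h.plant h.filter h.control t i))
      (Submodule.add_mem _ (mulVec_mem (Y := fun ω => fstPart (x t ω))
      (fun j => hx t le_rfl (Sum.inl j)) M.Abar i) (w_mem_primitiveSpan t i)) using 1
    ext ω
    simp

/-- The term of the directed information at time `t`. -/
lemma condMutualInfo_eq (h : IsGaussianLoop M K C P x w v y xhat u) {S : Matrix (Fin n) (Fin n) ℝ}
    (hS : HasErrorCov P (fun ω => fstPart (x 0 ω)) (obsSpan y x 0 1) S) (t : ℕ) :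
    condMutualInfo P (history x (t + 1)) (y t)
        (fun ω => (history y t ω, history (fun t ω => sndPart (x t ω)) (t + 1) ω))
      = ENNReal.ofReal (Real.logb 2 (C * (M.riccati C)^[t] S * Cᵀ + 1).det / 2) := by
  have h2 := h.isSecondOrderLoop
  have hW := isGaussian_gaussianLaw M.W
  have hI := isGaussian_gaussianLaw (1 : Matrix (Fin n) (Fin n) ℝ)
  have hGS := isGaussianSpace_primitiveSpan h.primitive h.init
  have hpast := h.primitive.past_le
  have hxm : ∀ t, Measurable (x t) := fun t => (h.adapted t).1.mono (hpast _ _) le_rfl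
  have hym : ∀ t, Measurable (y t) := fun t => (h.adapted t).2.mono (hpast _ _) le_rfl
  have hobsm : Measurable (observations y x t (t + 1)) :=
    measurable_observations (fun s _ => hym s) fun s _ => hxm s
  have hobsG : ∀ j, (fun ω => observations y x t (t + 1) ω j) ∈ primitiveSpan (x 0) w v := by
    rintro (⟨s, j⟩ | ⟨s, j⟩)
    · exact (h.mem_primitiveSpan s).2 j
    · exact (h.mem_primitiveSpan s).1 (Sum.inr j)
  have hobs2 : IsL2 P (observations y x t (t + 1)) :=
    isL2_observations (fun s _ => h2.l2_y s) fun s _ => h2.l2_x s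
  -- The innovation `ε` is orthogonal to, hence independent of, the conditioning variables.
  obtain ⟨e, he2, hem, heo, hecov⟩ := h2.hasErrorCov_iterate hS t
  obtain ⟨ho, hymem, -, hεcov⟩ := h2.measurement_innovation he2 hem heo
  rw [hecov] at hεcov
  have hV : (C * (M.riccati C)^[t] S * Cᵀ + 1).PosDef :=
    innovation_posDef C .one (hecov ▸ secondMoment_posSemidef he2)
  have hε2 : IsL2 P fun ω => C *ᵥ e ω + v t ω := (he2.mulVec C).add (h2.l2_ν t)
  set ε : Ω → Fin n → ℝ := fun ω => C *ᵥ e ω + v t ω with hε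
  choose l b hlb using fun i => exists_affine_of_mem_affineFunctions (hymem i)
  have hyε : ∀ ω, y t ω = (fun i => l i ⬝ᵥ observations y x t (t + 1) ω + b i) + ε ω := by
    intro ω
    ext i
    have := hlb i ω
    rw [Pi.sub_apply] at this
    rw [Pi.add_apply, ← this, hε]
    ring
  have hεG : ∀ i, (fun ω => ε ω i) ∈ primitiveSpan (x 0) w v := fun i => by
    convert! Submodule.sub_mem _ ((h.mem_primitiveSpan t).2 i)
      (affineFunctions_le one_mem_primitiveSpan hobsG (hymem i)) using 1
    ext ω
    simp [hε]
  have hεm : Measurable ε := by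
    have : ε = fun ω => y t ω - fun i => l i ⬝ᵥ observations y x t (t + 1) ω + b i := by
      ext ω
      rw [hyε, add_sub_cancel_left]
    rw [this]
    refine (hym t).sub (measurable_pi_lambda _ fun i => ?_)
    simp only [dotProduct]
    fun_prop
  have hεmean : ∀ i, ∫ ω, ε ω i ∂P = 0 := fun i => by
    simpa using ho _ one_mem_affineFunctions i
  have hG := hGS.hasGaussianLaw_prod hobsm hεm hobsG hεG
  have hlaw : P.map ε = gaussianLaw (C * (M.riccati C)^[t] S * Cᵀ + 1) :=
    map_eq_gaussianLaw hεm hG.snd hεmean hV.posSemidef hεcov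
  have hind : IndepFun (observations y x t (t + 1)) ε P := by
    refine HasGaussianLaw.indepFun_of_covariance_eval
      (X := fun j ω => observations y x t (t + 1) ω j) (Y := fun i ω => ε ω i) hG fun j i => ?_
    rw [covariance_eq_sub (hobs2 j) (hε2 i), hεmean i, mul_zero, sub_zero]
    have := ho _ (coord_mem_affineFunctions j) i
    simpa [mul_comm] using this
  let F : (Fin t → Fin n → ℝ) × (Fin (t + 1) → Fin m → ℝ) →
      (Fin t × Fin n) ⊕ (Fin (t + 1) × Fin m) → ℝ :=
    fun z => Sum.elim (fun j => z.1 j.1 j.2) fun j => z.2 j.1 j.2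
  have hF : Measurable F := by
    refine measurable_pi_lambda _ ?_
    rintro (j | j)
    · exact (measurable_pi_apply j.2).comp ((measurable_pi_apply j.1).comp measurable_fst)
    · exact (measurable_pi_apply j.2).comp ((measurable_pi_apply j.1).comp measurable_snd)
  have hpastt : ∀ s ≤ t, Measurable[past (x 0) w v t t] (x s) := fun s hs =>
    (h.adapted s).1.mono (past_mono hs hs) le_rfl
  have hZpast : Measurable[past (x 0) w v t t]
      fun ω => (history y t ω, history (fun t ω => sndPart (x t ω)) (t + 1) ω) := by
    refine measurable_pair ?_ ?_
    · exact @measurable_pi_lambda _ _ _ (past (x 0) w v t t) _ _ fun s =>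
        (h.adapted s).2.mono (past_mono s.2.le s.2) le_rfl
    · exact @measurable_pi_lambda _ _ _ (past (x 0) w v t t) _ _ fun s =>
        measurable_sndPart.comp (hpastt s (Nat.lt_succ_iff.1 s.2))
  have hXpast : Measurable[past (x 0) w v t t] (history x (t + 1)) :=
    @measurable_pi_lambda _ _ _ (past (x 0) w v t t) _ _ fun s =>
      hpastt s (Nat.lt_succ_iff.1 s.2)
  have hφ : Measurable fun (z : (Fin t → Fin n → ℝ) × (Fin (t + 1) → Fin m → ℝ)) (i : Fin n) =>
      l i ⬝ᵥ F z + b i :=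
    measurable_pi_lambda _ fun i => ((measurable_dotProduct (l i)).comp hF).add_const (b i)
  have hc : Measurable fun z : ((Fin t → Fin n → ℝ) × (Fin (t + 1) → Fin m → ℝ))
      × (Fin (t + 1) → Fin n ⊕ Fin m → ℝ) => C *ᵥ fstPart (z.2 (Fin.last t)) :=
    (measurable_mulVec C).comp (measurable_fstPart.comp
      ((measurable_pi_apply (Fin.last t)).comp measurable_snd))
  have hindZ : IndepFun
      (fun ω => (history y t ω, history (fun t ω => sndPart (x t ω)) (t + 1) ω)) ε P :=
    hind.comp (φ := fun z : (Fin t × Fin n) ⊕ (Fin (t + 1) × Fin m) → ℝ =>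
      ((fun s j => z (Sum.inl (s, j)) : Fin t → Fin n → ℝ),
        (fun s j => z (Sum.inr (s, j)) : Fin (t + 1) → Fin m → ℝ))) (by fun_prop) measurable_id
  exact condMutualInfo_gaussian hV (hZpast.mono (hpast _ _) le_rfl) (hXpast.mono (hpast _ _) le_rfl)
    (hym t) (h.primitive.measurable_v t) hεm hc hφ
    (h.primitive.indepFun_v (measurable_pair hZpast hXpast)) hindZ (h.primitive.law_v t) hlaw
    (h.sensor t) hyε

end IsGaussianLoop

/-! ### Shannon–Fano–Elias codes are prefix-free -/

section SFE

variable {α : Type*} {e : α ↪ ℕ} {q : α → ℝ}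

lemma floor_two_mul_div_two (z : ℝ) : ⌊2 * z⌋ / 2 = ⌊z⌋ := by
  have h1 := Int.floor_le z
  have h2 := Int.lt_floor_add_one z
  have h3 : 2 * ⌊z⌋ ≤ ⌊2 * z⌋ := Int.le_floor.2 (by push_cast; linarith)
  have h4 : ⌊2 * z⌋ < 2 * ⌊z⌋ + 2 := Int.floor_lt.2 (by push_cast; linarith)
  omega

/-- The first `L` binary digits of a number in `[0, 1)` determine its integer part at scale
`2 ^ L`. -/
lemma floor_mul_two_pow_eq {F G : ℝ} (hF : F ∈ Set.Ico (0 : ℝ) 1) (hG : G ∈ Set.Ico (0 : ℝ) 1)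
    (L : ℕ) (h : ∀ i < L, (⌊F * 2 ^ (i + 1)⌋ % 2 = 1 ↔ ⌊G * 2 ^ (i + 1)⌋ % 2 = 1)) :
    ⌊F * 2 ^ L⌋ = ⌊G * 2 ^ L⌋ := by
  induction L with
  | zero =>
    rw [pow_zero, mul_one, mul_one, Int.floor_eq_zero_iff.2 hF, Int.floor_eq_zero_iff.2 hG]
  | succ L ih =>
    have h1 := ih fun i hi => h i (hi.trans L.lt_succ_self)
    have h2 := h L L.lt_succ_self
    have h3 := floor_two_mul_div_two (F * 2 ^ L)
    have h4 := floor_two_mul_div_two (G * 2 ^ L)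
    have e1 : 2 * (F * 2 ^ L) = F * 2 ^ (L + 1) := by ring
    have e2 : 2 * (G * 2 ^ L) = G * 2 ^ (L + 1) := by ring
    rw [e1] at h3
    rw [e2] at h4
    omega

lemma two_pow_neg_sfeLength_le {a : α} (ha : 0 < q a) :
    ((2 : ℝ) ^ sfeLength q a)⁻¹ ≤ q a / 2 := by
  have h1 : 1 / q a ≤ (2 : ℝ) ^ ⌈Real.logb 2 (1 / q a)⌉₊ := by
    rw [← Real.rpow_natCast]
    calc 1 / q a = (2 : ℝ) ^ Real.logb 2 (1 / q a) :=
          (Real.rpow_logb two_pos (by norm_num) (by positivity)).symm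
      _ ≤ _ := Real.rpow_le_rpow_of_exponent_le one_le_two (Nat.le_ceil _)
  rw [sfeLength, pow_succ, inv_le_comm₀ (by positivity) (by positivity)]
  calc (q a / 2)⁻¹ = 1 / q a * 2 := by field_simp
    _ ≤ _ := mul_le_mul_of_nonneg_right h1 zero_le_two

lemma summable_ite_lt (hs : Summable q) (a : α) :
    Summable fun b => if e b < e a then q b else 0 := by
  have := hs.indicator {b | e b < e a}
  exact this.congr fun b => by simp [Set.indicator_apply]

lemma sfeCDF_add_le (h0 : ∀ a, 0 ≤ q a) (hs : Summable q) {a b : α} (hab : e a < e b) :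
    sfeCDF e q a + q a / 2 + q b / 2 ≤ sfeCDF e q b := by
  have h1 : (∑' c, if e c < e a then q c else 0) + q a ≤ ∑' c, if e c < e b then q c else 0 := by
    classical
    rw [← tsum_ite_eq a (fun _ => q a), ← (summable_ite_lt hs a).tsum_add
      ((hasSum_ite_eq a (q a)).summable)]
    refine (((summable_ite_lt hs a).add (hasSum_ite_eq a (q a)).summable)).tsum_le_tsum
      (fun c => ?_) (summable_ite_lt hs b)
    by_cases hc : c = a
    · subst hc
      simp [hab]
    · rw [if_neg hc, add_zero]
      split_ifs with h2 h3
      · exact le_rfl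
      · exact absurd (h2.trans hab) h3
      · exact h0 c
      · exact le_rfl
  rw [sfeCDF, sfeCDF]
  linarith

lemma sfeCDF_mem_Ico (h0 : ∀ a, 0 ≤ q a) (hs : Summable q) (h1 : ∑' a, q a ≤ 1) {a : α}
    (ha : 0 < q a) : sfeCDF e q a ∈ Set.Ico (0 : ℝ) 1 := by
  classical
  have h2 : 0 ≤ ∑' b, if e b < e a then q b else 0 :=
    tsum_nonneg fun b => by split_ifs; exacts [h0 b, le_rfl]
  have h3 : (∑' c, if e c < e a then q c else 0) + q a ≤ ∑' c, q c := by
    rw [← tsum_ite_eq a (fun _ => q a), ← (summable_ite_lt hs a).tsum_add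
      ((hasSum_ite_eq a (q a)).summable)]
    refine (((summable_ite_lt hs a).add (hasSum_ite_eq a (q a)).summable)).tsum_le_tsum
      (fun c => ?_) hs
    by_cases hc : c = a
    · subst hc; simp
    · rw [if_neg hc, add_zero]
      split_ifs
      exacts [le_rfl, h0 c]
  rw [sfeCDF]
  exact ⟨by linarith, by linarith⟩

/-- The Shannon–Fano–Elias code of a (sub)probability mass function is prefix-free on its support:
two codewords with a common prefix of length `L = sfeLength q a` would come from values of the
modified distribution function less than `2 ^ (-L) ≤ q a / 2` apart. -/
lemma isPrefixFreeOn_sfeCode (h0 : ∀ a, 0 ≤ q a) (hs : Summable q) (h1 : ∑' a, q a ≤ 1) :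
    IsPrefixFreeOn (sfeCode e q) {a | 0 < q a} := by
  intro a ha b hb hab hpre
  have hFa := sfeCDF_mem_Ico (e := e) h0 hs h1 ha
  have hFb := sfeCDF_mem_Ico (e := e) h0 hs h1 hb
  have hlen : sfeLength q a ≤ sfeLength q b := by simpa [sfeCode] using hpre.length_le
  have hfloor := floor_mul_two_pow_eq hFa hFb (sfeLength q a) fun i hi => by
    have h2 := hpre.getElem (i := i) (by simpa [sfeCode] using hi)
    simpa [sfeCode] using h2
  have hpow : (0 : ℝ) < 2 ^ sfeLength q a := by positivity
  have hclose := Int.abs_sub_lt_one_of_floor_eq_floor hfloor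
  rw [← sub_mul, abs_mul, abs_of_pos hpow, ← lt_inv_mul_iff₀' hpow, mul_one] at hclose
  have hle := hclose.trans_le (two_pow_neg_sfeLength_le ha)
  have ha' : 0 < q a := ha
  have hb' : 0 < q b := hb
  rw [abs_lt] at hle
  obtain h | h := lt_or_gt_of_ne (e.injective.ne hab)
  · have := sfeCDF_add_le h0 hs h
    linarith [hle.1]
  · have := sfeCDF_add_le h0 hs h
    linarith [hle.2]

lemma length_sfeCode_le {a : α} (ha : 0 < q a) (ha1 : q a ≤ 1) :
    ((sfeCode e q a).length : ℝ) ≤ 2 + Real.logb 2 (1 / q a) := by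
  have h1 : 0 ≤ Real.logb 2 (1 / q a) :=
    Real.logb_nonneg one_lt_two ((one_le_div ha).2 ha1)
  have h2 := Nat.ceil_lt_add_one h1
  simp only [sfeCode, List.length_map, List.length_range, sfeLength]
  push_cast
  linarith

end SFE

/-! ### Coding conditionally on the dither -/

section CondPMF

variable {Ω β : Type*} [MeasurableSpace Ω] [MeasurableSpace β] {n : ℕ} {P : Measure Ω}
  [IsProbabilityMeasure P] {Z : Ω → Fin n → ℤ} {D : Ω → β}

lemma condPMF_nonneg (δ : β) (k : Fin n → ℤ) : 0 ≤ condPMF P Z D δ k := measureReal_nonneg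

lemma condPMF_le_one (δ : β) (k : Fin n → ℤ) : condPMF P Z D δ k ≤ 1 := measureReal_le_one

lemma ofReal_condPMF (δ : β) (k : Fin n → ℤ) :
    ENNReal.ofReal (condPMF P Z D δ k) = condDistrib Z D P δ {k} :=
  ofReal_measureReal

lemma tsum_ofReal_condPMF (δ : β) : ∑' k, ENNReal.ofReal (condPMF P Z D δ k) = 1 := by
  simp only [ofReal_condPMF]
  rw [← measure_univ (μ := condDistrib Z D P δ), ← Set.iUnion_of_singleton (Fin n → ℤ),
    measure_iUnion (fun a b hab => by simpa using hab) fun k => measurableSet_singleton k]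

lemma summable_condPMF (δ : β) : Summable (condPMF P Z D δ) := by
  have h := ENNReal.summable_toReal (f := fun k => ENNReal.ofReal (condPMF P Z D δ k))
    (by rw [tsum_ofReal_condPMF]; exact ENNReal.one_ne_top)
  simpa only [ENNReal.toReal_ofReal (condPMF_nonneg δ _)] using h

lemma tsum_condPMF (δ : β) : ∑' k, condPMF P Z D δ k = 1 := by
  have h := congrArg ENNReal.toReal (tsum_ofReal_condPMF (P := P) (Z := Z) (D := D) δ)
  rwa [ENNReal.tsum_toReal_eq fun _ => ENNReal.ofReal_ne_top, ENNReal.toReal_one,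
    tsum_congr fun k => ENNReal.toReal_ofReal (condPMF_nonneg δ k)] at h

lemma isPrefixFreeOn_condPMF (e : (Fin n → ℤ) ↪ ℕ) (δ : β) :
    IsPrefixFreeOn (sfeCode e (condPMF P Z D δ)) {k | 0 < condPMF P Z D δ k} :=
  isPrefixFreeOn_sfeCode (condPMF_nonneg δ) (summable_condPMF δ) (tsum_condPMF δ).le

lemma measurable_condPMF (k : Fin n → ℤ) : Measurable fun δ => condPMF P Z D δ k :=
  (Kernel.measurable_coe _ (measurableSet_singleton k)).ennreal_toReal

lemma measurable_uncurry_condPMF :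
    Measurable fun z : β × (Fin n → ℤ) => condPMF P Z D z.1 z.2 :=
  measurable_from_prod_countable_left measurable_condPMF

/-- Expectation of a function of `(D, Z)` by conditioning on `D`. -/
lemma lintegral_eq_tsum_condPMF (hZ : Measurable Z) (hD : Measurable D)
    {h : β × (Fin n → ℤ) → ℝ≥0∞} (hh : Measurable h) :
    ∫⁻ ω, h (D ω, Z ω) ∂P
      = ∫⁻ δ, ∑' k, h (δ, k) * ENNReal.ofReal (condPMF P Z D δ k) ∂(P.map D) := by
  rw [← lintegral_map hh (hD.prodMk hZ), ← compProd_map_condDistrib hZ.aemeasurable,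
    Measure.lintegral_compProd hh]
  refine lintegral_congr fun δ => ?_
  rw [lintegral_countable']
  simp only [ofReal_condPMF]

lemma condPMF_pos_ae (hZ : Measurable Z) (hD : Measurable D) :
    ∀ᵐ ω ∂P, 0 < condPMF P Z D (D ω) (Z ω) := by
  have hset : MeasurableSet {z : β × (Fin n → ℤ) | condPMF P Z D z.1 z.2 ≤ 0} :=
    measurableSet_le measurable_uncurry_condPMF measurable_const
  have h := lintegral_eq_tsum_condPMF (P := P) hZ hD
    (h := Set.indicator {z | condPMF P Z D z.1 z.2 ≤ 0} 1) (measurable_one.indicator hset)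
  have h0 : ∀ δ k, Set.indicator {z : β × (Fin n → ℤ) | condPMF P Z D z.1 z.2 ≤ 0} 1 (δ, k)
      * ENNReal.ofReal (condPMF P Z D δ k) = 0 := by
    intro δ k
    by_cases hk : condPMF P Z D δ k ≤ 0
    · rw [ENNReal.ofReal_of_nonpos hk, mul_zero]
    · rw [Set.indicator_of_notMem (by simpa using hk), zero_mul]
  simp only [h0, tsum_zero, lintegral_zero] at h
  have h' := (lintegral_eq_zero_iff (μ := P) (f := fun ω =>
    Set.indicator {z : β × (Fin n → ℤ) | condPMF P Z D z.1 z.2 ≤ 0} (fun _ => (1 : ℝ≥0∞)) (D ω, Z ω))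
    ((measurable_const.indicator hset).comp (hD.prodMk hZ))).1 h
  filter_upwards [h'] with ω hω
  by_contra hneg
  have : (D ω, Z ω) ∈ {z : β × (Fin n → ℤ) | condPMF P Z D z.1 z.2 ≤ 0} := not_lt.1 hneg
  simp [Set.indicator_of_mem this] at hω

/-- A prefix-free code is uniquely decodable on the support of the probability mass function. -/
lemma exists_decoder (hZ : Measurable Z) (hD : Measurable D) (e : (Fin n → ℤ) ↪ ℕ) :
    ∃ dec : β → List Bool → Fin n → ℤ, ∀ᵐ ω ∂P, dec (D ω) (sfeCodeword P e Z D ω) = Z ω := by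
  classical
  refine ⟨fun δ c => if hc : ∃ k, 0 < condPMF P Z D δ k ∧ sfeCode e (condPMF P Z D δ) k = c
    then hc.choose else 0, ?_⟩
  filter_upwards [condPMF_pos_ae hZ hD] with ω hω
  have hc : ∃ k, 0 < condPMF P Z D (D ω) k ∧
      sfeCode e (condPMF P Z D (D ω)) k = sfeCodeword P e Z D ω := ⟨Z ω, hω, rfl⟩
  rw [dif_pos hc]
  by_contra hne
  exact isPrefixFreeOn_condPMF e (D ω) _ hc.choose_spec.1 _ hω hne
    (by rw [hc.choose_spec.2]; exact List.prefix_rfl)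

end CondPMF

/-! ### Rate of entropy-coded dithered quantization -/

section Rate

variable {n : ℕ} {Δ : ℝ}

/-- The support of the dither. -/
def ditherCube (n : ℕ) (Δ : ℝ) : Set (Fin n → ℝ) :=
  Set.univ.pi fun _ => Set.Ico (-(Δ / 2)) (Δ / 2)

lemma measurableSet_ditherCube : MeasurableSet (ditherCube n Δ) :=
  MeasurableSet.univ_pi fun _ => measurableSet_Ico

/-- The translates of the dither support by the quantizer lattice are disjoint. -/
lemma tsum_setLIntegral_ditherCube_le (hΔ : 0 < Δ) (g : (Fin n → ℝ) → ℝ≥0∞) :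
    ∑' k : Fin n → ℤ, ∫⁻ δ in ditherCube n Δ, g ((fun i => k i * Δ) - δ) ≤ ∫⁻ y, g y := by
  set A : (Fin n → ℤ) → Set (Fin n → ℝ) := fun k => {y | (fun i => k i * Δ) - y ∈ ditherCube n Δ}
    with hA
  have hAm : ∀ k, MeasurableSet (A k) := fun k =>
    (measurable_const.sub measurable_id) measurableSet_ditherCube
  have hdisj : Pairwise (Function.onFun Disjoint A) := by
    intro k l hkl
    refine Set.disjoint_left.2 fun y hk hl => hkl (funext fun i => ?_)
    have h1 := hk i (Set.mem_univ i)
    have h2 := hl i (Set.mem_univ i)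
    simp only [Pi.sub_apply, Set.mem_Ico] at h1 h2
    have h3 : ((k i : ℝ) - l i) * Δ < 1 * Δ := by linarith [h1.2, h2.1]
    have h4 : ((l i : ℝ) - k i) * Δ < 1 * Δ := by linarith [h2.2, h1.1]
    have h5 := lt_of_mul_lt_mul_right h3 hΔ.le
    have h6 := lt_of_mul_lt_mul_right h4 hΔ.le
    have h7 : k i - l i < 1 := by exact_mod_cast h5
    have h8 : l i - k i < 1 := by exact_mod_cast h6
    omega
  have hk : ∀ k : Fin n → ℤ, ∫⁻ δ in ditherCube n Δ, g ((fun i => k i * Δ) - δ)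
      = ∫⁻ y in A k, g y := by
    intro k
    rw [← lintegral_indicator measurableSet_ditherCube, ← lintegral_indicator (hAm k),
      ← lintegral_sub_left_eq_self _ (fun i => (k i : ℝ) * Δ)]
    refine lintegral_congr fun δ => ?_
    by_cases h : (fun i => (k i : ℝ) * Δ) - δ ∈ ditherCube n Δ
    · rw [Set.indicator_of_mem h, Set.indicator_of_mem (show δ ∈ A k from h), sub_sub_cancel]
    · rw [Set.indicator_of_notMem h, Set.indicator_of_notMem (show δ ∉ A k from h)]
  simp only [hk]
  rw [← lintegral_iUnion hAm hdisj]
  exact setLIntegral_le_lintegral _ _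

lemma lintegral_ditherLaw_tsum_le (hΔ : 0 < Δ) {g : (Fin n → ℝ) → ℝ≥0∞} (hg : Measurable g) :
    ∫⁻ δ, ∑' k : Fin n → ℤ, ENNReal.ofReal Δ ^ n * g ((fun i => k i * Δ) - δ) ∂ditherLaw n Δ
      ≤ ∫⁻ y, g y := by
  have hvol : volume (ditherCube n Δ) = ENNReal.ofReal Δ ^ n := by
    rw [ditherCube, Real.volume_pi_Ico]
    simp
  have h0 : ENNReal.ofReal Δ ^ n ≠ 0 := pow_ne_zero _ (by simpa using hΔ)
  have htop : ENNReal.ofReal Δ ^ n ≠ ∞ := ENNReal.pow_ne_top ENNReal.ofReal_ne_top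
  have hm : ∀ k : Fin n → ℤ, Measurable fun δ : Fin n → ℝ => g ((fun i => (k i : ℝ) * Δ) - δ) :=
    fun k => hg.comp (measurable_const.sub measurable_id)
  have hlaw : ditherLaw n Δ = (ENNReal.ofReal Δ ^ n)⁻¹ • volume.restrict (ditherCube n Δ) := by
    rw [← hvol]; rfl
  rw [hlaw, lintegral_smul_measure,
    lintegral_tsum fun k => ((hm k).const_mul _).aemeasurable]
  simp only [lintegral_const_mul _ (hm _), ENNReal.tsum_mul_left, smul_eq_mul]
  rw [← mul_assoc, ENNReal.inv_mul_cancel h0 htop, one_mul]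
  exact tsum_setLIntegral_ditherCube_le hΔ g

variable {Ω : Type*} [MeasurableSpace Ω] {P : Measure Ω} [IsProbabilityMeasure P]
  {Z : Ω → Fin n → ℤ} {D Y : Ω → Fin n → ℝ} {V : Matrix (Fin n) (Fin n) ℝ}

/-- The comparison weight `Δⁿ g(k Δ - δ)` of the index `z = (δ, k)`, where `g` is the centered Gaussian
density with covariance `V`. For a fixed dither `δ` the weights need not sum to one, but the
average of their sum over the dither is one. -/
noncomputable def cellWeight (Δ : ℝ) (V : Matrix (Fin n) (Fin n) ℝ)
    (z : (Fin n → ℝ) × (Fin n → ℤ)) : ℝ :=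
  Δ ^ n * gaussianDensity V ((fun i => z.2 i * Δ) - z.1)

lemma cellWeight_pos (hΔ : 0 < Δ) (hV : V.PosDef) (z : (Fin n → ℝ) × (Fin n → ℤ)) :
    0 < cellWeight Δ V z :=
  mul_pos (pow_pos hΔ n) (gaussianDensity_pos hV _)

lemma measurable_cellWeight : Measurable (cellWeight Δ V) := by
  have h : Measurable fun z : (Fin n → ℝ) × (Fin n → ℤ) => (fun i => (z.2 i : ℝ) * Δ) - z.1 := by
    refine Measurable.sub (measurable_pi_lambda _ fun i => ?_) measurable_fst
    exact (measurable_from_top.comp ((measurable_pi_apply i).comp measurable_snd)).mul_const Δ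
  exact (measurable_gaussianDensity.comp h).const_mul _

/-- The likelihood ratio appearing in Gibbs' inequality has mean at most one. -/
lemma lintegral_cellWeight_div_le (hΔ : 0 < Δ) (hV : V.PosDef) (hZ : Measurable Z)
    (hD : Measurable D) (hlaw : P.map D = ditherLaw n Δ) :
    ∫⁻ ω, ENNReal.ofReal (cellWeight Δ V (D ω, Z ω) / condPMF P Z D (D ω) (Z ω)) ∂P ≤ 1 := by
  rw [lintegral_eq_tsum_condPMF hZ hD (h := fun z =>
      ENNReal.ofReal (cellWeight Δ V z / condPMF P Z D z.1 z.2))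
    (measurable_cellWeight.div measurable_uncurry_condPMF).ennreal_ofReal, hlaw]
  calc _ ≤ ∫⁻ δ, ∑' k : Fin n → ℤ, ENNReal.ofReal Δ ^ n
          * ENNReal.ofReal (gaussianDensity V ((fun i => k i * Δ) - δ)) ∂ditherLaw n Δ := by
        refine lintegral_mono fun δ => ENNReal.tsum_le_tsum fun k => ?_
        rw [← ENNReal.ofReal_pow hΔ.le, ← ENNReal.ofReal_mul (pow_pos hΔ n).le,
          ← ENNReal.ofReal_mul' (condPMF_nonneg δ k)]
        refine ENNReal.ofReal_le_ofReal ?_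
        obtain h | h := (condPMF_nonneg (P := P) (Z := Z) (D := D) δ k).eq_or_lt'
        · rw [h, mul_zero]
          exact (cellWeight_pos hΔ hV (δ, k)).le
        · rw [div_mul_cancel₀ _ h.ne']
          rfl
    _ ≤ ∫⁻ y, ENNReal.ofReal (gaussianDensity V y) :=
        lintegral_ditherLaw_tsum_le hΔ measurable_gaussianDensity.ennreal_ofReal
    _ = 1 := lintegral_gaussianDensity hV

/-- The expected length of the codeword is bounded through Gibbs' inequality, comparing the
conditional probability mass function with the Gaussian cell weights. -/
lemma lintegral_length_le (hΔ : 0 < Δ) (hV : V.PosDef) (hZ : Measurable Z)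
    (hD : Measurable D) (hlaw : P.map D = ditherLaw n Δ) (hY : ∀ ω i, Y ω i = Z ω i * Δ - D ω i)
    (hY2 : IsL2 P Y) (hcov : secondMoment P Y Y = V) (e : (Fin n → ℤ) ↪ ℕ) :
    ∫⁻ ω, ((sfeCodeword P e Z D ω).length : ℝ≥0∞) ∂P
      ≤ ENNReal.ofReal (2 + n / 2 * Real.logb 2 (2 * Real.pi * Real.exp 1 / Δ ^ 2)
          + Real.logb 2 V.det / 2) := by
  have hlog2 : 0 < Real.log 2 := Real.log_pos one_lt_two
  set ρ : Ω → ℝ := fun ω => cellWeight Δ V (D ω, Z ω) / condPMF P Z D (D ω) (Z ω) with hρ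
  have hρ0 : ∀ ω, 0 ≤ ρ ω := fun ω => div_nonneg (cellWeight_pos hΔ hV _).le (condPMF_nonneg _ _)
  have hρm : Measurable ρ :=
    (measurable_cellWeight.div measurable_uncurry_condPMF).comp (hD.prodMk hZ)
  have hρle : ∫⁻ ω, ENNReal.ofReal (ρ ω) ∂P ≤ 1 := lintegral_cellWeight_div_le hΔ hV hZ hD hlaw
  have hρint : Integrable ρ P := by
    refine ⟨hρm.aestronglyMeasurable, ?_⟩
    rw [hasFiniteIntegral_iff_ofReal (.of_forall hρ0)]
    exact hρle.trans_lt ENNReal.one_lt_top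
  have hρle' : ∫ ω, ρ ω ∂P ≤ 1 := by
    rw [integral_eq_lintegral_of_nonneg_ae (.of_forall hρ0) hρm.aestronglyMeasurable]
    exact ENNReal.toReal_le_of_le_ofReal zero_le_one (by simpa using hρle)
  have hlogw : ∀ ω, Real.log (cellWeight Δ V (D ω, Z ω))
      = n * Real.log Δ + Real.log (gaussianDensity V (Y ω)) := by
    intro ω
    have : (fun i => (Z ω i : ℝ) * Δ) - D ω = Y ω := funext fun i => (hY ω i).symm
    rw [cellWeight, this, Real.log_mul (pow_pos hΔ n).ne' (gaussianDensity_pos hV _).ne',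
      Real.log_pow]
  have hlogint := integrable_log_gaussianDensity hV hY2
  set G : Ω → ℝ := fun ω => 2 + (-(n * Real.log Δ + Real.log (gaussianDensity V (Y ω)))
    + (ρ ω - 1)) / Real.log 2 with hG
  have hi1 : Integrable (fun ω => -(n * Real.log Δ + Real.log (gaussianDensity V (Y ω)))) P :=
    ((integrable_const _).add hlogint).neg
  have hi2 : Integrable (fun ω => ρ ω - 1) P := hρint.sub (integrable_const 1)
  have hi3 : Integrable (fun ω => (-(n * Real.log Δ + Real.log (gaussianDensity V (Y ω)))
    + (ρ ω - 1)) / Real.log 2) P := (hi1.add hi2).div_const _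
  have hGint : Integrable G P := (integrable_const _).add hi3
  have hle : ∀ᵐ ω ∂P, ((sfeCodeword P e Z D ω).length : ℝ) ≤ G ω := by
    filter_upwards [condPMF_pos_ae (P := P) hZ hD] with ω hω
    refine (length_sfeCode_le hω (condPMF_le_one _ _)).trans (add_le_add_right ?_ 2)
    rw [Real.logb, div_le_div_iff_of_pos_right hlog2, one_div, Real.log_inv, ← hlogw]
    have hw := cellWeight_pos hΔ hV (D ω, Z ω)
    have h1 := Real.log_le_sub_one_of_pos (div_pos hw hω)
    rw [Real.log_div hw.ne' hω.ne'] at h1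
    change _ ≤ ρ ω - 1 at h1
    linarith
  have hG0 : 0 ≤ᵐ[P] G := hle.mono fun ω hω => (Nat.cast_nonneg _).trans hω
  have hGval : ∫ ω, G ω ∂P ≤ 2 + n / 2 * Real.logb 2 (2 * Real.pi * Real.exp 1 / Δ ^ 2)
      + Real.logb 2 V.det / 2 := by
    have h1 : ∫ ω, G ω ∂P = 2 + (-(n * Real.log Δ + -(n * Real.log (2 * Real.pi)
        + Real.log V.det + n) / 2) + (∫ ω, ρ ω ∂P - 1)) / Real.log 2 := by
      rw [hG, integral_add (integrable_const _) hi3, integral_div, integral_add hi1 hi2,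
        integral_neg, integral_add (integrable_const _) hlogint,
        integral_sub hρint (integrable_const 1), integral_log_gaussianDensity hV hY2 hcov]
      simp
    have h2 : Real.log (2 * Real.pi * Real.exp 1 / Δ ^ 2)
        = Real.log (2 * Real.pi) + 1 - 2 * Real.log Δ := by
      rw [Real.log_div (by positivity) (by positivity), Real.log_mul (by positivity)
        (Real.exp_pos 1).ne', Real.log_exp, Real.log_pow]
      norm_num
    rw [h1, Real.logb, Real.logb, h2]
    have h3 : (-(n * Real.log Δ + -(n * Real.log (2 * Real.pi) + Real.log V.det + n) / 2)
        + (∫ ω, ρ ω ∂P - 1)) / Real.log 2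
        ≤ (-(n * Real.log Δ + -(n * Real.log (2 * Real.pi) + Real.log V.det + n) / 2))
          / Real.log 2 := by
      rw [div_le_div_iff_of_pos_right hlog2]
      linarith
    refine (add_le_add_right h3 2).trans (le_of_eq ?_)
    field_simp
    ring
  calc ∫⁻ ω, ((sfeCodeword P e Z D ω).length : ℝ≥0∞) ∂P
      ≤ ∫⁻ ω, ENNReal.ofReal (G ω) ∂P := by
        refine lintegral_mono_ae (hle.mono fun ω hω => ?_)
        rw [← ENNReal.ofReal_natCast]
        exact ENNReal.ofReal_le_ofReal hω
    _ = ENNReal.ofReal (∫ ω, G ω ∂P) := (ofReal_integral_eq_lintegral_ofReal hGint hG0).symm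
    _ ≤ _ := ENNReal.ofReal_le_ofReal hGval

end Rate

/-! ### Time averages -/

section Averages

variable {n m p : ℕ}

lemma tendsto_average_ofReal {a : ℕ → ℝ} {L : ℝ} (h : Tendsto a atTop (𝓝 L)) :
    Tendsto (fun T : ℕ => (∑ t ∈ Finset.range T, ENNReal.ofReal (a t)) / T) atTop
      (𝓝 (ENNReal.ofReal L)) := by
  have h1 : Tendsto (fun t => max (a t) 0) atTop (𝓝 (max L 0)) := h.max tendsto_const_nhds
  have h2 := (ENNReal.continuous_ofReal.tendsto _).comp h1.cesaro
  have hmax : ∀ r : ℝ, ENNReal.ofReal (max r 0) = ENNReal.ofReal r := fun r => by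
    rw [ENNReal.ofReal_max, ENNReal.ofReal_zero, max_eq_left zero_le]
  rw [hmax] at h2
  refine h2.congr' ?_
  filter_upwards [eventually_gt_atTop 0] with T hT
  have hT' : (0 : ℝ) < T := by exact_mod_cast hT
  simp only [Function.comp]
  rw [mul_comm, ← div_eq_mul_inv, ENNReal.ofReal_div_of_pos hT', ENNReal.ofReal_natCast,
    ENNReal.ofReal_sum_of_nonneg fun t _ => le_max_right _ _]
  simp only [hmax]

lemma measurable_quantIndex (Δ : ℝ) : Measurable (quantIndex Δ : (Fin n → ℝ) → Fin n → ℤ) := by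
  refine measurable_pi_lambda _ fun i => Int.measurable_floor.comp ?_
  fun_prop

lemma IsQuantizedLoop.measurable_zidx {Ω : Type*} [MeasurableSpace Ω] {P : Measure Ω}
    [IsProbabilityMeasure P] {M : Plant n m p} {C : Matrix (Fin n) (Fin n) ℝ}
    {K : Matrix (Fin p) (Fin n ⊕ Fin m) ℝ} {x w : ℕ → Ω → Fin n ⊕ Fin m → ℝ}
    {d xtil y xhat : ℕ → Ω → Fin n → ℝ} {zidx : ℕ → Ω → Fin n → ℤ} {u : ℕ → Ω → Fin p → ℝ} {Δ : ℝ}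
    (h : IsQuantizedLoop M K C Δ P x w d xtil zidx y xhat u) (t : ℕ) : Measurable (zidx t) := by
  rw [show zidx t = fun ω => quantIndex Δ (C *ᵥ (fstPart (x t ω) - xtil t ω) + d t ω) from
    funext (h.quant t)]
  exact (measurable_quantIndex Δ).comp (((h.measurable_signal_past t).mono
    (h.primitive.past_le _ _) le_rfl).add (h.primitive.measurable_v t))

/-- The expected codeword length is at most the overhead plus the information rate of a Gaussian
channel with unit noise and error covariance given by the Riccati recursion. The overhead splits
into `2` from rounding in the code, and `(1/2) log₂ (2πe/12)` per coordinate from the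
non-Gaussianity of the dither; the stated constant has a larger argument of the logarithm. -/
lemma IsQuantizedLoop.lintegral_length_le {Ω : Type*} [MeasurableSpace Ω] {P : Measure Ω}
    [IsProbabilityMeasure P] {M : Plant n m p} {C : Matrix (Fin n) (Fin n) ℝ}
    {K : Matrix (Fin p) (Fin n ⊕ Fin m) ℝ} {x w : ℕ → Ω → Fin n ⊕ Fin m → ℝ}
    {d xtil y xhat : ℕ → Ω → Fin n → ℝ} {zidx : ℕ → Ω → Fin n → ℤ} {u : ℕ → Ω → Fin p → ℝ} {Δ : ℝ}
    (h : IsQuantizedLoop M K C Δ P x w d xtil zidx y xhat u) (hΔ : 0 < Δ) (hΔ2 : Δ ^ 2 / 12 = 1)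
    {S : Matrix (Fin n) (Fin n) ℝ} (hS0 : S.PosSemidef)
    (hS : HasErrorCov P (fun ω => fstPart (x 0 ω)) (obsSpan y x 0 1) S)
    (e : (Fin n → ℤ) ↪ ℕ) (t : ℕ) :
    ∫⁻ ω, ((sfeCodeword P e (zidx t) (d t) ω).length : ℝ≥0∞) ∂P ≤
      ENNReal.ofReal (overhead n
        + Real.logb 2 (C * (M.riccati C)^[t] S * Cᵀ + 1).det / 2) := by
  have hV : (C * (M.riccati C)^[t] S * Cᵀ + 1).PosDef :=
    innovation_posDef C .one (Plant.iterate_riccati_posSemidef hS0 t)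
  refine (LQGSI.lintegral_length_le hΔ hV (h.measurable_zidx t) (h.primitive.measurable_v t)
    (h.primitive.law_v t) (h.reconstruct_eq_index t) ((h.isSecondOrderLoop hΔ hΔ2).l2_y t)
    (h.secondMoment_reconstruct hΔ hΔ2 hS t) e).trans (ENNReal.ofReal_le_ofReal ?_)
  have h12 : Δ ^ 2 = 12 := by linarith
  have hpi := Real.pi_pos
  have hlog : Real.logb 2 (2 * Real.pi * Real.exp 1 / 12)
      ≤ Real.logb 2 (4 * Real.pi * Real.exp 1 / 12) := by
    refine Real.logb_le_logb_of_le one_lt_two (by positivity) ?_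
    gcongr
    norm_num
  rw [h12, overhead]
  have := mul_le_mul_of_nonneg_left hlog (by positivity : (0 : ℝ) ≤ n / 2)
  linarith

end Averages

end LQGSI

theorem theorem2 {n m p : ℕ} (M : Plant n m p)
    (S : Matrix (Fin n ⊕ Fin m) (Fin n ⊕ Fin m) ℝ) (hS : M.IsStabilizingSolution S)
    (C₁ : Matrix (Fin n) (Fin n) ℝ)
    -- the Gaussian three-stage test channel
    {Ω : Type*} [MeasurableSpace Ω] (P : Measure Ω) [IsProbabilityMeasure P]
    (xG wG : ℕ → Ω → Fin n ⊕ Fin m → ℝ) (vG yG xhatG : ℕ → Ω → Fin n → ℝ)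
    (uG : ℕ → Ω → Fin p → ℝ)
    (hG : IsGaussianLoop M (M.gain S) C₁ P xG wG vG yG xhatG uG)
    -- the quantized loop with step `Δ = 2√3`
    {Ω' : Type*} [MeasurableSpace Ω'] (P' : Measure Ω') [IsProbabilityMeasure P']
    (x w : ℕ → Ω' → Fin n ⊕ Fin m → ℝ) (d xtil : ℕ → Ω' → Fin n → ℝ)
    (zidx : ℕ → Ω' → Fin n → ℤ) (y xhat : ℕ → Ω' → Fin n → ℝ) (u : ℕ → Ω' → Fin p → ℝ)
    (hQ : IsQuantizedLoop M (M.gain S) C₁ (2 * √3) P' x w d xtil zidx y xhat u)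
    -- the initial states have the same first and second moments
    (hmean : ∀ i, ∫ ω, x 0 ω i ∂P' = ∫ ω, xG 0 ω i ∂P)
    (hsecond : ∀ i j, ∫ ω, x 0 ω i * x 0 ω j ∂P' = ∫ ω, xG 0 ω i * xG 0 ω j ∂P)
    -- the enumeration of the alphabet, and the codewords
    (e : (Fin n → ℤ) ↪ ℕ) (a : ℕ → Ω' → List Bool)
    (ha : ∀ t ω, a t ω = sfeCodeword P' e (zidx t) (d t) ω) :
    -- the code used at time `t` is prefix-free and lossless
    (∀ t, (∀ δ, IsPrefixFreeOn (sfeCode e (condPMF P' (zidx t) (d t) δ))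
          {k | 0 < condPMF P' (zidx t) (d t) δ k}) ∧
        ∃ D : (Fin n → ℝ) → List Bool → Fin n → ℤ, ∀ᵐ ω ∂P', D (d t ω) (a t ω) = zidx t ω) ∧
    -- bound by the directed information
    limsup (fun T : ℕ => avgLength P' a T) atTop ≤
      limsup (fun T : ℕ => directedInfo P xG yG (fun t ω => sndPart (xG t ω)) T / T) atTop
        + ENNReal.ofReal (overhead n) ∧
    -- bound by the value of the log-determinant program, for `C₁` obtained from a minimizer
    (∀ (γ : ℝ) (Phat Pi : Matrix (Fin n) (Fin n) ℝ), M.IsMinimizer S γ Phat Pi →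
      C₁ᵀ * C₁ = Phat⁻¹ - (M.Ptilde Phat)⁻¹ →
      limsup (fun T : ℕ => directedInfo P xG yG (fun t ω => sndPart (xG t ω)) T / T) atTop =
          ENNReal.ofReal ((Real.logb 2 (M.Ptilde Phat).det - Real.logb 2 Phat.det) / 2) ∧
        limsup (fun T : ℕ => avgLength P' a T) atTop ≤
          ENNReal.ofReal (overhead n
            + (Real.logb 2 (M.Ptilde Phat).det - Real.logb 2 Phat.det) / 2)) := by
  have hΔ : (0 : ℝ) < 2 * √3 := by positivity
  have hΔ2 : (2 * √3) ^ 2 / 12 = (1 : ℝ) := by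
    rw [mul_pow, Real.sq_sqrt (by norm_num)]
    norm_num
  have hG2 := hG.isSecondOrderLoop
  have hQ2 := hQ.isSecondOrderLoop hΔ hΔ2
  have hz : ∀ t, Measurable (zidx t) := hQ.measurable_zidx
  have hd := hQ.primitive.measurable_v
  -- Both loops start from the same error covariance `S₀`.
  have hQ0 := hQ.hasErrorCov hΔ hΔ2 0
  have hG0 := hasErrorCov_init (y := yG) (hG2.l2_x 0) (hQ2.l2_x 0) hmean hsecond hQ0
  have hS0 := hQ0.posSemidef
  generalize secondMoment P' (fun ω => fstPart (x 0 ω) - xtil 0 ω)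
    (fun ω => fstPart (x 0 ω) - xtil 0 ω) = S₀ at hQ0 hG0 hS0
  set r : ℕ → ℝ := fun t => Real.logb 2 (C₁ * (M.riccati C₁)^[t] S₀ * C₁ᵀ + 1).det / 2 with hr
  have hDI : (fun T : ℕ => directedInfo P xG yG (fun t ω => sndPart (xG t ω)) T / T)
      = fun T : ℕ => (∑ t ∈ Finset.range T, ENNReal.ofReal (r t)) / T :=
    funext fun T => by
      rw [directedInfo, Finset.sum_congr rfl fun t _ => hG.condMutualInfo_eq hG0 t]
  have hlen : ∀ T, avgLength P' a T
      ≤ (∑ t ∈ Finset.range T, ENNReal.ofReal (overhead n + r t)) / T := fun T => by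
    refine ENNReal.div_le_div_right (Finset.sum_le_sum fun t _ => ?_) _
    simp only [ha]
    exact hQ.lintegral_length_le hΔ hΔ2 hS0 hQ0 e t
  refine ⟨fun t => ⟨isPrefixFreeOn_condPMF e, ?_⟩, ?_, fun γ Phat Pi hmin hC => ?_⟩
  · obtain ⟨D, hD⟩ := exists_decoder (P := P') (hz t) (hd t) e
    exact ⟨D, by simpa only [ha] using hD⟩
  · rw [hDI, ← limsup_add_const]
    · refine limsup_le_limsup (.of_forall fun T => (hlen T).trans ?_)
      calc (∑ t ∈ Finset.range T, ENNReal.ofReal (overhead n + r t)) / T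
          ≤ (∑ t ∈ Finset.range T, (ENNReal.ofReal (r t) + ENNReal.ofReal (overhead n))) / T :=
            ENNReal.div_le_div_right (Finset.sum_le_sum fun t _ => by
              rw [add_comm (overhead n)]; exact ENNReal.ofReal_add_le) _
        _ ≤ (∑ t ∈ Finset.range T, ENNReal.ofReal (r t)) / T + ENNReal.ofReal (overhead n) := by
            rw [Finset.sum_add_distrib, ENNReal.add_div, Finset.sum_const, Finset.card_range,
              nsmul_eq_mul]
            exact add_le_add_right (ENNReal.div_le_of_le_mul (le_of_eq (mul_comm _ _))) _
    all_goals isBoundedDefault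
  · have hlim := Plant.tendsto_logb_det_innovation hS0 hmin.1.posDef_Phat hC
    rw [hDI]
    refine ⟨(tendsto_average_ofReal hlim).limsup_eq, ?_⟩
    exact (limsup_le_limsup (.of_forall hlen)).trans
      (tendsto_average_ofReal (hlim.const_add (overhead n))).limsup_eq.le
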